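/- Let $m\ge 1$, let $\kappa=(k_0,\dots,k_m)$ be a vector of positive integers, let $\eta_0\in\mathbb R$, and let $a_j=r_je^{2\pi i\eta_j}$ with $r_j>1$ and $\eta_j\in\mathbb R$ for $j=1,\dots,m$, where $\eta_1=0$ (so $a_1>1$ is real). Consider the Blaschke-type product $$B(z)=B_{\mu\kappa}(z)=e^{2\pi i\eta_0}z^{k_0}\prod_{j=1}^m\left(\frac{z-a_j}{1-\overline{a}_jz}\right)^{k_j},$$ a rational map of the Riemann sphere $\overline{\mathbb C}$ that maps the unit circle $\mathbb S^1$ to itself. A continuous map $g:\mathbb S^1\to\mathbb S^1$ is called $2m$-multimodal if it has exactly $2m$ turning points, that is, points of $\mathbb S^1$ at which a lift $F:\mathbb R\to\mathbb R$ of $g$ under $t\mapsto e^{2\pi it}$ has a local maximum or minimum. If the restriction $B|_{\mathbb S^1}$ is $2m$-multimodal, then there are analytic Jordan curves $\Gamma_1,\dots,\Gamma_m\subset\mathbb C$ such that $$B^{-1}(\mathbb S^1)=\mathbb S^1\cup\Gamma_1\cup\cdots\cup\Gamma_m,$$ where $B^{-1}(\mathbb S^1)$ is the full preimage in $\overline{\mathbb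 C}$, and the following properties hold: (a) each $\Gamma_j$ is symmetric under the inversion $z\mapsto 1/\overline z$ about $\mathbb S^1$; (b) for each $j$, $\Gamma_j\cap\mathbb S^1=\{c_j',c_j''\}$, where $c_j',c_j''$ are distinct critical points of $B$; (c) if $D_j$ denotes the topological open disk in $\mathbb C$ bounded by $\Gamma_j$, then the closures of $D_1,\dots,D_m$ are pairwise disjoint, and $D_j$ contains $a_j$ and $1/\overline{a}_j$ for every $j$. -/

import Mathlib

open Complex ComplexConjugate

noncomputable section

namespace BlaschkeType

/-! ### Multimodal circle maps -/

/-- `F : ℝ → ℝ` is a lift of the circle map `g` with respect to the covering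
`t ↦ exp (2π i t)`. -/
def IsLift (F : ℝ → ℝ) (g : Circle → Circle) : Prop :=
  Continuous F ∧
    ∀ t : ℝ, Circle.exp (2 * Real.pi * F t) = g (Circle.exp (2 * Real.pi * t))

/-- A turning point of a circle map: a point at which a lift has a local maximum or a local
minimum (lifts of a continuous map differ by integer constants, so the choice is immaterial). -/
def IsTurningPoint (g : Circle → Circle) (c : Circle) : Prop :=
  ∃ F : ℝ → ℝ, IsLift F g ∧
    ∃ t : ℝ, Circle.exp (2 * Real.pi * t) = c ∧ IsLocalExtr F t

/-- A circle map is `n`-multimodal if it is continuous and has exactly `n` turning points.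
(Local extrema are not required to be strict, so an interval of constancy would produce
infinitely many of them: an `n`-multimodal map is strictly monotone between consecutive
turning points.) -/
def IsMultimodal (n : ℕ) (g : Circle → Circle) : Prop :=
  Continuous g ∧ {c : Circle | IsTurningPoint g c}.encard = n

/-! ### The family of Blaschke-type products -/

/-- The parameters `μ = (η₀, a₁, r₂, η₂, …, rₘ, ηₘ)`; the index set `{1, …, m}` is `Fin m`,
and `a₁ = r₁ > 1` is real, that is, `η₁ = 0`. -/
structure Param (m : ℕ) where
  η₀ : ℝ
  r : Fin m → ℝ
  η : Fin m → ℝ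
  one_lt_r : ∀ j, 1 < r j
  η_first : ∀ h : 0 < m, η ⟨0, h⟩ = 0

variable {m : ℕ}

/-- `a_j = r_j exp (2π i η_j)`. -/
def Param.a (μ : Param m) (j : Fin m) : ℂ :=
  (μ.r j : ℂ) * cexp (2 * Real.pi * I * (μ.η j : ℂ))

/-- The formula for `B_{μκ}` in the finite plane, away from its poles `1 / conj a_j`:
`exp (2π i η₀) z ^ k₀ ∏ ((z - a_j) / (1 - conj a_j z)) ^ k_j`. -/
def blaschke (μ : Param m) (κ : Fin (m + 1) → ℕ) (z : ℂ) : ℂ :=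
  cexp (2 * Real.pi * I * (μ.η₀ : ℂ)) * z ^ κ 0 *
    ∏ j : Fin m, ((z - μ.a j) / (1 - conj (μ.a j) * z)) ^ κ j.succ

open Classical in
/-- `B_{μκ}` as a self-map of the Riemann sphere (for positive exponents `k_j`): the poles are
`∞` and the points `z` with `1 - conj a_j z = 0` for some `j`. -/
def blaschkeSphere (μ : Param m) (κ : Fin (m + 1) → ℕ) : OnePoint ℂ → OnePoint ℂ
  | none => OnePoint.infty
  | some z =>
    if ∃ j, 1 - conj (μ.a j) * z = 0 then OnePoint.infty
    else ((blaschke μ κ z : ℂ) : OnePoint ℂ)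

theorem Param.norm_a (μ : Param m) (j : Fin m) : ‖μ.a j‖ = μ.r j := by
  have h : (2 * Real.pi * I * (μ.η j : ℂ)) = ((2 * Real.pi * μ.η j : ℝ) : ℂ) * I := by
    push_cast; ring
  rw [Param.a, norm_mul, h, norm_exp_ofReal_mul_I, mul_one, norm_real, Real.norm_eq_abs,
    abs_of_pos (by linarith [μ.one_lt_r j])]

theorem norm_blaschke (μ : Param m) (κ : Fin (m + 1) → ℕ) {z : ℂ} (hz : ‖z‖ = 1) :
    ‖blaschke μ κ z‖ = 1 := by
  have h : (2 * Real.pi * I * (μ.η₀ : ℂ)) = ((2 * Real.pi * μ.η₀ : ℝ) : ℂ) * I := by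
    push_cast; ring
  rw [blaschke, norm_mul, norm_mul, h, norm_exp_ofReal_mul_I, norm_pow, hz, one_pow, one_mul,
    one_mul, norm_prod]
  refine Finset.prod_eq_one fun j _ => ?_
  have hzz : conj z * z = 1 := by
    rw [mul_comm, mul_conj, normSq_eq_norm_sq, hz]; norm_num
  have e : 1 - conj (μ.a j) * z = conj (z - μ.a j) * z := by
    rw [map_sub, sub_mul, hzz]
  have hne : z - μ.a j ≠ 0 := by
    intro h0
    have h1 : z = μ.a j := sub_eq_zero.mp h0
    have h2 := μ.norm_a j
    have h3 := μ.one_lt_r j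
    rw [← h1, hz] at h2
    linarith
  rw [norm_pow, norm_div, e, norm_mul, hz, mul_one, RCLike.norm_conj,
    div_self (norm_ne_zero_iff.mpr hne), one_pow]

/-- `f_{μκ}`, the restriction of `B_{μκ}` to the unit circle. -/
def circleRestriction (μ : Param m) (κ : Fin (m + 1) → ℕ) (z : Circle) : Circle :=
  ⟨blaschke μ κ z, mem_sphere_zero_iff_norm.mpr (norm_blaschke μ κ z.norm_coe)⟩

/-- The critical points of a function holomorphic near `c`. -/
def IsCriticalPoint (f : ℂ → ℂ) (c : ℂ) : Prop :=
  AnalyticAt ℂ f c ∧ deriv f c = 0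

/-! ### Curves and disks in the plane -/

/-- A Jordan curve: the image of the circle under a continuous injective map. -/
def IsJordanCurve (Γ : Set ℂ) : Prop :=
  ∃ γ : Circle → ℂ, Continuous γ ∧ Function.Injective γ ∧ Set.range γ = Γ

/-- An analytic Jordan curve: a Jordan curve every point of which has an open neighbourhood `U`
and an injective holomorphic map on `U` under which `Γ ∩ U` is the preimage of the real
line. -/
def IsAnalyticJordanCurve (Γ : Set ℂ) : Prop :=
  IsJordanCurve Γ ∧
    ∀ p ∈ Γ, ∃ (U : Set ℂ) (φ : ℂ → ℂ), IsOpen U ∧ p ∈ U ∧ DifferentiableOn ℂ φ U ∧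
      Set.InjOn φ U ∧ Γ ∩ U = {z ∈ U | (φ z).im = 0}

/-- `D` is the topological open disk in the plane bounded by the curve `Γ`: a bounded open set,
homeomorphic to the open unit disk, with boundary `Γ`. (For a Jordan curve `Γ` there is exactly
one such set, the bounded component of the complement of `Γ`.) -/
def IsOpenDiskBoundedBy (D Γ : Set ℂ) : Prop :=
  IsOpen D ∧ Bornology.IsBounded D ∧ Nonempty (D ≃ₜ Metric.ball (0 : ℂ) 1) ∧ frontier D = Γ

/-- A set that is symmetric under the inversion `z ↦ 1 / conj z` about the unit circle. -/
def IsInversionSymmetric (Γ : Set ℂ) : Prop :=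
  (0 : ℂ) ∉ Γ ∧ (fun z : ℂ => 1 / conj z) '' Γ = Γ

end BlaschkeType

end

noncomputable section

namespace BlaschkeType

open Set Metric Filter Topology

section

/-! ### Local lemmas on analytic functions -/

/-! The logarithmic derivative `z B' / B` has a polynomial numerator `critPoly` of degree at most
`2m`. A turning point of the circle map is a zero of `B'`, hence a root of `critPoly`, so `2m`
turning points use up all the roots: each is simple and lies on the circle
(`hasCircleCriticalPoints`). Off the circle `B` is therefore unramified except over `0` and `∞`, and
on the circle it has only folds of order two.

Cut the closed unit disc along `|B| = 1`. Where `0 < |B| < 1` or `1 < |B| < ∞`, the map `B` or `1/B`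
is a covering of the punctured disc, so every component of the low region `|B| < 1` or the high
region `|B| > 1` is a disc around one zero or pole, on which the map becomes `w ↦ w ^ k`
(`exists_openParam`, `subset_iUnion`). The parametrization extends to the closed disc, and stays
injective because near each point of the circle `B` is injective on the inner side: at a fold this
says that squaring is injective on the upper half-plane. Since `0` is the only zero inside, the low
region is one disc. The high region consists of `m` discs around the points `1 / conj a_j`, with
pairwise disjoint closures `T_j` (`disjoint_param`).

It remains to see how `T_j` meets the circle. The intersection is closed, and relatively open at
noncritical points. It is not the whole circle, since `T_j` would then fill the disc and contain
`0`; it is not empty, since the boundary of `T_j` would then be split off from the connected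
boundary curve of the low region, which also passes through the critical points. By connectedness
`T_j` contains at least two critical points (`exists_two_critical`). As there are `2m` of them and
the `m` sets `T_j` are disjoint, each contains exactly two (`card_critical`), and `T_j` meets the
circle in an arc between them.

Doubling `T_j` across that arc by `z ↦ 1 / conj z`, which commutes with `B`, gives the closed disc
bounded by `Γ_j`. Away from the circle `Γ_j` is a regular level curve of `|B|`. At a fold the level
set `|B| = 1` is a cross `Re G * Im G = 0` in a local coordinate `G`; one branch is the circle and
the other is `Γ_j`, which is therefore analytic there too. -/

theorem exists_nhds_injOn_of_deriv_ne_zero {f : ℂ → ℂ} {z : ℂ} (hf : AnalyticAt ℂ f z)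
    (hd : deriv f z ≠ 0) : ∃ N ∈ 𝓝 z, InjOn f N := by
  have h := (hf.hasStrictDerivAt).hasStrictFDerivAt_equiv hd
  exact ⟨_, (h.toOpenPartialHomeomorph f).open_source.mem_nhds
    h.mem_toOpenPartialHomeomorph_source, (h.toOpenPartialHomeomorph f).injOn⟩

/-- An analytic function with a zero of order `k > 0` is the `k`-th power of a local
coordinate. -/
theorem exists_root_of_analyticOrderAt {f : ℂ → ℂ} {p : ℂ} (hf : AnalyticAt ℂ f p)
    {k : ℕ} (hk : 0 < k) (ho : analyticOrderAt f p = k) :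
    ∃ χ : ℂ → ℂ, AnalyticAt ℂ χ p ∧ χ p = 0 ∧ deriv χ p ≠ 0 ∧ ∀ᶠ z in 𝓝 p, f z = χ z ^ k := by
  obtain ⟨h, ha, hne, he⟩ := (hf.analyticOrderAt_eq_natCast).1 ho
  obtain ⟨c, hc⟩ := IsAlgClosed.exists_pow_nat_eq (h p) hk
  have hc0 : c ≠ 0 := by rintro rfl; exact hne (by rw [← hc, zero_pow hk.ne'])
  -- Dividing by `h p` keeps the base of the power near `1`, where the principal root is analytic;
  -- `c` restores the constant.
  set g : ℂ → ℂ := fun z => c * (h z / h p) ^ (1 / (k : ℂ)) with hg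
  have hga : AnalyticAt ℂ g p := by
    have h1 : h p / h p ∈ slitPlane := by rw [div_self hne]; exact one_mem_slitPlane
    exact analyticAt_const.mul ((ha.div_const).cpow analyticAt_const h1)
  have hgp : g p = c := by simp [hg, div_self hne]
  have hgk : ∀ z, g z ^ k = h z := by
    intro z
    have : ((h z / h p) ^ (1 / (k : ℂ))) ^ k = h z / h p := by
      rw [one_div]; exact cpow_nat_inv_pow _ hk.ne'
    simp only [hg, mul_pow, this, hc]
    field_simp
  refine ⟨fun z => (z - p) * g z, (analyticAt_id.sub analyticAt_const).mul hga, by simp, ?_, ?_⟩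
  · have : HasDerivAt (fun z => (z - p) * g z) (1 * g p + (p - p) * deriv g p) p :=
      ((hasDerivAt_id p).sub_const p).mul hga.differentiableAt.hasDerivAt
    rw [this.deriv]; simpa [hgp] using hc0
  · filter_upwards [he] with z hz
    rw [hz, mul_pow, hgk, smul_eq_mul]

/-- Uniqueness of lifts through a locally injective map. -/
theorem eqOn_of_comp_eqOn_of_locallyInjective {A : Type*} [TopologicalSpace A] {S : Set A}
    {f : ℂ → ℂ} {g₁ g₂ : A → ℂ} (hS : IsPreconnected S) (h₁ : ContinuousOn g₁ S)
    (h₂ : ContinuousOn g₂ S) (he : ∀ s ∈ S, f (g₁ s) = f (g₂ s))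
    (hf : ∀ s ∈ S, ∃ N ∈ 𝓝 (g₁ s), InjOn f N) {a : A} (ha : a ∈ S) (haa : g₁ a = g₂ a) :
    EqOn g₁ g₂ S := by
  have := isPreconnected_iff_preconnectedSpace.1 hS
  have c₁ : Continuous (fun s : S => g₁ s) := continuousOn_iff_continuous_domRestrict.1 h₁
  have c₂ : Continuous (fun s : S => g₂ s) := continuousOn_iff_continuous_domRestrict.1 h₂
  have hcl : IsClopen {s : S | g₁ s = g₂ s} := by
    refine ⟨isClosed_eq c₁ c₂, isOpen_iff_mem_nhds.2 fun s hs => ?_⟩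
    obtain ⟨N, hN, hi⟩ := hf s s.2
    have hN' : N ∈ 𝓝 (g₂ s) := by rw [← show g₁ s = g₂ s from hs]; exact hN
    filter_upwards [c₁.continuousAt hN, c₂.continuousAt hN'] with t t1 t2
    exact hi t1 t2 (he t t.2)
  have hu := hcl.eq_univ ⟨⟨a, ha⟩, haa⟩
  intro s hs
  have : (⟨s, hs⟩ : S) ∈ {s : S | g₁ s = g₂ s} := by rw [hu]; trivial
  exact this

/-! ### Proper branched coverings of the disc -/

/-- `f` maps the compact set `K` into the closed unit disc, `O` is the preimage of the open disc,
and `f` has no critical points in `O` except zeros. -/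
structure IsBranchedDisc (f : ℂ → ℂ) (K O : Set ℂ) : Prop where
  isCompact : IsCompact K
  isOpen : IsOpen O
  mem_iff : ∀ z, z ∈ O ↔ z ∈ K ∧ ‖f z‖ < 1
  norm_le : ∀ z ∈ K, ‖f z‖ ≤ 1
  analyticAt : ∀ z ∈ K, AnalyticAt ℂ f z
  deriv_ne : ∀ z ∈ O, f z ≠ 0 → deriv f z ≠ 0
  order_ne_top : ∀ z ∈ O, f z = 0 → analyticOrderAt f z ≠ ⊤
  finite_fiber : ∀ w, {z ∈ K | f z = w}.Finite
  locInj : ∀ z ∈ K, ‖f z‖ = 1 → ∃ N ∈ 𝓝 z, InjOn f (N ∩ O)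

/-- `ψ` parametrizes the closure of the component of `O` around the zero `p` in such a way that
`f` becomes `w ↦ w ^ k`. -/
structure IsDiscParam (f : ℂ → ℂ) (K : Set ℂ) (p : ℂ) (k : ℕ) (ψ : ℂ → ℂ) : Prop where
  k_pos : 0 < k
  cont : ContinuousOn ψ (closedBall 0 1)
  inj : InjOn ψ (closedBall 0 1)
  mapsTo : MapsTo ψ (closedBall 0 1) K
  map_eq : ∀ w ∈ closedBall (0 : ℂ) 1, f (ψ w) = w ^ k
  map_zero : ψ 0 = p
  isOpen_image : IsOpen (ψ '' ball 0 1)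

namespace IsBranchedDisc

variable {f : ℂ → ℂ} {K O : Set ℂ} (h : IsBranchedDisc f K O)
include h

theorem subset : O ⊆ K := fun z hz => ((h.mem_iff z).1 hz).1

theorem norm_lt {z : ℂ} (hz : z ∈ O) : ‖f z‖ < 1 := ((h.mem_iff z).1 hz).2

theorem continuousOn : ContinuousOn f K := fun z hz => (h.analyticAt z hz).continuousAt.continuousWithinAt

theorem locInj_of_ne {z : ℂ} (hz : z ∈ O) (h0 : f z ≠ 0) : ∃ N ∈ 𝓝 z, InjOn f N :=
  exists_nhds_injOn_of_deriv_ne_zero (h.analyticAt z (h.subset hz)) (h.deriv_ne z hz h0)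

/-- In a coordinate `χ` with `f = χ ^ k`, the branch is the inverse of `χ`. The bound `δ ≤ 1` makes
`log δ ≤ 0`, so that the logarithm of the small disc stays in the left half-plane. -/
theorem exists_local_branch {p : ℂ} (hp : p ∈ K) (hfp : f p = 0) :
    ∃ (k : ℕ) (δ : ℝ) (ψ : ℂ → ℂ), 0 < k ∧ 0 < δ ∧ δ ≤ 1 ∧ ContinuousOn ψ (ball 0 δ) ∧
      InjOn ψ (ball 0 δ) ∧ MapsTo ψ (ball 0 δ) O ∧ ψ 0 = p ∧ (∀ w ∈ ball (0 : ℂ) δ, f (ψ w) = w ^ k) ∧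
      ψ '' ball 0 δ ∈ 𝓝 p := by
  have hpO : p ∈ O := (h.mem_iff p).2 ⟨hp, by simp [hfp]⟩
  have hfa := h.analyticAt p hp
  obtain ⟨k, hk⟩ := ENat.ne_top_iff_exists.1 (h.order_ne_top p hpO hfp)
  have hk0 : 0 < k := by
    rcases Nat.eq_zero_or_pos k with rfl | h0
    · exact absurd hfp (hfa.analyticOrderAt_eq_zero.1 (by simpa using hk.symm))
    · exact h0
  obtain ⟨χ, hχa, hχ0, hχd, hχ⟩ := exists_root_of_analyticOrderAt hfa hk0 hk.symm
  have hs := (hχa.hasStrictDerivAt).hasStrictFDerivAt_equiv hχd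
  set e := hs.toOpenPartialHomeomorph χ with he
  have hec : (e : ℂ → ℂ) = χ := hs.toOpenPartialHomeomorph_coe
  have hpe : p ∈ e.source := hs.mem_toOpenPartialHomeomorph_source
  have h0t : (0 : ℂ) ∈ e.target := by
    have := e.map_source hpe
    rwa [hec, hχ0] at this
  have hsymm : e.symm 0 = p := by
    have := e.left_inv hpe
    rwa [hec, hχ0] at this
  have hcont : ContinuousAt e.symm 0 := e.continuousAt_symm h0t
  have hev : ∀ᶠ w in 𝓝 (0 : ℂ), w ∈ e.target ∧ e.symm w ∈ O ∧ f (e.symm w) = χ (e.symm w) ^ k := by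
    have t : Tendsto e.symm (𝓝 0) (𝓝 p) := by simpa [ContinuousAt, hsymm] using hcont
    exact (show ∀ᶠ w in 𝓝 (0 : ℂ), w ∈ e.target from e.open_target.mem_nhds h0t).and ((t.eventually (h.isOpen.mem_nhds hpO)).and (t.eventually hχ))
  obtain ⟨δ', hδ', hb⟩ := Metric.eventually_nhds_iff_ball.1 hev
  refine ⟨k, min δ' 1, e.symm, hk0, lt_min hδ' one_pos, min_le_right _ _, ?_, ?_, ?_, hsymm, ?_, ?_⟩
  · exact fun w hw => (e.continuousAt_symm (hb w (ball_subset_ball (min_le_left _ _) hw)).1).continuousWithinAt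
  · exact e.symm.injOn.mono fun w hw => (hb w (ball_subset_ball (min_le_left _ _) hw)).1
  · exact fun w hw => (hb w (ball_subset_ball (min_le_left _ _) hw)).2.1
  · intro w hw
    obtain ⟨h1, -, h3⟩ := hb w (ball_subset_ball (min_le_left _ _) hw)
    rw [h3, ← hec, e.right_inv h1]
  · have : ball (0 : ℂ) (min δ' 1) ∈ 𝓝 (e p) := by
      rw [hec, hχ0]; exact ball_mem_nhds _ (lt_min hδ' one_pos)
    filter_upwards [e.open_source.mem_nhds hpe, (e.continuousAt hpe) this] with z hz1 hz2
    exact ⟨e z, hz2, e.left_inv hz1⟩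

/-- Compactness of `K` supplies the properness that turns a local homeomorphism into a covering.
Points of `K` with `0 < |f| < 1` lie in the open set `O`, where `f' ≠ 0`, so local inverses in the
plane are also local inverses in `K`. -/
theorem isCoveringMapOn : IsCoveringMapOn (fun z : K => f z) (ball 0 1 \ {0}) := by
  have : CompactSpace K := isCompact_iff_compactSpace.1 h.isCompact
  refine IsCoveringMapOn.of_isLocalHomeomorphOn (continuousOn_iff_continuous_domRestrict.1 h.continuousOn) ?_
  intro z hz
  have hz1 : ‖f z‖ < 1 := by simpa using hz.1
  have hz0 : f z ≠ 0 := by simpa using hz.2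
  have hzO : (z : ℂ) ∈ O := (h.mem_iff z).2 ⟨z.2, hz1⟩
  have hs := ((h.analyticAt z z.2).hasStrictDerivAt).hasStrictFDerivAt_equiv (h.deriv_ne z hzO hz0)
  set e := (hs.toOpenPartialHomeomorph f).restr O with he
  have hes : e.source = (hs.toOpenPartialHomeomorph f).source ∩ O := by
    rw [he, OpenPartialHomeomorph.restr_source, h.isOpen.interior_eq]
  have hec : (e : ℂ → ℂ) = f := hs.toOpenPartialHomeomorph_coe
  have hze : (z : ℂ) ∈ e.source := by
    rw [hes]; exact ⟨hs.mem_toOpenPartialHomeomorph_source, hzO⟩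
  refine (isLocalHomeomorphOn_iff_isOpenEmbedding_restrict (s := {z})).2 ?_ z rfl
  rintro _ rfl
  refine ⟨(↑) ⁻¹' e.source, (e.open_source.preimage continuous_subtype_val).mem_nhds hze, ?_⟩
  have h1 := e.isOpenEmbedding_restrict
  let H : ((↑) ⁻¹' e.source : Set K) ≃ₜ e.source :=
    { toFun := fun x => ⟨x.1.1, x.2⟩
      invFun := fun x => ⟨⟨x.1, h.subset (hes.subset x.2).2⟩, x.2⟩
      left_inv := fun _ => rfl
      right_inv := fun _ => rfl
      continuous_toFun := by fun_prop
      continuous_invFun := by fun_prop }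
  have h2 := h1.comp H.isOpenEmbedding
  convert h2 using 1
  ext x
  simp [hec, H, Set.domRestrict]

end IsBranchedDisc
end

/-! ### Lifting the exponential: parametrization over the open disc -/

section

theorem isPreconnected_re_lt (c : ℝ) : IsPreconnected {s : ℂ | s.re < c} :=
  (convex_halfSpace_re_lt c).isPreconnected

namespace IsBranchedDisc

variable {f : ℂ → ℂ} {K O : Set ℂ} (h : IsBranchedDisc f K O)
include h

/-- The exponential on the left half-plane lifts through `f`, extending a local branch at a
zero of `f`. -/
theorem exists_lift_exp {k : ℕ} (hk : 0 < k) {δ : ℝ} (hδ : 0 < δ) (hδ1 : δ ≤ 1) {ψ : ℂ → ℂ}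
    (hc : ContinuousOn ψ (ball 0 δ)) (hm : MapsTo ψ (ball 0 δ) O)
    (he : ∀ w ∈ ball (0 : ℂ) δ, f (ψ w) = w ^ k) :
    ∃ Φ : ℂ → ℂ, ContinuousOn Φ {s | s.re < 0} ∧ MapsTo Φ {s | s.re < 0} O ∧
      (∀ s : ℂ, s.re < 0 → f (Φ s) = exp s) ∧
      ∀ s : ℂ, s.re < k * Real.log δ → Φ s = ψ (exp (s / k)) := by
  have hk' : (0 : ℝ) < k := by exact_mod_cast hk
  have hkc : (k : ℂ) ≠ 0 := by exact_mod_cast hk.ne'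
  have hlog : Real.log δ ≤ 0 := Real.log_nonpos hδ.le hδ1
  have hball : ∀ s : ℂ, s.re < k * Real.log δ → exp (s / k) ∈ ball (0 : ℂ) δ := by
    intro s hs
    rw [mem_ball_zero_iff, norm_exp]
    rw [← Real.lt_log_iff_exp_lt hδ, div_natCast_re, div_lt_iff₀ hk']
    linarith
  set s₀ : ℂ := ((k * (Real.log δ - 1) : ℝ) : ℂ) with hs₀
  have hs₀r : s₀.re < k * Real.log δ := by rw [hs₀, ofReal_re]; nlinarith
  have hneg : ∀ s : ℂ, s.re < k * Real.log δ → s.re < 0 := fun s hs =>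
    lt_of_lt_of_le hs (mul_nonpos_of_nonneg_of_nonpos hk'.le hlog)
  have hex : ∀ s : ℂ, exp (s / k) ^ k = exp s := fun s => by
    rw [← exp_nat_mul, mul_div_cancel₀ _ hkc]
  let A := {s : ℂ // s.re < 0}
  have hconv : Convex ℝ {s : ℂ | s.re < 0} := convex_halfSpace_re_lt 0
  have hne : {s : ℂ | s.re < 0}.Nonempty := ⟨s₀, hneg _ hs₀r⟩
  have : ContractibleSpace A := hconv.contractibleSpace hne
  have : LocallyPathConnectedSpace A :=
    (isOpen_lt continuous_re continuous_const).locallyPathConnectedSpace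
  let E : C(A, ℂ) := ⟨fun s => exp s, by fun_prop⟩
  -- The left half-plane is simply connected and `exp` maps it into the punctured disc, so the lift
  -- exists; uniqueness of lifts then makes it agree with the local branch on the whole half-plane
  -- where that is defined.
  obtain ⟨F, ⟨hF0, hF⟩, -⟩ := h.isCoveringMapOn.existsUnique_continuousMap_lifts E
    (a₀ := ⟨s₀, hneg _ hs₀r⟩) (e₀ := ⟨ψ (exp (s₀ / k)), h.subset (hm (hball _ hs₀r))⟩)
    (by simp only [E, ContinuousMap.coe_mk]; rw [he _ (hball _ hs₀r), hex])
    (by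
      rintro ⟨s, hs⟩
      refine ⟨?_, exp_ne_zero _⟩
      simpa [E, norm_exp] using hs)
  classical
  have hFe : ∀ s : A, f (F s) = exp s := fun s => congrFun hF s
  let Φ : ℂ → ℂ := fun s => if hs : s.re < 0 then F ⟨s, hs⟩ else 0
  have hΦ : ∀ s : A, Φ s = F s := fun s => dif_pos s.2
  have hΦc : ContinuousOn Φ {s | s.re < 0} := by
    rw [continuousOn_iff_continuous_domRestrict]
    have : ({s : ℂ | s.re < 0}.domRestrict Φ) = fun s : A => ((F s : K) : ℂ) := by
      ext s; exact hΦ s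
    rw [this]
    exact continuous_subtype_val.comp F.continuous
  have hΦe : ∀ s : ℂ, s.re < 0 → f (Φ s) = exp s := fun s hs => by
    rw [hΦ ⟨s, hs⟩]; exact hFe ⟨s, hs⟩
  have hΦO : MapsTo Φ {s | s.re < 0} O := by
    intro s hs
    rw [h.mem_iff, hΦe s hs, norm_exp]
    refine ⟨?_, Real.exp_lt_one_iff.2 hs⟩
    rw [hΦ ⟨s, hs⟩]; exact (F ⟨s, hs⟩).2
  refine ⟨Φ, hΦc, hΦO, hΦe, ?_⟩
  refine eqOn_of_comp_eqOn_of_locallyInjective (f := f) (isPreconnected_re_lt _)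
    (hΦc.mono hneg) (hc.comp (by fun_prop) hball) ?_ ?_ hs₀r ?_
  · intro s hs
    rw [hΦe s (hneg s hs), he _ (hball s hs), hex]
  · intro s hs
    refine h.locInj_of_ne (hΦO (hneg s hs)) ?_
    rw [hΦe s (hneg s hs)]; exact exp_ne_zero _
  · rw [hΦ ⟨s₀, hneg _ hs₀r⟩, hF0]

/-- The parametrization over the open disc. -/
theorem exists_openParam {p : ℂ} (hp : p ∈ K) (hfp : f p = 0) :
    ∃ (k : ℕ) (ψ : ℂ → ℂ), 0 < k ∧ ContinuousOn ψ (ball 0 1) ∧ InjOn ψ (ball 0 1) ∧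
      MapsTo ψ (ball 0 1) O ∧ (∀ w ∈ ball (0 : ℂ) 1, f (ψ w) = w ^ k) ∧ ψ 0 = p ∧
      IsOpen (ψ '' ball 0 1) := by
  obtain ⟨k, δ, ψ₀, hk, hδ, hδ1, hc, hi, hm, h0, he, hn⟩ := h.exists_local_branch hp hfp
  obtain ⟨Φ, hΦc, hΦO, hΦe, hΦ⟩ := h.exists_lift_exp hk hδ hδ1 hc hm he
  have hk' : (0 : ℝ) < k := by exact_mod_cast hk
  have hkc : (k : ℂ) ≠ 0 := by exact_mod_cast hk.ne'
  have hlog : Real.log δ ≤ 0 := Real.log_nonpos hδ.le hδ1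
  have hball : ∀ s : ℂ, s.re < k * Real.log δ → exp (s / k) ∈ ball (0 : ℂ) δ := by
    intro s hs
    rw [mem_ball_zero_iff, norm_exp]
    rw [← Real.lt_log_iff_exp_lt hδ, div_natCast_re, div_lt_iff₀ hk']
    linarith
  have hLi : ∀ s : ℂ, s.re < 0 → ∃ N ∈ 𝓝 (Φ s), InjOn f N := fun s hs =>
    h.locInj_of_ne (hΦO hs) (by rw [hΦe s hs]; exact exp_ne_zero _)
  -- a far left base point
  obtain ⟨a, ha⟩ : ∃ a : ℂ, a.re < k * Real.log δ := ⟨((k * Real.log δ - 1 : ℝ) : ℂ), by simp⟩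
  have hshift : ∀ (c : ℝ) (s : ℂ), (s + c * I).re = s.re := fun c s => by simp
  have ha0 : a.re < 0 := lt_of_lt_of_le ha (mul_nonpos_of_nonneg_of_nonpos hk'.le hlog)
  have hsc : ∀ c : ℝ, ContinuousOn (fun s : ℂ => Φ (s + c * I)) {s | s.re < 0} := fun c =>
    hΦc.comp (by fun_prop) (fun s hs => by simpa using hs)
  -- The period `2πik` is visible far to the left, where `Φ s` depends only on `exp (s / k)`;
  -- uniqueness of lifts spreads it to the half-plane.
  have hper : ∀ (n : ℤ) (s : ℂ), s.re < 0 → Φ (s + (2 * Real.pi * (k * n) : ℝ) * I) = Φ s := by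
    intro n
    refine eqOn_of_comp_eqOn_of_locallyInjective (f := f) (isPreconnected_re_lt 0) (hsc _) hΦc
      ?_ ?_ ha0 ?_
    · intro s hs
      rw [hΦe _ (by rw [hshift]; exact hs), hΦe _ hs, exp_eq_exp_iff_exists_int]
      exact ⟨k * n, by push_cast; ring⟩
    · intro s hs; exact hLi _ (by rw [hshift]; exact hs)
    · rw [hΦ _ (by rw [hshift]; exact ha), hΦ _ ha]
      congr 1
      rw [exp_eq_exp_iff_exists_int]
      exact ⟨n, by push_cast; field_simp⟩
  -- Equal values force `s - s' = 2πin`. Translation by `2πin` then preserves `Φ` everywhere, and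
  -- far to the left the injectivity of the local branch shows that it does not change `exp (s /
  -- k)`.
  have hinj : ∀ s s' : ℂ, s.re < 0 → s'.re < 0 → Φ s = Φ s' → exp (s / k) = exp (s' / k) := by
    intro s s' hs hs' hss
    have h1 : exp s = exp s' := by rw [← hΦe s hs, ← hΦe s' hs', hss]
    obtain ⟨n, hn⟩ := exp_eq_exp_iff_exists_int.1 h1
    have hn' : s = s' + (2 * Real.pi * n : ℝ) * I := by rw [hn]; push_cast; ring
    have hall : EqOn (fun s : ℂ => Φ (s + (2 * Real.pi * n : ℝ) * I)) Φ {s | s.re < 0} := by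
      refine eqOn_of_comp_eqOn_of_locallyInjective (f := f) (isPreconnected_re_lt 0) (hsc _) hΦc
        ?_ ?_ hs' ?_
      · intro s hs
        rw [hΦe _ (by rw [hshift]; exact hs), hΦe _ hs, exp_eq_exp_iff_exists_int]
        exact ⟨n, by push_cast; ring⟩
      · intro s hs; exact hLi _ (by rw [hshift]; exact hs)
      · simp only [← hn', hss]
    have h2 := hall (show a ∈ {s : ℂ | s.re < 0} from ha0)
    simp only at h2
    rw [hΦ _ (by rw [hshift]; exact ha), hΦ _ ha] at h2
    have h3 := hi (hball _ (by rw [hshift]; exact ha)) (hball _ ha) h2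
    rw [hn', add_div, exp_add]
    rw [add_div, exp_add] at h3
    rw [mul_right_eq_self₀.1 h3 |>.resolve_right (exp_ne_zero _), mul_one]
  classical
  -- Since `Φ` has period `2πik`, the jump of the principal logarithm across its cut has no effect.
  set ψ : ℂ → ℂ := fun w => if w = 0 then p else Φ (k * log w) with hψ
  have hψ0 : ψ 0 = p := if_pos rfl
  have hψn : ∀ w : ℂ, w ≠ 0 → ψ w = Φ (k * log w) := fun w hw => if_neg hw
  have hre : ∀ w : ℂ, (k * log w).re = k * Real.log ‖w‖ := fun w => by
    rw [← ofReal_natCast, re_ofReal_mul, log_re]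
  have hre0 : ∀ w : ℂ, w ≠ 0 → ‖w‖ < 1 → (k * log w).re < 0 := fun w hw hw1 => by
    rw [hre]; exact mul_neg_of_pos_of_neg hk' (Real.log_neg (norm_pos_iff.2 hw) hw1)
  have hexpk : ∀ w : ℂ, w ≠ 0 → exp (k * log w) = w ^ k := fun w hw => by
    rw [exp_nat_mul, exp_log hw]
  have hψψ : EqOn ψ ψ₀ (ball 0 δ) := by
    intro w hw
    by_cases hw0 : w = 0
    · rw [hw0, hψ0, h0]
    · rw [hψn w hw0, hΦ, mul_div_cancel_left₀ _ hkc, exp_log hw0]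
      rw [hre]
      exact mul_lt_mul_of_pos_left (Real.log_lt_log (norm_pos_iff.2 hw0) (mem_ball_zero_iff.1 hw)) hk'
  have hpO : p ∈ O := (h.mem_iff p).2 ⟨hp, by simp [hfp]⟩
  have hψO : MapsTo ψ (ball 0 1) O := by
    intro w hw
    by_cases hw0 : w = 0
    · rw [hw0, hψ0]; exact hpO
    · rw [hψn w hw0]; exact hΦO (hre0 w hw0 (mem_ball_zero_iff.1 hw))
  have hψe : ∀ w ∈ ball (0 : ℂ) 1, f (ψ w) = w ^ k := by
    intro w hw
    by_cases hw0 : w = 0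
    · rw [hw0, hψ0, hfp, zero_pow hk.ne']
    · rw [hψn w hw0, hΦe _ (hre0 w hw0 (mem_ball_zero_iff.1 hw)), hexpk w hw0]
  -- an arbitrary choice of the logarithm may be used
  have hψlog : ∀ w s : ℂ, ‖w‖ < 1 → exp s = w → ψ w = Φ (k * s) := by
    intro w s hw hs
    have hw0 : w ≠ 0 := hs ▸ exp_ne_zero s
    obtain ⟨n, hn⟩ := exp_eq_exp_iff_exists_int.1 (hs.trans (exp_log hw0).symm)
    rw [hψn w hw0, hn, ← hper n _ (hre0 w hw0 hw)]
    congr 1; push_cast; ring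
  refine ⟨k, ψ, hk, ?_, ?_, hψO, hψe, hψ0, ?_⟩
  · intro w hw
    have hw1 := mem_ball_zero_iff.1 hw
    refine ContinuousAt.continuousWithinAt ?_
    by_cases hw0 : w = 0
    · have : ψ₀ =ᶠ[𝓝 w] ψ := by
        filter_upwards [isOpen_ball.mem_nhds (show w ∈ ball (0 : ℂ) δ by simp [hw0, hδ])] with z hz
        exact (hψψ hz).symm
      exact (hc.continuousAt (isOpen_ball.mem_nhds (by simp [hw0, hδ]))).congr this
    -- `log (z / w) + log w` is a logarithm of `z` that is continuous at `w` even on the branch cut.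
    · have hL : ContinuousAt (fun z : ℂ => (k : ℂ) * (log (z / w) + log w)) w := by
        refine continuousAt_const.mul (ContinuousAt.add ?_ continuousAt_const)
        exact (continuousAt_id.div_const w).clog (by simp [div_self hw0])
      have hLw : (fun z : ℂ => (k : ℂ) * (log (z / w) + log w)) w = k * log w := by
        simp [div_self hw0]
      have : (fun z => Φ (k * (log (z / w) + log w))) =ᶠ[𝓝 w] ψ := by
        filter_upwards [isOpen_ball.mem_nhds hw, isOpen_ne.mem_nhds hw0] with z hz1 hz0
        refine (hψlog z _ (mem_ball_zero_iff.1 hz1) ?_).symm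
        rw [exp_add, exp_log (div_ne_zero hz0 hw0), exp_log hw0, div_mul_cancel₀ _ hw0]
      refine ContinuousAt.congr (f := fun z => Φ (k * (log (z / w) + log w))) ?_ this
      refine ContinuousAt.comp (g := Φ) ?_ hL
      rw [show (k : ℂ) * (log (w / w) + log w) = k * log w from hLw]
      exact hΦc.continuousAt ((isOpen_lt continuous_re continuous_const).mem_nhds (hre0 w hw0 hw1))
  · intro w hw w' hw' hww
    have hpow : w ^ k = w' ^ k := by rw [← hψe w hw, ← hψe w' hw', hww]
    by_cases hw0 : w = 0
    · rw [hw0, zero_pow hk.ne'] at hpow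
      rw [hw0, eq_zero_of_pow_eq_zero hpow.symm]
    · have hw0' : w' ≠ 0 := by
        rintro rfl; rw [zero_pow hk.ne'] at hpow; exact hw0 (eq_zero_of_pow_eq_zero hpow)
      rw [hψn w hw0, hψn w' hw0'] at hww
      have := hinj _ _ (hre0 w hw0 (mem_ball_zero_iff.1 hw)) (hre0 w' hw0' (mem_ball_zero_iff.1 hw')) hww
      rwa [mul_div_cancel_left₀ _ hkc, mul_div_cancel_left₀ _ hkc, exp_log hw0, exp_log hw0'] at this
  -- For `y` near `z = ψ w`, continue the logarithm of `f` from `z` to `y` and apply `Φ`: the result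
  -- has the same value under `f` as `y` and lies near `z`, so it is `y` by local injectivity. At `w
  -- = 0` the local branch already covers a neighbourhood.
  · rw [isOpen_iff_mem_nhds]
    rintro _ ⟨w, hw, rfl⟩
    have hw1 := mem_ball_zero_iff.1 hw
    by_cases hw0 : w = 0
    · rw [hw0, hψ0]
      refine Filter.mem_of_superset hn ?_
      rw [← hψψ.image_eq]
      exact image_mono (ball_subset_ball hδ1)
    · set z := ψ w with hz
      have hzO : z ∈ O := hψO hw
      have hfz : f z = w ^ k := hψe w hw
      have hfz0 : f z ≠ 0 := by rw [hfz]; exact pow_ne_zero _ hw0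
      have hfc : ContinuousAt f z := (h.analyticAt z (h.subset hzO)).continuousAt
      obtain ⟨N, hN, hiN⟩ := h.locInj_of_ne hzO hfz0
      have hL : ContinuousAt (fun y : ℂ => log (f y / f z) + k * log w) z := by
        refine ContinuousAt.add ?_ continuousAt_const
        exact (hfc.div_const _).clog (by simp [div_self hfz0])
      have hLz : (fun y : ℂ => log (f y / f z) + k * log w) z = k * log w := by
        simp [div_self hfz0]
      have hH : {s : ℂ | s.re < 0} ∈ 𝓝 ((fun y : ℂ => log (f y / f z) + k * log w) z) := by
        rw [hLz]; exact (isOpen_lt continuous_re continuous_const).mem_nhds (hre0 w hw0 hw1)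
      have hcomp : ContinuousAt (fun y : ℂ => Φ (log (f y / f z) + k * log w)) z :=
        ContinuousAt.comp (g := Φ) (hΦc.continuousAt hH) hL
      have hval : (fun y : ℂ => Φ (log (f y / f z) + k * log w)) z = z := by
        simp only [div_self hfz0, log_one, zero_add]
        rw [hz, hψn w hw0]
      have hN' : N ∈ 𝓝 ((fun y : ℂ => Φ (log (f y / f z) + k * log w)) z) := by rw [hval]; exact hN
      filter_upwards [hN, hcomp hN', hL hH, hfc.eventually_ne hfz0] with y hy1 hy2 hy3 hy4
      have hes : exp (log (f y / f z) + k * log w) = f y := by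
        rw [exp_add, exp_log (div_ne_zero hy4 hfz0), hexpk w hw0, ← hfz, div_mul_cancel₀ _ hfz0]
      have hy5 : Φ (log (f y / f z) + k * log w) = y :=
        hiN hy2 hy1 (by rw [hΦe _ hy3, hes])
      set s := log (f y / f z) + k * log w with hs
      refine ⟨exp (s / k), ?_, ?_⟩
      · rw [mem_ball_zero_iff, norm_exp]
        refine Real.exp_lt_one_iff.2 ?_
        rw [div_natCast_re]; exact div_neg_of_neg_of_pos hy3 hk'
      · rw [hψlog (exp (s / k)) (s / k) ?_ rfl, mul_div_cancel₀ _ hkc, hy5]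
        rw [norm_exp]
        refine Real.exp_lt_one_iff.2 ?_
        rw [div_natCast_re]; exact div_neg_of_neg_of_pos hy3 hk'

end IsBranchedDisc
end

/-! ### Extension to the boundary; disjointness and exhaustion of the components -/

section

namespace IsBranchedDisc

variable {f : ℂ → ℂ} {K O : Set ℂ} (h : IsBranchedDisc f K O)
include h

/-- A lift of `w ↦ w ^ k` over the open disc has limits at all points of the closed disc. -/
theorem exists_tendsto {k : ℕ} {ψ : ℂ → ℂ} (hc : ContinuousOn ψ (ball 0 1))
    (hm : MapsTo ψ (ball 0 1) O) (he : ∀ w ∈ ball (0 : ℂ) 1, f (ψ w) = w ^ k) {w₀ : ℂ}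
    (hw₀ : w₀ ∈ closedBall (0 : ℂ) 1) : ∃ z, Tendsto ψ (𝓝[ball 0 1] w₀) (𝓝 z) := by
  have hmK : MapsTo ψ (ball 0 1) K := fun w hw => h.subset (hm hw)
  have hne : (𝓝[ball (0 : ℂ) 1] w₀).NeBot := by
    rw [← mem_closure_iff_nhdsWithin_neBot, closure_ball _ one_ne_zero]; exact hw₀
  have hKm : map ψ (𝓝[ball 0 1] w₀) ≤ 𝓟 K := by
    rw [le_principal_iff, mem_map]
    exact mem_of_superset self_mem_nhdsWithin hmK
  have hfe : Tendsto (fun w => f (ψ w)) (𝓝[ball 0 1] w₀) (𝓝 (w₀ ^ k)) := by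
    refine Tendsto.congr' (f₁ := fun w : ℂ => w ^ k) ?_ ?_
    · filter_upwards [self_mem_nhdsWithin] with w hw using (he w hw).symm
    · exact ((continuous_pow k).tendsto w₀).mono_left nhdsWithin_le_nhds
  obtain ⟨z₀, hz₀, hcl⟩ := h.isCompact.exists_clusterPt hKm
  have hfin := h.finite_fiber (w₀ ^ k)
  -- A cluster point is isolated in the finite fibre over `w₀ ^ k`. Taking `ε ≤ r / 2` below makes
  -- the sphere of radius `ε` miss this fibre, so near `w₀` the values of `ψ` avoid that sphere; a
  -- connected image which enters the ball must then stay in it.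
  obtain ⟨r, hr, hrF⟩ : ∃ r > 0, ∀ z ∈ {z ∈ K | f z = w₀ ^ k}, z ∈ ball z₀ r → z = z₀ := by
    have h1 : ({z ∈ K | f z = w₀ ^ k} \ {z₀})ᶜ ∈ 𝓝 z₀ :=
      (hfin.subset sdiff_subset).isClosed.isOpen_compl.mem_nhds (by simp)
    obtain ⟨r, hr, hb⟩ := Metric.mem_nhds_iff.1 h1
    exact ⟨r, hr, fun z hz hzr => by by_contra hne; exact hb hzr ⟨hz, hne⟩⟩
  refine ⟨z₀, Metric.tendsto_nhds.2 fun ε' hε' => ?_⟩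
  set ε := min ε' (r / 2) with hε
  have hε0 : 0 < ε := lt_min hε' (by linarith)
  have hcomp : IsCompact (f '' (K ∩ sphere z₀ ε)) :=
    (h.isCompact.inter_right isClosed_sphere).image_of_continuousOn (h.continuousOn.mono inter_subset_left)
  have hnot : (f '' (K ∩ sphere z₀ ε))ᶜ ∈ 𝓝 (w₀ ^ k) := by
    refine hcomp.isClosed.isOpen_compl.mem_nhds ?_
    rintro ⟨z, ⟨hzK, hzs⟩, hzf⟩
    rw [mem_sphere] at hzs
    have : z = z₀ := hrF z ⟨hzK, hzf⟩ (by
      rw [mem_ball, hzs]; exact lt_of_le_of_lt (min_le_right _ _) (by linarith))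
    rw [this, dist_self] at hzs
    linarith
  have hev := hfe hnot
  rw [mem_map, Metric.mem_nhdsWithin_iff] at hev
  obtain ⟨δ, hδ, hδb⟩ := hev
  set S := ball w₀ δ ∩ ball (0 : ℂ) 1 with hS
  have hSp : IsPreconnected (ψ '' S) :=
    (((convex_ball w₀ δ).inter (convex_ball 0 1)).isPreconnected).image _ (hc.mono inter_subset_right)
  have hSn : ∀ w ∈ S, dist (ψ w) z₀ ≠ ε := fun w hw hd => by
    exact hδb hw ⟨ψ w, ⟨hmK hw.2, hd⟩, rfl⟩
  have hSmem : S ∈ 𝓝[ball 0 1] w₀ :=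
    inter_mem (mem_nhdsWithin_of_mem_nhds (ball_mem_nhds _ hδ)) self_mem_nhdsWithin
  have hmeet : (ψ '' S ∩ ball z₀ ε).Nonempty := by
    have := (clusterPt_iff_nonempty.1 hcl) (ball_mem_nhds z₀ hε0) (image_mem_map hSmem)
    rwa [inter_comm]
  have hsub : ψ '' S ⊆ ball z₀ ε := by
    refine hSp.subset_of_closure_inter_subset isOpen_ball hmeet ?_
    rintro _ ⟨hz, ⟨w, hw, rfl⟩⟩
    have := closure_ball_subset_closedBall hz
    exact lt_of_le_of_ne this (hSn w hw)
  filter_upwards [hSmem] with w hw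
  exact lt_of_lt_of_le (hsub ⟨w, hw, rfl⟩) (min_le_left _ _)

/-- Two parametrizations which meet at boundary points agree along curves ending there. -/
theorem eventually_eq_of_meet {k₁ k₂ : ℕ} (hk₁ : 0 < k₁) (hk₂ : 0 < k₂) {ψ₁ ψ₂ : ℂ → ℂ}
    (hc₁ : ContinuousOn ψ₁ (closedBall 0 1)) (hc₂ : ContinuousOn ψ₂ (closedBall 0 1))
    (hm₁ : MapsTo ψ₁ (ball 0 1) O) (hm₂ : MapsTo ψ₂ (ball 0 1) O)
    (hK : MapsTo ψ₁ (closedBall 0 1) K)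
    (he₁ : ∀ w ∈ closedBall (0 : ℂ) 1, f (ψ₁ w) = w ^ k₁)
    (he₂ : ∀ w ∈ closedBall (0 : ℂ) 1, f (ψ₂ w) = w ^ k₂) {w₁ w₂ : ℂ} (hw₁ : ‖w₁‖ = 1)
    (hw₂ : ‖w₂‖ = 1) (hww : ψ₁ w₁ = ψ₂ w₂) :
    ∀ᶠ t : ℝ in 𝓝[<] 1, ψ₁ ((t ^ k₂ : ℝ) * w₁) = ψ₂ ((t ^ k₁ : ℝ) * w₂) := by
  have key : ∀ {k : ℕ}, 0 < k → ∀ {ψ : ℂ → ℂ}, ContinuousOn ψ (closedBall 0 1) → ∀ {w : ℂ}, ‖w‖ = 1 →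
      (∀ t : ℝ, t ∈ Ioo 0 1 → ((t ^ k : ℝ) * w) ∈ ball (0 : ℂ) 1) ∧
      Tendsto (fun t : ℝ => ψ ((t ^ k : ℝ) * w)) (𝓝[<] 1) (𝓝 (ψ w)) := by
    intro k hk ψ hc w hw
    have h1 : ∀ t : ℝ, t ∈ Ioo 0 1 → ((t ^ k : ℝ) * w) ∈ ball (0 : ℂ) 1 := by
      intro t ht
      rw [mem_ball_zero_iff, norm_mul, hw, mul_one, norm_real, Real.norm_of_nonneg (pow_nonneg ht.1.le k)]
      exact pow_lt_one₀ ht.1.le ht.2 hk.ne'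
    refine ⟨h1, ?_⟩
    have h2 : Tendsto (fun t : ℝ => ((t ^ k : ℝ) * w : ℂ)) (𝓝[<] 1) (𝓝[closedBall 0 1] w) := by
      refine tendsto_nhdsWithin_iff.2 ⟨?_, ?_⟩
      · have : Continuous (fun t : ℝ => ((t ^ k : ℝ) * w : ℂ)) := by fun_prop
        simpa using (this.tendsto 1).mono_left (nhdsWithin_le_nhds (s := Iio 1))
      · filter_upwards [Ioo_mem_nhdsLT (zero_lt_one (α := ℝ))] with t ht
        exact ball_subset_closedBall (h1 t ht)
    exact (hc w (by simp [hw])).tendsto.comp h2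
  have hz : ‖f (ψ₁ w₁)‖ = 1 := by
    rw [he₁ _ (by simp [hw₁]), norm_pow, hw₁, one_pow]
  obtain ⟨N, hN, hi⟩ := h.locInj _ (hK (show w₁ ∈ closedBall (0:ℂ) 1 by simp [hw₁])) hz
  obtain ⟨a₁, b₁⟩ := key hk₂ hc₁ hw₁
  obtain ⟨a₂, b₂⟩ := key hk₁ hc₂ hw₂
  have hpw : w₁ ^ k₁ = w₂ ^ k₂ := by
    rw [← he₁ _ (by simp [hw₁]), ← he₂ _ (by simp [hw₂]), hww]
  filter_upwards [b₁ hN, b₂ (hww ▸ hN), Ioo_mem_nhdsLT (zero_lt_one (α := ℝ))] with t ht1 ht2 ht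
  -- The crossed exponents give both points the same value `t ^ (k₁ * k₂) * w₁ ^ k₁` under `f`, and
  -- near the common endpoint `f` is injective on `O`.
  refine hi ⟨ht1, hm₁ (a₁ t ht)⟩ ⟨ht2, hm₂ (a₂ t ht)⟩ ?_
  rw [he₁ _ (ball_subset_closedBall (a₁ t ht)), he₂ _ (ball_subset_closedBall (a₂ t ht)), mul_pow, mul_pow, hpw]
  push_cast
  rw [← pow_mul, ← pow_mul, mul_comm k₂ k₁]

/-- Limits extend the open parametrization continuously. If two points of the unit circle had the
same image, the images of the radii ending there would merge just before the boundary, and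
injectivity over the open disc identifies the two points. -/
theorem exists_param {p : ℂ} (hp : p ∈ K) (hfp : f p = 0) :
    ∃ (k : ℕ) (ψ : ℂ → ℂ), IsDiscParam f K p k ψ := by
  obtain ⟨k, ψ, hk, hc, hi, hm, he, h0, ho⟩ := h.exists_openParam hp hfp
  have hcl : closure (ball (0 : ℂ) 1) = closedBall 0 1 := closure_ball _ one_ne_zero
  set ψ' := extendFrom (ball (0 : ℂ) 1) ψ with hψ'
  have heq : EqOn ψ' ψ (ball 0 1) := fun w hw =>
    extendFrom_eq (subset_closure hw) (hc w hw).tendsto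
  have hc' : ContinuousOn ψ' (closedBall 0 1) :=
    continuousOn_extendFrom hcl.ge fun w hw => h.exists_tendsto hc hm he hw
  have hm' : MapsTo ψ' (ball 0 1) O := fun w hw => by rw [heq hw]; exact hm hw
  have hmK : MapsTo ψ' (closedBall 0 1) K := by
    have := MapsTo.closure_of_continuousOn (fun w hw => h.subset (hm' hw)) (hcl ▸ hc')
    rwa [hcl, h.isCompact.isClosed.closure_eq] at this
  have he' : ∀ w ∈ closedBall (0 : ℂ) 1, f (ψ' w) = w ^ k := by
    have : EqOn (fun w => f (ψ' w)) (fun w => w ^ k) (closedBall (0 : ℂ) 1) := by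
      refine EqOn.of_subset_closure (s := ball 0 1) ?_ (h.continuousOn.comp hc' hmK)
        (continuous_pow k).continuousOn ball_subset_closedBall hcl.ge
      intro w hw
      simp only [heq hw, he w hw]
    exact this
  refine ⟨k, ψ', hk, hc', ?_, hmK, he', ?_, ?_⟩
  · intro w₁ hw₁ w₂ hw₂ hww
    have hpw : ‖w₁‖ = ‖w₂‖ := by
      have : w₁ ^ k = w₂ ^ k := by rw [← he' _ hw₁, ← he' _ hw₂, hww]
      have := congrArg norm this
      rw [norm_pow, norm_pow] at this
      exact (pow_left_inj₀ (norm_nonneg _) (norm_nonneg _) hk.ne').1 this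
    rcases (mem_closedBall_zero_iff.1 hw₁).lt_or_eq with hlt | heq1
    · have b1 : w₁ ∈ ball (0 : ℂ) 1 := mem_ball_zero_iff.2 hlt
      have b2 : w₂ ∈ ball (0 : ℂ) 1 := mem_ball_zero_iff.2 (hpw ▸ hlt)
      exact hi b1 b2 (by rw [← heq b1, ← heq b2, hww])
    · have ev := h.eventually_eq_of_meet hk hk hc' hc' hm' hm' hmK he' he' heq1 (hpw ▸ heq1) hww
      obtain ⟨t, ht1, ht⟩ := (ev.and (Ioo_mem_nhdsLT (zero_lt_one (α := ℝ)))).exists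
      have hb : ∀ {w : ℂ}, ‖w‖ = 1 → ((t ^ k : ℝ) * w) ∈ ball (0 : ℂ) 1 := by
        intro w hw
        rw [mem_ball_zero_iff, norm_mul, hw, mul_one, norm_real, Real.norm_of_nonneg (pow_nonneg ht.1.le k)]
        exact pow_lt_one₀ ht.1.le ht.2 hk.ne'
      rw [heq (hb heq1), heq (hb (hpw ▸ heq1))] at ht1
      have := hi (hb heq1) (hb (hpw ▸ heq1)) ht1
      exact mul_left_cancel₀ (by exact_mod_cast (pow_pos ht.1 k).ne') this
  · rw [heq (by simp), h0]
  · rwa [heq.image_eq]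

variable {p p' : ℂ} {k k' : ℕ} {ψ ψ' : ℂ → ℂ}

theorem mem_iff_of_param (hψ : IsDiscParam f K p k ψ) {w : ℂ} (hw : w ∈ closedBall (0 : ℂ) 1) :
    ψ w ∈ O ↔ w ∈ ball (0 : ℂ) 1 := by
  rw [h.mem_iff, hψ.map_eq w hw, norm_pow, mem_ball_zero_iff,
    pow_lt_one_iff_of_nonneg (norm_nonneg _) hψ.k_pos.ne']
  exact ⟨fun a => a.2, fun a => ⟨hψ.mapsTo hw, a⟩⟩

theorem closed_inter_subset (hψ : IsDiscParam f K p k ψ) :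
    ψ '' closedBall 0 1 ∩ O ⊆ ψ '' ball 0 1 := by
  rintro _ ⟨⟨w, hw, rfl⟩, hO⟩
  exact ⟨w, (h.mem_iff_of_param hψ hw).1 hO, rfl⟩

/-- The image of an open disc is open, and closed relative to `O`. If two such images met, one would
contain the other by connectedness, hence also its centre, which is a second zero of `f`. If only
the boundaries met, radii ending at the common point would merge and bring back the first case. -/
theorem disjoint_param (hψ : IsDiscParam f K p k ψ) (hψ' : IsDiscParam f K p' k' ψ')
    (hpp : p ≠ p') : Disjoint (ψ '' closedBall 0 1) (ψ' '' closedBall 0 1) := by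
  have hO : ∀ {p k ψ}, IsDiscParam f K p k ψ → MapsTo ψ (ball 0 1) O := fun hψ w hw =>
    (h.mem_iff_of_param hψ (ball_subset_closedBall hw)).2 hw
  have hopen : ∀ w ∈ ball (0 : ℂ) 1, ∀ w' ∈ ball (0 : ℂ) 1, ψ w ≠ ψ' w' := by
    intro w hw w' hw' hww
    have hpre : IsPreconnected (ψ '' ball 0 1) :=
      (convex_ball 0 1).isPreconnected.image _ (hψ.cont.mono ball_subset_closedBall)
    have hsub : ψ '' ball 0 1 ⊆ ψ' '' ball 0 1 := by
      refine hpre.subset_of_closure_inter_subset hψ'.isOpen_image ⟨ψ w, ⟨w, hw, rfl⟩, ⟨w', hw', hww.symm⟩⟩ ?_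
      rintro z ⟨hz, ⟨u, hu, rfl⟩⟩
      refine h.closed_inter_subset hψ' ⟨?_, hO hψ hu⟩
      have hcp : IsClosed (ψ' '' closedBall 0 1) :=
        ((isCompact_closedBall 0 1).image_of_continuousOn hψ'.cont).isClosed
      exact closure_minimal (image_mono ball_subset_closedBall) hcp hz
    obtain ⟨u, hu, hup⟩ := hsub ⟨0, by simp, rfl⟩
    have h1 : f (ψ 0) = 0 := by rw [hψ.map_eq 0 (by simp), zero_pow hψ.k_pos.ne']
    rw [← hup, hψ'.map_eq u (ball_subset_closedBall hu)] at h1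
    rw [eq_zero_of_pow_eq_zero h1, hψ.map_zero, hψ'.map_zero] at hup
    exact hpp hup.symm
  rw [Set.disjoint_left]
  rintro _ ⟨w, hw, rfl⟩ ⟨w', hw', hww⟩
  have hiff : w ∈ ball (0 : ℂ) 1 ↔ w' ∈ ball (0 : ℂ) 1 := by
    rw [← h.mem_iff_of_param hψ hw, ← hww, h.mem_iff_of_param hψ' hw']
  by_cases hb : w ∈ ball (0 : ℂ) 1
  · exact hopen w hb w' (hiff.1 hb) hww.symm
  · have e1 : ‖w‖ = 1 := le_antisymm (mem_closedBall_zero_iff.1 hw) (by simpa using hb)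
    have e2 : ‖w'‖ = 1 := le_antisymm (mem_closedBall_zero_iff.1 hw') (by simpa using (hiff.not.1 hb))
    have ev := h.eventually_eq_of_meet hψ.k_pos hψ'.k_pos hψ.cont hψ'.cont (hO hψ) (hO hψ')
      hψ.mapsTo hψ.map_eq hψ'.map_eq e1 e2 hww.symm
    obtain ⟨t, ht1, ht⟩ := (ev.and (Ioo_mem_nhdsLT (zero_lt_one (α := ℝ)))).exists
    have hb : ∀ {k : ℕ} {w : ℂ}, 0 < k → ‖w‖ = 1 → ((t ^ k : ℝ) * w) ∈ ball (0 : ℂ) 1 := by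
      intro k w hk hw
      rw [mem_ball_zero_iff, norm_mul, hw, mul_one, norm_real, Real.norm_of_nonneg (pow_nonneg ht.1.le k)]
      exact pow_lt_one₀ ht.1.le ht.2 hk.ne'
    exact hopen _ (hb hψ'.k_pos e1) _ (hb hψ.k_pos e2) ht1

/-- The components around the zeros of `f` exhaust `O`. -/
theorem subset_iUnion {ι : Type*} [Finite ι] {p : ι → ℂ} {k : ι → ℕ} {ψ : ι → ℂ → ℂ}
    (hψ : ∀ i, IsDiscParam f K (p i) (k i) (ψ i)) (hz : ∀ z ∈ O, f z = 0 → ∃ i, z = p i) :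
    O ⊆ ⋃ i, ψ i '' ball 0 1 := by
  set U := ⋃ i, ψ i '' ball 0 1 with hU
  have hUo : IsOpen U := isOpen_iUnion fun i => (hψ i).isOpen_image
  intro z₁ hz₁
  by_contra hz₁U
  -- Minimum principle: on the uncovered part `|f|` attains a minimum, which is positive and less
  -- than `1`. The minimum point has a neighbourhood in the uncovered part of `O`, and there `f` is
  -- open, so it also takes the smaller values `t * f z₂` with `t < 1`.
  have hR : IsCompact (K \ U) := h.isCompact.diff hUo
  obtain ⟨z₂, hz₂, hmin⟩ := hR.exists_isMinOn ⟨z₁, h.subset hz₁, hz₁U⟩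
    (h.continuousOn.norm.mono sdiff_subset)
  have hlt : ‖f z₂‖ < 1 := lt_of_le_of_lt (hmin ⟨h.subset hz₁, hz₁U⟩) (h.norm_lt hz₁)
  have hz₂O : z₂ ∈ O := (h.mem_iff _).2 ⟨hz₂.1, hlt⟩
  have hf0 : f z₂ ≠ 0 := by
    intro h0
    obtain ⟨i, rfl⟩ := hz z₂ hz₂O h0
    exact hz₂.2 (mem_iUnion.2 ⟨i, 0, by simp, (hψ i).map_zero⟩)
  have hT : IsClosed (⋃ i, ψ i '' closedBall 0 1) := isClosed_iUnion_of_finite fun i =>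
    ((isCompact_closedBall 0 1).image_of_continuousOn (hψ i).cont).isClosed
  have hz₂T : z₂ ∉ ⋃ i, ψ i '' closedBall 0 1 := by
    intro hT
    obtain ⟨i, hi⟩ := mem_iUnion.1 hT
    exact hz₂.2 (mem_iUnion.2 ⟨i, h.closed_inter_subset (hψ i) ⟨hi, hz₂O⟩⟩)
  have hev : ∀ᶠ z in 𝓝 z₂, ‖f z₂‖ ≤ ‖f z‖ := by
    filter_upwards [h.isOpen.mem_nhds hz₂O, hT.isOpen_compl.mem_nhds hz₂T] with z hz1 hz2
    refine hmin ⟨h.subset hz1, fun hzU => hz2 ?_⟩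
    obtain ⟨i, hi⟩ := mem_iUnion.1 hzU
    exact mem_iUnion.2 ⟨i, image_mono ball_subset_closedBall hi⟩
  have hmap := ((h.analyticAt z₂ hz₂.1).hasStrictDerivAt).map_nhds_eq (h.deriv_ne z₂ hz₂O hf0)
  have hev' : ∀ᶠ y in 𝓝 (f z₂), ‖f z₂‖ ≤ ‖y‖ := by rw [← hmap]; exact hev
  have htend : Tendsto (fun t : ℝ => (t : ℂ) * f z₂) (𝓝[<] 1) (𝓝 (f z₂)) := by
    have : Continuous (fun t : ℝ => (t : ℂ) * f z₂) := by fun_prop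
    simpa using (this.tendsto 1).mono_left (nhdsWithin_le_nhds (s := Iio 1))
  obtain ⟨t, ht1, ht⟩ := ((htend.eventually hev').and (Ioo_mem_nhdsLT (zero_lt_one (α := ℝ)))).exists
  rw [norm_mul, norm_real, Real.norm_of_nonneg ht.1.le] at ht1
  nlinarith [norm_pos_iff.2 hf0, ht.2]

end IsBranchedDisc
end

section

/-! ### Local normal form on the unit circle -/

/-- A local coordinate `G` at a point `c` of the unit circle, straightening the circle, in which
`B = B c * exp (i α G ^ n)`. -/
structure IsCircleChart (B : ℂ → ℂ) (c : ℂ) (n : ℕ) (α : ℝ) (G : ℂ → ℂ) (N : Set ℂ) : Prop where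
  isOpen : IsOpen N
  mem : c ∈ N
  sign : α = 1 ∨ α = -1
  differentiableOn : DifferentiableOn ℂ G N
  inj : InjOn G N
  zero : G c = 0
  norm_lt : ∀ z ∈ N, ‖G z‖ < 1
  eq : ∀ z ∈ N, B z = B c * exp (I * (α * G z ^ n))
  lt_iff : ∀ z ∈ N, ‖z‖ < 1 ↔ 0 < (G z).im
  eq_iff : ∀ z ∈ N, ‖z‖ = 1 ↔ (G z).im = 0
  map_nhds : map G (𝓝 c) = 𝓝 0

/-- Along a vertical line the derivative of `Im g` is `Re g' > 0`, and `Im g` vanishes on the real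
axis; so it increases through `0` exactly there. -/
theorem eventually_im_sign {g : ℂ → ℂ} (hg : AnalyticAt ℂ g 0) (hd : 0 < (deriv g 0).re)
    (hr : ∀ᶠ x : ℝ in 𝓝 0, (g x).im = 0) :
    ∀ᶠ ζ in 𝓝 (0 : ℂ), (0 < ζ.im ↔ 0 < (g ζ).im) ∧ (ζ.im = 0 ↔ (g ζ).im = 0) := by
  have hre : Tendsto (fun ζ : ℂ => ζ.re) (𝓝 0) (𝓝 0) := by
    simpa using continuous_re.tendsto (0 : ℂ)
  have hev : ∀ᶠ ζ in 𝓝 (0 : ℂ), DifferentiableAt ℂ g ζ ∧ 0 < (deriv g ζ).re ∧ (g ζ.re).im = 0 := by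
    refine (hg.eventually_analyticAt.mono fun z hz => hz.differentiableAt).and (Filter.Eventually.and ?_ (hre.eventually hr))
    exact (continuous_re.continuousAt.comp hg.deriv.continuousAt).eventually_const_lt hd
  obtain ⟨r, hr0, hb⟩ := Metric.eventually_nhds_iff_ball.1 hev
  filter_upwards [ball_mem_nhds (0 : ℂ) hr0] with ζ hζ
  set x := ζ.re with hx
  set y := ζ.im with hy
  have hmem : ∀ t ∈ Icc (-|y|) |y|, ((x : ℂ) + t * I) ∈ ball (0 : ℂ) r := by
    intro t ht
    have ht' : |t| ≤ |y| := abs_le.2 ht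
    rw [mem_ball_zero_iff] at hζ ⊢
    refine lt_of_le_of_lt ?_ hζ
    rw [Complex.norm_eq_sqrt_sq_add_sq, Complex.norm_eq_sqrt_sq_add_sq]
    refine Real.sqrt_le_sqrt ?_
    simp only [add_re, ofReal_re, mul_re, I_re, mul_zero, ofReal_im, I_im, mul_one, sub_self, add_zero,
      add_im, mul_im, zero_add]
    have := sq_le_sq.2 ht'
    linarith
  set u : ℝ → ℝ := fun t => (g (x + t * I)).im with hu
  have hder : ∀ t ∈ Icc (-|y|) |y|, HasDerivAt u (deriv g (x + t * I)).re t := by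
    intro t ht
    have h1 : HasDerivAt (fun t : ℝ => ((x : ℂ) + t * I)) I t := by
      simpa using ((ofRealCLM.hasDerivAt (x := t)).mul_const I).const_add (x : ℂ)
    have h2 := (hb _ (hmem t ht)).1.hasDerivAt.scomp t h1
    have h3 := (imCLM.hasFDerivAt.comp_hasDerivAt t h2)
    rw [smul_eq_mul, imCLM_apply, I_mul_im] at h3
    exact h3
  have hmono : StrictMonoOn u (Icc (-|y|) |y|) := by
    refine strictMonoOn_of_deriv_pos (convex_Icc _ _) (fun t ht => (hder t ht).continuousAt.continuousWithinAt) ?_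
    intro t ht
    have ht' := interior_subset ht
    rw [(hder t ht').deriv]
    exact (hb _ (hmem t ht')).2.1
  have h0 : u 0 = 0 := by
    simp only [hu, ofReal_zero, zero_mul, add_zero]
    exact (hb ζ hζ).2.2
  have hyu : u y = (g ζ).im := by
    simp only [hu, hx, hy, re_add_im]
  have m0 : (0 : ℝ) ∈ Icc (-|y|) |y| := ⟨by simp, by simp⟩
  have my : y ∈ Icc (-|y|) |y| := ⟨neg_abs_le y, le_abs_self y⟩
  refine ⟨?_, ?_⟩
  · have := hmono.lt_iff_lt m0 my
    rw [h0, hyu] at this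
    exact this.symm
  · have := hmono.injOn.eq_iff my m0
    rw [h0, hyu] at this
    exact this.symm

/-- Write `F = ζ ^ n * h`. The factor `h` is real on the real axis, and the sign `α` makes `α * h 0`
positive, so that the principal `n`-th root of `α * h` is analytic and real on the real axis. For
even `n` the sign cannot be absorbed into the root. -/
theorem exists_real_root {F : ℂ → ℂ} (hF : AnalyticAt ℂ F 0) {n : ℕ} (hn : 0 < n)
    (ho : analyticOrderAt F 0 = n) (hr : ∀ᶠ x : ℝ in 𝓝 0, (F x).im = 0) :
    ∃ (α : ℝ) (g : ℂ → ℂ), (α = 1 ∨ α = -1) ∧ AnalyticAt ℂ g 0 ∧ g 0 = 0 ∧ 0 < (deriv g 0).re ∧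
      (∀ᶠ ζ in 𝓝 0, F ζ = α * g ζ ^ n) ∧ ∀ᶠ x : ℝ in 𝓝 0, (g x).im = 0 := by
  obtain ⟨h, ha, hne, he⟩ := (hF.analyticOrderAt_eq_natCast).1 ho
  have hofr : Tendsto (fun x : ℝ => (x : ℂ)) (𝓝 0) (𝓝 0) := by
    simpa using continuous_ofReal.tendsto (0 : ℝ)
  have hcont : ContinuousAt (fun x : ℝ => (h x).im) 0 := by
    refine continuous_im.continuousAt.comp (ContinuousAt.comp (g := h) ?_ continuous_ofReal.continuousAt)
    simpa using ha.continuousAt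
  have him : ∀ᶠ x : ℝ in 𝓝 0, x ≠ 0 → (h x).im = 0 := by
    filter_upwards [hr, hofr.eventually he] with x hx1 hx2 hx0
    have h3 : F x = ((x ^ n : ℝ) : ℂ) * h x := by rw [hx2]; simp
    rw [h3, im_ofReal_mul] at hx1
    exact (mul_eq_zero.1 hx1).resolve_left (pow_ne_zero _ hx0)
  -- At the origin itself `x ^ n` cannot be cancelled, so reality of `h 0` comes from continuity.
  have h00 : (h 0).im = 0 := by
    have t1 : Tendsto (fun x : ℝ => (h x).im) (𝓝[≠] 0) (𝓝 (h 0).im) := by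
      simpa using hcont.tendsto.mono_left nhdsWithin_le_nhds
    have t2 : Tendsto (fun x : ℝ => (h x).im) (𝓝[≠] 0) (𝓝 0) := by
      refine tendsto_const_nhds.congr' ?_
      rw [EventuallyEq, eventually_nhdsWithin_iff]
      filter_upwards [him] with x hx hx0 using (hx hx0).symm
    exact tendsto_nhds_unique t1 t2
  have him' : ∀ᶠ x : ℝ in 𝓝 0, (h x).im = 0 := by
    filter_upwards [him] with x hx
    by_cases hx0 : x = 0
    · rw [hx0]; exact_mod_cast h00
    · exact hx hx0
  have hre0 : (h 0).re ≠ 0 := fun hre => hne (Complex.ext hre h00)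
  obtain ⟨α, hα, hpos⟩ : ∃ α : ℝ, (α = 1 ∨ α = -1) ∧ 0 < (α * h 0 : ℂ).re := by
    rcases lt_or_gt_of_ne hre0 with hlt | hgt
    · exact ⟨-1, Or.inr rfl, by simpa using hlt⟩
    · exact ⟨1, Or.inl rfl, by simpa using hgt⟩
  have hαα : (α : ℂ) * α = 1 := by rcases hα with rfl | rfl <;> norm_num
  set k : ℂ → ℂ := fun ζ => α * h ζ with hk
  have hka : AnalyticAt ℂ k 0 := analyticAt_const.mul ha
  have hslit : k 0 ∈ slitPlane := Or.inl hpos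
  set q : ℂ → ℂ := fun ζ => k ζ ^ (1 / (n : ℂ)) with hq
  have hqa : AnalyticAt ℂ q 0 := hka.cpow analyticAt_const hslit
  have hqk : ∀ ζ, q ζ ^ n = k ζ := fun ζ => by
    simp only [hq, one_div]; exact cpow_nat_inv_pow _ hn.ne'
  have hpos' : ∀ᶠ x : ℝ in 𝓝 0, 0 < (k x).re := by
    have : ContinuousAt (fun x : ℝ => (k x).re) 0 := by
      refine continuous_re.continuousAt.comp (ContinuousAt.comp (g := k) ?_ continuous_ofReal.continuousAt)
      simpa using hka.continuousAt
    refine this.eventually_const_lt ?_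
    simp only [ofReal_zero]; exact hpos
  have hqr : ∀ x : ℂ, 0 < (k x).re → (k x).im = 0 → q x = (((k x).re ^ (1 / (n : ℝ)) : ℝ) : ℂ) := by
    intro x hx hxi
    have : k x = ((k x).re : ℂ) := Complex.ext (by simp) (by simpa using hxi)
    simp only [hq]
    rw [this, ofReal_re, ofReal_cpow hx.le]
    push_cast; rfl
  have hki : ∀ᶠ x : ℝ in 𝓝 0, (k x).im = 0 := by
    filter_upwards [him'] with x hx
    simp only [hk, im_ofReal_mul, hx, mul_zero]
  refine ⟨α, fun ζ => ζ * q ζ, hα, analyticAt_id.mul hqa, by simp, ?_, ?_, ?_⟩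
  · have : HasDerivAt (fun ζ => ζ * q ζ) (1 * q 0 + 0 * deriv q 0) 0 :=
      (hasDerivAt_id (0 : ℂ)).mul hqa.differentiableAt.hasDerivAt
    have hk0 : (k 0).im = 0 := by simp only [hk, im_ofReal_mul, h00, mul_zero]
    rw [this.deriv, one_mul, zero_mul, add_zero, hqr 0 hpos hk0, ofReal_re]
    exact Real.rpow_pos_of_pos hpos _
  · filter_upwards [he] with ζ hζ
    rw [hζ, mul_pow, hqk, smul_eq_mul, sub_zero, hk]
    linear_combination (-(ζ ^ n * h ζ)) * hαα
  · filter_upwards [hpos', hki] with x h1 h2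
    rw [hqr x h1 h2, im_ofReal_mul, ofReal_im, mul_zero]

/-- In the logarithmic coordinates `-i log (z / c)` and `-i log (B / B c)` the unit circle is the
real line, and `B` becomes a function real on the real line with a zero of order `n`. A real `n`-th
root of it is the coordinate `G`. Since `Im (-i log (z / c)) = -log |z|`, the disc corresponds to
the upper half-plane. -/
theorem exists_circleChart {B : ℂ → ℂ} {c : ℂ} (hB : AnalyticAt ℂ B c) (hc : ‖c‖ = 1)
    (hcirc : ∀ z, ‖z‖ = 1 → ‖B z‖ = 1) {n : ℕ} (hn : 0 < n)
    (ho : analyticOrderAt (fun z => B z - B c) c = n) :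
    ∃ α G N, IsCircleChart B c n α G N := by
  have hc0 : c ≠ 0 := by rintro rfl; simp at hc
  have hBc : B c ≠ 0 := by
    intro h0; have := hcirc c hc; rw [h0, norm_zero] at this; exact zero_ne_one this
  set e : ℂ → ℂ := fun ζ => c * exp (I * ζ) with he
  have hea : AnalyticAt ℂ e 0 := by fun_prop
  have he0 : e 0 = c := by simp [he]
  have hed : deriv e 0 ≠ 0 := by
    have : HasDerivAt e (c * (exp (I * 0) * (I * 1))) 0 :=
      (((hasDerivAt_id (0 : ℂ)).const_mul I).cexp).const_mul c
    rw [this.deriv]; simp [hc0, I_ne_zero]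
  set l : ℂ → ℂ := fun u => -I * log (1 + u / B c) with hl
  have hla : AnalyticAt ℂ l 0 := by
    refine analyticAt_const.mul (AnalyticAt.clog (analyticAt_const.add (analyticAt_id.div_const)) ?_)
    simp
  have hl0 : l 0 = 0 := by simp [hl]
  have hld : deriv l 0 ≠ 0 := by
    have h1 : HasDerivAt (fun u : ℂ => 1 + u / B c) (1 / B c) 0 :=
      ((hasDerivAt_id (0 : ℂ)).div_const (B c)).const_add 1
    have h2 := (h1.clog (by simp)).const_mul (-I)
    rw [h2.deriv]
    simp [hBc, I_ne_zero]
  set β : ℂ → ℂ := (fun z => B z - B c) ∘ e with hβ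
  have hβ0 : β 0 = 0 := by simp [hβ, he0]
  have hβa : AnalyticAt ℂ β 0 := AnalyticAt.comp (by rw [he0]; exact hB.sub analyticAt_const) hea
  have hβo : analyticOrderAt β 0 = n := by
    rw [hβ, analyticOrderAt_comp_of_deriv_ne_zero hea hed, he0, ho]
  set F : ℂ → ℂ := l ∘ β with hF
  have hFa : AnalyticAt ℂ F 0 := AnalyticAt.comp (by rwa [hβ0]) hβa
  have hFo : analyticOrderAt F 0 = n := by
    rw [hF, AnalyticAt.analyticOrderAt_comp (by rwa [hβ0]) hβa, hβ0,
      hla.analyticOrderAt_eq_one_of_zero_deriv_ne_zero hl0 hld]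
    simpa using hβo
  have hFv : ∀ ζ, F ζ = -I * log (B (e ζ) / B c) := by
    intro ζ
    simp only [hF, hl, hβ, Function.comp]
    congr 2
    field_simp
    ring
  have hFr : ∀ x : ℝ, (F x).im = 0 := by
    intro x
    have h1 : ‖e x‖ = 1 := by
      simp only [he, norm_mul, hc, one_mul, mul_comm I, norm_exp_ofReal_mul_I]
    rw [hFv]
    simp [log_re, hcirc _ h1, hcirc c hc]
  obtain ⟨α, g, hα, hga, hg0, hgd, hgF, hgr⟩ := exists_real_root hFa hn hFo (Eventually.of_forall hFr)
  have hsign := eventually_im_sign hga hgd hgr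
  set Z : ℂ → ℂ := fun z => -I * log (z / c) with hZ
  have hZa : AnalyticAt ℂ Z c :=
    analyticAt_const.mul (AnalyticAt.clog (analyticAt_id.div_const) (by simp [div_self hc0]))
  have hZc : Z c = 0 := by simp [hZ, div_self hc0]
  have hZd : deriv Z c ≠ 0 := by
    have h2 := (((hasDerivAt_id c).div_const c).clog (by simp [div_self hc0])).const_mul (-I)
    have h3 : deriv Z c = -I * (1 / c / (id c / c)) := h2.deriv
    rw [h3]; simp [hc0, I_ne_zero]
  have hZe : ∀ z, z ≠ 0 → e (Z z) = z := by
    intro z hz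
    have : I * (-I * log (z / c)) = log (z / c) := by rw [← mul_assoc]; simp
    simp only [he, hZ, this, exp_log (div_ne_zero hz hc0)]
    field_simp
  have hZim : ∀ z, (Z z).im = -Real.log ‖z‖ := by
    intro z
    simp [hZ, log_re, hc]
  set G : ℂ → ℂ := g ∘ Z with hG
  have hGa : AnalyticAt ℂ G c := AnalyticAt.comp (by rwa [hZc]) hZa
  have hGc : G c = 0 := by simp [hG, hZc, hg0]
  have hGd : deriv G c ≠ 0 := by
    rw [hG, deriv_comp c (by rw [hZc]; exact hga.differentiableAt) hZa.differentiableAt, hZc]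
    refine mul_ne_zero (fun h0 => ?_) hZd
    rw [h0] at hgd; simp at hgd
  have hZt : Tendsto Z (𝓝 c) (𝓝 0) := by
    have := hZa.continuousAt.tendsto; rwa [hZc] at this
  obtain ⟨N₁, hN₁, hinj⟩ := exists_nhds_injOn_of_deriv_ne_zero hGa hGd
  have hnorm : ∀ᶠ z in 𝓝 c, ‖G z‖ < 1 :=
    hGa.continuousAt.norm.eventually_lt_const (by simp [hGc])
  have hall : ∀ᶠ z in 𝓝 c, z ∈ N₁ ∧ AnalyticAt ℂ G z ∧ ‖G z‖ < 1 ∧ z ≠ 0 ∧ B z ≠ 0 ∧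
      ((0 < (Z z).im ↔ 0 < (g (Z z)).im) ∧ ((Z z).im = 0 ↔ (g (Z z)).im = 0)) ∧
      F (Z z) = α * g (Z z) ^ n :=
    (show ∀ᶠ z in 𝓝 c, z ∈ N₁ from hN₁).and <| hGa.eventually_analyticAt.and <| hnorm.and <|
      (show ∀ᶠ z in 𝓝 c, z ≠ 0 from isOpen_ne.mem_nhds hc0).and <| (hB.continuousAt.eventually_ne hBc).and <|
      (hZt.eventually hsign).and (hZt.eventually hgF)
  obtain ⟨N, hN, hNo, hcN⟩ := _root_.eventually_nhds_iff.1 hall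
  refine ⟨α, G, N, hNo, hcN, hα, fun z hz => (hN z hz).2.1.differentiableAt.differentiableWithinAt,
    hinj.mono fun z hz => (hN z hz).1, hGc, fun z hz => (hN z hz).2.2.1, ?_, ?_, ?_, ?_⟩
  · intro z hz
    obtain ⟨-, -, -, hz0, hBz, -, h7⟩ := hN z hz
    have : (α : ℂ) * G z ^ n = -I * log (B z / B c) := by
      rw [← hZe z hz0, ← hFv, hZe z hz0, h7]; rfl
    rw [this, ← mul_assoc]
    simp only [mul_neg, I_mul_I, neg_neg, one_mul]
    rw [exp_log (div_ne_zero hBz hBc)]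
    field_simp
  · intro z hz
    obtain ⟨-, -, -, hz0, -, h6, -⟩ := hN z hz
    rw [show G z = g (Z z) from rfl, ← h6.1, hZim, neg_pos, Real.log_neg_iff (norm_pos_iff.2 hz0)]
  · intro z hz
    obtain ⟨-, -, -, hz0, -, h6, -⟩ := hN z hz
    rw [show G z = g (Z z) from rfl, ← h6.2, hZim, neg_eq_zero]
    constructor
    · intro h1; rw [h1, Real.log_one]
    · intro h1; exact Real.eq_one_of_pos_of_log_eq_zero (norm_pos_iff.2 hz0) h1
  · rw [← hGc]; exact hGa.hasStrictDerivAt.map_nhds_eq hGd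

end

section

variable {m : ℕ}

/-! ### The rational function -/

def numPoly (μ : Param m) (κ : Fin (m + 1) → ℕ) : Polynomial ℂ :=
  Polynomial.C (cexp (2 * Real.pi * I * (μ.η₀ : ℂ))) * Polynomial.X ^ κ 0 *
    ∏ j : Fin m, (Polynomial.X - Polynomial.C (μ.a j)) ^ κ j.succ

def denPoly (μ : Param m) (κ : Fin (m + 1) → ℕ) : Polynomial ℂ :=
  ∏ j : Fin m, (1 - Polynomial.C (conj (μ.a j)) * Polynomial.X) ^ κ j.succ

/-- `(z - a_j) (1 - conj a_j z)`. -/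
def poleFactor (μ : Param m) (j : Fin m) : Polynomial ℂ :=
  (Polynomial.X - Polynomial.C (μ.a j)) * (1 - Polynomial.C (conj (μ.a j)) * Polynomial.X)

/-- The numerator of the logarithmic derivative `z B' / B`. -/
def critPoly (μ : Param m) (κ : Fin (m + 1) → ℕ) : Polynomial ℂ :=
  Polynomial.C (κ 0 : ℂ) * ∏ j, poleFactor μ j +
    ∑ j, Polynomial.C ((κ j.succ : ℂ) * (1 - μ.a j * conj (μ.a j))) * Polynomial.X *
      ∏ i ∈ Finset.univ.erase j, poleFactor μ i

variable (μ : Param m) (κ : Fin (m + 1) → ℕ)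

theorem numPoly_eval (z : ℂ) : (numPoly μ κ).eval z =
    cexp (2 * Real.pi * I * (μ.η₀ : ℂ)) * z ^ κ 0 * ∏ j : Fin m, (z - μ.a j) ^ κ j.succ := by
  simp [numPoly, Polynomial.eval_prod]

theorem denPoly_eval (z : ℂ) : (denPoly μ κ).eval z =
    ∏ j : Fin m, (1 - conj (μ.a j) * z) ^ κ j.succ := by
  simp [denPoly, Polynomial.eval_prod]

theorem poleFactor_eval (j : Fin m) (z : ℂ) : (poleFactor μ j).eval z =
    (z - μ.a j) * (1 - conj (μ.a j) * z) := by
  simp [poleFactor]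

theorem critPoly_eval (z : ℂ) : (critPoly μ κ).eval z =
    (κ 0 : ℂ) * ∏ j, ((z - μ.a j) * (1 - conj (μ.a j) * z)) +
    ∑ j, (κ j.succ : ℂ) * (1 - μ.a j * conj (μ.a j)) * z *
      ∏ i ∈ Finset.univ.erase j, ((z - μ.a i) * (1 - conj (μ.a i) * z)) := by
  simp [critPoly, Polynomial.eval_prod, Polynomial.eval_finsetSum, poleFactor_eval]

theorem blaschke_eq_div (z : ℂ) :
    blaschke μ κ z = (numPoly μ κ).eval z / (denPoly μ κ).eval z := by
  rw [blaschke, numPoly_eval, denPoly_eval, mul_div_assoc, ← Finset.prod_div_distrib]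
  simp only [div_pow]

theorem Param.a_ne_zero (j : Fin m) : μ.a j ≠ 0 := by
  intro h
  have := μ.norm_a j
  rw [h, norm_zero] at this
  linarith [μ.one_lt_r j]

theorem Param.one_lt_norm_a (j : Fin m) : 1 < ‖μ.a j‖ := by
  rw [μ.norm_a]; exact μ.one_lt_r j

theorem Param.sub_ne_zero {z : ℂ} (hz : ‖z‖ ≤ 1) (j : Fin m) : z - μ.a j ≠ 0 := by
  intro h
  have := μ.one_lt_norm_a j
  rw [← _root_.sub_eq_zero.1 h] at this
  linarith

theorem Param.one_sub_eq_zero_iff (z : ℂ) (j : Fin m) :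
    1 - conj (μ.a j) * z = 0 ↔ z = 1 / conj (μ.a j) := by
  have h : conj (μ.a j) ≠ 0 := (map_ne_zero _).2 (μ.a_ne_zero j)
  rw [eq_div_iff h, _root_.sub_eq_zero, eq_comm, mul_comm]

theorem Param.norm_pole_lt (j : Fin m) : ‖1 / conj (μ.a j)‖ < 1 := by
  rw [norm_div, norm_one, RCLike.norm_conj, div_lt_one (by linarith [μ.one_lt_norm_a j])]
  exact μ.one_lt_norm_a j

theorem Param.one_sub_ne_zero {z : ℂ} (hz : 1 ≤ ‖z‖) (j : Fin m) : 1 - conj (μ.a j) * z ≠ 0 := by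
  rw [Ne, μ.one_sub_eq_zero_iff]
  rintro rfl
  linarith [μ.norm_pole_lt j]

variable {μ κ}

theorem denPoly_eval_eq_zero_iff (hκ : ∀ j, 0 < κ j) (z : ℂ) :
    (denPoly μ κ).eval z = 0 ↔ ∃ j, 1 - conj (μ.a j) * z = 0 := by
  rw [denPoly_eval, Finset.prod_eq_zero_iff]
  simp [(hκ _).ne']

theorem numPoly_eval_eq_zero_iff (hκ : ∀ j, 0 < κ j) (z : ℂ) :
    (numPoly μ κ).eval z = 0 ↔ z = 0 ∨ ∃ j, z - μ.a j = 0 := by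
  rw [numPoly_eval, mul_eq_zero, mul_eq_zero, Finset.prod_eq_zero_iff]
  simp [(hκ _).ne', exp_ne_zero]

theorem numPoly_eval_eq_zero_iff_of_norm_le (hκ : ∀ j, 0 < κ j) {z : ℂ} (hz : ‖z‖ ≤ 1) :
    (numPoly μ κ).eval z = 0 ↔ z = 0 := by
  rw [numPoly_eval_eq_zero_iff hκ]
  simp [μ.sub_ne_zero hz]

theorem denPoly_eval_zero : (denPoly μ κ).eval 0 = 1 := by
  simp [denPoly_eval]

theorem numPoly_eval_zero (hκ : ∀ j, 0 < κ j) : (numPoly μ κ).eval 0 = 0 :=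
  (numPoly_eval_eq_zero_iff hκ 0).2 (Or.inl rfl)

theorem norm_num_eq_norm_den (hκ : ∀ j, 0 < κ j) {z : ℂ} (hz : ‖z‖ = 1) :
    ‖(numPoly μ κ).eval z‖ = ‖(denPoly μ κ).eval z‖ := by
  have h1 := norm_blaschke μ κ hz
  have hd : (denPoly μ κ).eval z ≠ 0 := by
    rw [Ne, denPoly_eval_eq_zero_iff hκ]
    rintro ⟨j, hj⟩
    exact μ.one_sub_ne_zero hz.ge j hj
  rw [blaschke_eq_div, norm_div, div_eq_one_iff_eq (norm_ne_zero_iff.2 hd)] at h1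
  exact h1

theorem analyticAt_blaschke {z : ℂ} (hz : (denPoly μ κ).eval z ≠ 0) :
    AnalyticAt ℂ (blaschke μ κ) z := by
  have : blaschke μ κ = fun z => (numPoly μ κ).eval z / (denPoly μ κ).eval z :=
    funext (blaschke_eq_div μ κ)
  rw [this]
  exact ((numPoly μ κ).differentiable.analyticAt z).div ((denPoly μ κ).differentiable.analyticAt z) hz

/-- Reflection in the circle inverts and conjugates each factor. With division by zero equal to
zero, the identity also holds at the poles and at the zeros other than `0`. -/
theorem blaschke_inv_conj {z : ℂ} (hz : z ≠ 0) :
    blaschke μ κ (1 / conj z) = 1 / conj (blaschke μ κ z) := by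
  have hz' : conj z ≠ 0 := (map_ne_zero _).2 hz
  have he : conj (cexp (2 * Real.pi * I * (μ.η₀ : ℂ))) = (cexp (2 * Real.pi * I * (μ.η₀ : ℂ)))⁻¹ := by
    rw [← exp_conj, ← exp_neg]
    congr 1
    simp [map_ofNat]
  simp only [blaschke, map_mul, map_pow, map_prod, map_div₀, map_sub, map_one, conj_conj, he,
    one_div, mul_inv, inv_inv, inv_pow, ← Finset.prod_inv_distrib]
  congr 1
  refine Finset.prod_congr rfl fun j _ => ?_
  rw [← inv_pow, inv_div]
  congr 1
  have h1 : (conj z)⁻¹ - μ.a j = (1 - μ.a j * conj z) / conj z := by field_simp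
  have h2 : 1 - conj (μ.a j) * (conj z)⁻¹ = (conj z - conj (μ.a j)) / conj z := by field_simp
  rw [h1, h2, div_div_div_cancel_right₀ hz']

theorem norm_blaschke_inv_conj {z : ℂ} (hz : z ≠ 0) :
    ‖blaschke μ κ (1 / conj z)‖ = 1 ↔ ‖blaschke μ κ z‖ = 1 := by
  rw [blaschke_inv_conj hz, norm_div, norm_one, RCLike.norm_conj, one_div, inv_eq_one]

/-- The logarithmic derivative of `B`. -/
theorem deriv_blaschke_mul {z : ℂ} (hz : z ≠ 0) (hz1 : ∀ j, z - μ.a j ≠ 0)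
    (hz2 : ∀ j, 1 - conj (μ.a j) * z ≠ 0) :
    deriv (blaschke μ κ) z * (z * ∏ j, (poleFactor μ j).eval z) =
      blaschke μ κ z * (critPoly μ κ).eval z := by
  set E := cexp (2 * Real.pi * I * (μ.η₀ : ℂ)) with hE
  have hE0 : E ≠ 0 := exp_ne_zero _
  have hfac : ∀ j : Fin m, HasDerivAt (fun z => (z - μ.a j) / (1 - conj (μ.a j) * z))
      ((1 - μ.a j * conj (μ.a j)) / (1 - conj (μ.a j) * z) ^ 2) z := by
    intro j
    have h1 : HasDerivAt (fun z => z - μ.a j) 1 z := (hasDerivAt_id z).sub_const _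
    have h2 : HasDerivAt (fun z => 1 - conj (μ.a j) * z) (-(conj (μ.a j) * 1)) z :=
      ((hasDerivAt_id z).const_mul (conj (μ.a j))).const_sub 1
    refine (h1.div h2 (hz2 j)).congr_deriv ?_
    congr 1
    ring
  have hlog : logDeriv (blaschke μ κ) z = (κ 0 : ℂ) / z + ∑ j : Fin m,
      (κ j.succ : ℂ) * ((1 - μ.a j * conj (μ.a j)) / ((z - μ.a j) * (1 - conj (μ.a j) * z))) := by
    have hb : blaschke μ κ = fun z => (E * z ^ κ 0) *
      ∏ j : Fin m, ((z - μ.a j) / (1 - conj (μ.a j) * z)) ^ κ j.succ := rfl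
    have hne : ∀ j : Fin m, ((z - μ.a j) / (1 - conj (μ.a j) * z)) ^ κ j.succ ≠ 0 := fun j =>
      pow_ne_zero _ (div_ne_zero (hz1 j) (hz2 j))
    have hdf : ∀ j : Fin m, DifferentiableAt ℂ
        (fun z => ((z - μ.a j) / (1 - conj (μ.a j) * z)) ^ κ j.succ) z := fun j =>
      (hfac j).differentiableAt.pow _
    rw [hb, logDeriv_mul (f := fun z => E * z ^ κ 0) z (mul_ne_zero hE0 (pow_ne_zero _ hz)) (Finset.prod_ne_zero_iff.2 fun j _ => hne j)
      (by fun_prop) (DifferentiableAt.fun_finsetProd fun j _ => hdf j),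
      logDeriv_const_mul z E hE0, logDeriv_fun_pow differentiableAt_fun_id,
      logDeriv_prod (fun j _ => hne j) (fun j _ => hdf j)]
    congr 1
    · rw [logDeriv_apply]; simp [div_eq_mul_inv]
    · refine Finset.sum_congr rfl fun j _ => ?_
      rw [logDeriv_fun_pow (hfac j).differentiableAt, logDeriv_apply, (hfac j).deriv]
      congr 1
      have := hz1 j; have := hz2 j
      field_simp
  have hBne : blaschke μ κ z ≠ 0 := by
    rw [blaschke]
    exact mul_ne_zero (mul_ne_zero hE0 (pow_ne_zero _ hz))
      (Finset.prod_ne_zero_iff.2 fun j _ => pow_ne_zero _ (div_ne_zero (hz1 j) (hz2 j)))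
  have hder : deriv (blaschke μ κ) z = blaschke μ κ z * logDeriv (blaschke μ κ) z := by
    rw [logDeriv_apply, mul_div_cancel₀ _ hBne]
  rw [hder, hlog, mul_assoc]
  congr 1
  rw [critPoly_eval, add_mul, Finset.sum_mul]
  simp only [poleFactor_eval]
  congr 1
  · field_simp
  · refine Finset.sum_congr rfl fun j _ => ?_
    rw [← Finset.mul_prod_erase Finset.univ _ (Finset.mem_univ j)]
    have := hz1 j; have := hz2 j
    field_simp

theorem natDegree_poleFactor_le (j : Fin m) : (poleFactor μ j).natDegree ≤ 2 := by
  rw [poleFactor]; compute_degree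

/-- Each summand replaces one of the `m` quadratic factors by a multiple of `X`. This bound is the
one that `2m` turning points must saturate. -/
theorem natDegree_critPoly_le : (critPoly μ κ).natDegree ≤ 2 * m := by
  have hprod : ∀ s : Finset (Fin m), (∏ i ∈ s, poleFactor μ i).natDegree ≤ 2 * s.card := by
    intro s
    refine (Polynomial.natDegree_prod_le _ _).trans ?_
    refine (Finset.sum_le_sum fun i _ => natDegree_poleFactor_le i).trans ?_
    simp [mul_comm]
  rw [critPoly]
  refine Polynomial.natDegree_add_le_of_degree_le ?_ (Polynomial.natDegree_sum_le_of_forall_le _ _ fun j _ => ?_)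
  · refine (Polynomial.natDegree_C_mul_le _ _).trans ((hprod _).trans ?_)
    simp
  · refine Polynomial.natDegree_mul_le.trans ?_
    have h1 := hprod (Finset.univ.erase j)
    rw [Finset.card_erase_of_mem (Finset.mem_univ j), Finset.card_univ, Fintype.card_fin] at h1
    have h2 : (Polynomial.C ((κ j.succ : ℂ) * (1 - μ.a j * conj (μ.a j))) * Polynomial.X).natDegree ≤ 1 :=
      (Polynomial.natDegree_C_mul_le _ _).trans Polynomial.natDegree_X_le
    have := j.pos
    omega

theorem critPoly_eval_zero_ne (hκ : ∀ j, 0 < κ j) : (critPoly μ κ).eval 0 ≠ 0 := by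
  rw [critPoly_eval]
  simp only [zero_sub, mul_zero, sub_zero, mul_one, zero_mul, Finset.sum_const_zero, add_zero]
  refine mul_ne_zero (by exact_mod_cast (hκ 0).ne') (Finset.prod_ne_zero_iff.2 fun j _ => ?_)
  exact neg_ne_zero.2 (μ.a_ne_zero j)

/-- A turning point is a critical point. -/
theorem deriv_eq_zero_of_isTurningPoint (hκ : ∀ j, 0 < κ j) {c : Circle}
    (h : IsTurningPoint (circleRestriction μ κ) c) : deriv (blaschke μ κ) c = 0 := by
  obtain ⟨F, ⟨hFc, hF⟩, t, ht, hext⟩ := h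
  set b : ℝ → ℂ := fun s => blaschke μ κ (exp (2 * Real.pi * s * I)) with hb
  have hbF : ∀ s, b s = exp (2 * Real.pi * F s * I) := by
    intro s
    have := congrArg (fun z : Circle => (z : ℂ)) (hF s)
    simp only [circleRestriction, Circle.coe_exp] at this
    push_cast at this
    exact this.symm
  have hct : exp (2 * Real.pi * t * I) = (c : ℂ) := by
    rw [← ht, Circle.coe_exp]; push_cast; rfl
  have hd : (denPoly μ κ).eval (c : ℂ) ≠ 0 := by
    rw [Ne, denPoly_eval_eq_zero_iff hκ]
    rintro ⟨j, hj⟩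
    exact μ.one_sub_ne_zero c.norm_coe.ge j hj
  have hγ : HasDerivAt (fun s : ℝ => exp (2 * Real.pi * s * I)) (c * (2 * Real.pi * I)) t := by
    have h1 : HasDerivAt (fun s : ℝ => (2 * Real.pi * s * I : ℂ)) (2 * Real.pi * 1 * I) t :=
      ((ofRealCLM.hasDerivAt (x := t)).const_mul (2 * Real.pi : ℂ)).mul_const I
    have h2 := h1.cexp
    rw [hct, mul_one] at h2
    exact h2
  have hbd : HasDerivAt b (deriv (blaschke μ κ) c * (c * (2 * Real.pi * I))) t := by
    have h1 : HasDerivAt (blaschke μ κ) (deriv (blaschke μ κ) c) (exp (2 * Real.pi * t * I)) := by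
      rw [hct]; exact (analyticAt_blaschke hd).differentiableAt.hasDerivAt
    exact h1.comp t hγ
  have hbt : b t ≠ 0 := by rw [hbF]; exact exp_ne_zero _
  -- differentiability of the lift
  have hlogF : (fun s => F t + (log (b s / b t)).im / (2 * Real.pi)) =ᶠ[𝓝 t] F := by
    -- The bound `1 / 2` keeps `2π (F s - F t)` in `(-π, π)`, where the principal logarithm recovers
    -- it from `b s / b t`.
    have hev : ∀ᶠ s in 𝓝 t, |F s - F t| < 1 / 2 := by
      have : ContinuousAt (fun s => |F s - F t|) t := by fun_prop
      exact this.eventually_lt_const (by simp)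
    filter_upwards [hev] with s hs
    have h1 : b s / b t = exp ((2 * Real.pi * (F s - F t) : ℝ) * I) := by
      rw [hbF, hbF, ← exp_sub]; congr 1; push_cast; ring
    have hpi := Real.pi_pos
    rw [abs_lt] at hs
    have h2 : log (b s / b t) = (2 * Real.pi * (F s - F t) : ℝ) * I := by
      rw [h1, log_exp]
      · simp only [im_ofReal_mul, I_im, mul_one]; nlinarith
      · simp only [im_ofReal_mul, I_im, mul_one]; nlinarith
    rw [h2]
    simp only [im_ofReal_mul, I_im, mul_one]
    field_simp
    ring
  have hFd : DifferentiableAt ℝ F t := by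
    refine DifferentiableAt.congr_of_eventuallyEq ?_ hlogF.symm
    have h1 : DifferentiableAt ℝ (fun s => log (b s / b t)) t := by
      have h2 : HasDerivAt (fun s => b s / b t) _ t := hbd.div_const (b t)
      exact (h2.clog_real (by simp [div_self hbt])).differentiableAt
    exact ((imCLM.differentiableAt.comp t h1).div_const _).const_add _
  have hF0 : HasDerivAt F 0 t := by
    have := hFd.hasDerivAt
    rwa [hext.deriv_eq_zero] at this
  have hb0 : HasDerivAt b 0 t := by
    have h1 : HasDerivAt (fun s : ℝ => (2 * Real.pi * F s * I : ℂ)) (2 * Real.pi * ((0 : ℝ) : ℂ) * I) t :=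
      ((hF0.ofReal_comp).const_mul (2 * Real.pi : ℂ)).mul_const I
    have h2 := h1.cexp
    simp only [ofReal_zero, mul_zero, zero_mul] at h2
    rwa [show b = fun s => exp (2 * Real.pi * F s * I) from funext hbF]
  have := hbd.unique hb0
  have hc0 : (c : ℂ) ≠ 0 := c.coe_ne_zero
  have hpi : (Real.pi : ℂ) ≠ 0 := by exact_mod_cast Real.pi_ne_zero
  refine (mul_eq_zero.1 this).resolve_right ?_
  exact mul_ne_zero hc0 (mul_ne_zero (mul_ne_zero two_ne_zero hpi) I_ne_zero)

end

section

variable {m : ℕ} {μ : Param m} {κ : Fin (m + 1) → ℕ}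

/-! ### The critical points -/

/-- The free critical points are simple, lie on the unit circle, and there are `2 m` of them. -/
structure HasCircleCriticalPoints (μ : Param m) (κ : Fin (m + 1) → ℕ) : Prop where
  pos : ∀ j, 0 < κ j
  card : (critPoly μ κ).roots.toFinset.card = 2 * m
  norm_root : ∀ c, (critPoly μ κ).eval c = 0 → ‖c‖ = 1
  simple : ∀ c, (critPoly μ κ).eval c = 0 → (critPoly μ κ).derivative.eval c ≠ 0

theorem critPoly_ne_zero (hκ : ∀ j, 0 < κ j) : critPoly μ κ ≠ 0 := by
  intro h
  have := critPoly_eval_zero_ne (μ := μ) hκ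
  rw [h] at this
  simp at this

theorem critPoly_eval_eq_zero_of_deriv {c : ℂ} (hc : ‖c‖ = 1)
    (hd : deriv (blaschke μ κ) c = 0) : (critPoly μ κ).eval c = 0 := by
  have hc0 : c ≠ 0 := by rintro rfl; simp at hc
  have h := deriv_blaschke_mul (μ := μ) (κ := κ) hc0 (μ.sub_ne_zero hc.le) (μ.one_sub_ne_zero hc.ge)
  rw [hd, zero_mul, eq_comm, mul_eq_zero] at h
  refine h.resolve_left fun h0 => ?_
  have := norm_blaschke μ κ hc
  rw [h0, norm_zero] at this
  exact zero_ne_one this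

/-- The number of turning points, of distinct roots, of roots with multiplicity and the degree form
an increasing chain from `2m` to at most `2m`. Equality throughout makes every root a turning point,
on the circle, and simple. -/
theorem hasCircleCriticalPoints (hκ : ∀ j, 0 < κ j)
    (hμ : IsMultimodal (2 * m) (circleRestriction μ κ)) : HasCircleCriticalPoints μ κ := by
  set P := critPoly μ κ with hP
  have hP0 : P ≠ 0 := critPoly_ne_zero hκ
  set T : Set ℂ := (fun c : Circle => (c : ℂ)) '' {c | IsTurningPoint (circleRestriction μ κ) c} with hT
  have hTcard : T.encard = (2 * m : ℕ) := by
    exact (Function.Injective.encard_image Circle.coe_injective _).trans hμ.2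
  have hsub : T ⊆ (P.roots.toFinset : Set ℂ) := by
    rintro _ ⟨c, hc, rfl⟩
    rw [Finset.mem_coe, Multiset.mem_toFinset, Polynomial.mem_roots hP0]
    exact critPoly_eval_eq_zero_of_deriv c.norm_coe (deriv_eq_zero_of_isTurningPoint hκ hc)
  have hle1 : P.roots.toFinset.card ≤ P.roots.card := Multiset.toFinset_card_le _
  have hle2 : P.roots.card ≤ 2 * m := (Polynomial.card_roots' P).trans natDegree_critPoly_le
  have hge : 2 * m ≤ P.roots.toFinset.card := by
    have := Set.encard_le_encard hsub
    rw [hTcard, Set.encard_coe_eq_coe_finsetCard] at this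
    exact_mod_cast this
  have hcard : P.roots.toFinset.card = 2 * m := le_antisymm (hle1.trans hle2) hge
  have hTeq : T = (P.roots.toFinset : Set ℂ) := by
    refine ((Finset.finite_toSet _).subset hsub).eq_of_subset_of_encard_le hsub ?_
    rw [hTcard, Set.encard_coe_eq_coe_finsetCard, hcard]
  have hnodup : P.roots.Nodup := by
    rw [← Multiset.dedup_eq_self]
    refine Multiset.eq_of_le_of_card_le (Multiset.dedup_le _) ?_
    have : P.roots.toFinset.card = (Multiset.dedup P.roots).card := rfl
    omega
  refine ⟨hκ, hcard, fun c hc => ?_, fun c hc hd => ?_⟩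
  · have : c ∈ T := by
      rw [hTeq, Finset.mem_coe, Multiset.mem_toFinset, Polynomial.mem_roots hP0]; exact hc
    obtain ⟨c', -, rfl⟩ := this
    exact c'.norm_coe
  · have h1 : 1 < P.rootMultiplicity c :=
      (Polynomial.one_lt_rootMultiplicity_iff_isRoot hP0).2 ⟨hc, hd⟩
    have h2 := Multiset.nodup_iff_count_le_one.1 hnodup c
    rw [Polynomial.count_roots] at h2
    omega

/-! ### Branched discs from pairs of polynomials -/

/-- Stated for a pair so that it serves both `B` and `1 / B`; comparing `|n|` with `|d|` describes
the regions without dividing at poles. By `h₂` the strict region avoids the circle, and `h₅` makes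
the fibres finite. -/
theorem isBranchedDisc_of_pair {n d : Polynomial ℂ}
    (h₁ : ∀ z, ‖z‖ ≤ 1 → n.eval z = 0 → d.eval z ≠ 0)
    (h₂ : ∀ z, ‖z‖ = 1 → ‖n.eval z‖ = ‖d.eval z‖)
    (h₃ : ∀ z, ‖z‖ < 1 → n.eval z ≠ 0 → d.eval z ≠ 0 →
      deriv (fun z => n.eval z / d.eval z) z ≠ 0)
    (h₄ : ∀ z, ‖z‖ = 1 → ∃ N ∈ 𝓝 z, InjOn (fun z => n.eval z / d.eval z) (N ∩ ball 0 1))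
    (h₅ : ∀ w, n - Polynomial.C w * d ≠ 0) :
    IsBranchedDisc (fun z => n.eval z / d.eval z) {z | ‖z‖ ≤ 1 ∧ ‖n.eval z‖ ≤ ‖d.eval z‖}
      {z | ‖z‖ < 1 ∧ ‖n.eval z‖ < ‖d.eval z‖} := by
  have hn : Continuous fun z => n.eval z := n.continuous
  have hd : Continuous fun z => d.eval z := d.continuous
  have hd0 : ∀ z, ‖z‖ ≤ 1 → ‖n.eval z‖ ≤ ‖d.eval z‖ → d.eval z ≠ 0 := by
    intro z hz hnd h0
    rw [h0, norm_zero] at hnd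
    exact h₁ z hz (norm_le_zero_iff.1 hnd) h0
  have han : ∀ z, d.eval z ≠ 0 → AnalyticAt ℂ (fun z => n.eval z / d.eval z) z := fun z hz =>
    (n.differentiable.analyticAt z).div (d.differentiable.analyticAt z) hz
  refine ⟨?_, ?_, ?_, ?_, fun z hz => han z (hd0 z hz.1 hz.2), ?_, ?_, ?_, ?_⟩
  · have : {z : ℂ | ‖z‖ ≤ 1 ∧ ‖n.eval z‖ ≤ ‖d.eval z‖} =
        closedBall 0 1 ∩ {z | ‖n.eval z‖ ≤ ‖d.eval z‖} := by ext; simp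
    rw [this]
    exact (isCompact_closedBall 0 1).inter_right (isClosed_le hn.norm hd.norm)
  · exact (isOpen_lt continuous_norm continuous_const).inter (isOpen_lt hn.norm hd.norm)
  · intro z
    simp only [mem_ofPred_eq, norm_div]
    constructor
    · rintro ⟨hz, hnd⟩
      exact ⟨⟨hz.le, hnd.le⟩, (div_lt_one (lt_of_le_of_lt (norm_nonneg _) hnd)).2 hnd⟩
    · rintro ⟨⟨hz, hnd⟩, hlt⟩
      have hpos : 0 < ‖d.eval z‖ := norm_pos_iff.2 (hd0 z hz hnd)
      rw [div_lt_one hpos] at hlt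
      refine ⟨lt_of_le_of_ne hz fun h => ?_, hlt⟩
      exact hlt.ne (h₂ z h)
  · rintro z ⟨hz, hnd⟩
    rw [norm_div]
    exact div_le_one_of_le₀ hnd (norm_nonneg _)
  · rintro z ⟨hz, hnd⟩ hf
    exact h₃ z hz (fun h => hf (by simp [h])) (hd0 z hz.le hnd.le)
  · rintro z ⟨hz, hnd⟩ - htop
    rw [analyticOrderAt_eq_top] at htop
    have hdz := hd0 z hz.le hnd.le
    have hn0 : ∀ᶠ y in 𝓝 z, n.eval y = 0 := by
      filter_upwards [htop, hd.continuousAt.eventually_ne hdz] with y hy1 hy2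
      exact (div_eq_zero_iff.1 hy1).resolve_right hy2
    have : n = 0 := Polynomial.eq_zero_of_infinite_isRoot n (infinite_of_mem_nhds z hn0)
    exact h₅ 0 (by simp [this])
  · intro w
    refine ((n - Polynomial.C w * d).roots.toFinset.finite_toSet).subset ?_
    rintro z ⟨⟨hz, hnd⟩, hw⟩
    rw [Finset.mem_coe, Multiset.mem_toFinset, Polynomial.mem_roots (h₅ w)]
    rw [div_eq_iff (hd0 z hz hnd)] at hw
    simp [Polynomial.IsRoot, hw]
  · rintro z ⟨hz, hnd⟩ hf
    have hdz := hd0 z hz hnd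
    rcases hz.lt_or_eq with hlt | heq
    · have hn0 : n.eval z ≠ 0 := by
        intro h0
        simp [h0] at hf
      obtain ⟨N, hN, hi⟩ := exists_nhds_injOn_of_deriv_ne_zero (han z hdz) (h₃ z hlt hn0 hdz)
      exact ⟨N, hN, hi.mono inter_subset_left⟩
    · obtain ⟨N, hN, hi⟩ := h₄ z heq
      exact ⟨N, hN, hi.mono (inter_subset_inter_right _ fun y hy => mem_ball_zero_iff.2 hy.1)⟩

/-- The inner side corresponds to the upper half-plane, where squaring is injective. As `‖G‖ < 1`,
two values of `α * G ^ n` differ by less than `2 < 2π`, so the exponential identifies none of them.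
-/
theorem IsCircleChart.injOn_ball {B : ℂ → ℂ} {c : ℂ} {n : ℕ} {α : ℝ} {G : ℂ → ℂ} {N : Set ℂ}
    (h : IsCircleChart B c n α G N) (hn : n = 1 ∨ n = 2) (hB : B c ≠ 0) :
    InjOn B (N ∩ ball 0 1) := by
  rintro z ⟨hz, hzb⟩ z' ⟨hz', hzb'⟩ hzz
  have hn0 : n ≠ 0 := by omega
  have him := (h.lt_iff z hz).1 (mem_ball_zero_iff.1 hzb)
  have him' := (h.lt_iff z' hz').1 (mem_ball_zero_iff.1 hzb')
  have hα0 : (α : ℂ) ≠ 0 := by rcases h.sign with h1 | h1 <;> simp [h1]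
  have hαn : ‖(α : ℂ)‖ = 1 := by rcases h.sign with h1 | h1 <;> simp [h1]
  rw [h.eq z hz, h.eq z' hz'] at hzz
  obtain ⟨k, hk⟩ := exp_eq_exp_iff_exists_int.1 (mul_left_cancel₀ hB hzz)
  have hk' : (α : ℂ) * G z ^ n = α * G z' ^ n + k * (2 * Real.pi) :=
    mul_left_cancel₀ I_ne_zero (by linear_combination hk)
  have hk0 : k = 0 := by
    by_contra hk0
    have h1 : (1 : ℝ) ≤ |(k : ℝ)| := by exact_mod_cast Int.one_le_abs hk0
    have h2 : ‖(k : ℂ) * (2 * Real.pi)‖ < 2 := by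
      have e : (k : ℂ) * (2 * Real.pi) = α * G z ^ n - α * G z' ^ n := by rw [hk']; ring
      rw [e]
      have b1 : ‖(α : ℂ) * G z ^ n‖ < 1 := by
        rw [norm_mul, hαn, one_mul, norm_pow]; exact pow_lt_one₀ (norm_nonneg _) (h.norm_lt z hz) hn0
      have b2 : ‖(α : ℂ) * G z' ^ n‖ < 1 := by
        rw [norm_mul, hαn, one_mul, norm_pow]; exact pow_lt_one₀ (norm_nonneg _) (h.norm_lt z' hz') hn0
      linarith [norm_sub_le ((α : ℂ) * G z ^ n) (α * G z' ^ n)]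
    have h3 : ‖(k : ℂ) * (2 * Real.pi)‖ = |(k : ℝ)| * (2 * Real.pi) := by
      rw [norm_mul, norm_intCast, norm_mul, norm_real, Real.norm_of_nonneg Real.pi_pos.le]
      norm_num
    rw [h3] at h2
    nlinarith [Real.pi_gt_three]
  rw [hk0, Int.cast_zero, zero_mul, add_zero] at hk'
  have hGG := mul_left_cancel₀ hα0 hk'
  refine h.inj hz hz' ?_
  rcases hn with rfl | rfl
  · simpa using hGG
  · rcases sq_eq_sq_iff_eq_or_eq_neg.1 hGG with h1 | h1
    · exact h1
    · rw [h1, neg_im] at him; linarith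

/-! ### Local behaviour of `B`, and `B`, `1 / B` as branched discs -/

namespace HasCircleCriticalPoints

variable (H : HasCircleCriticalPoints μ κ)
include H

theorem deriv_ne_zero {z : ℂ} (hn : (numPoly μ κ).eval z ≠ 0) (hd : (denPoly μ κ).eval z ≠ 0)
    (hP : (critPoly μ κ).eval z ≠ 0) : deriv (blaschke μ κ) z ≠ 0 := by
  rw [Ne, numPoly_eval_eq_zero_iff H.pos] at hn
  rw [Ne, denPoly_eval_eq_zero_iff H.pos] at hd
  push Not at hn hd
  have h := deriv_blaschke_mul (μ := μ) (κ := κ) hn.1 hn.2 hd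
  intro h0
  rw [h0, zero_mul, eq_comm, mul_eq_zero] at h
  refine h.elim (fun hB => ?_) hP
  rw [blaschke_eq_div, div_eq_zero_iff, numPoly_eval_eq_zero_iff H.pos, denPoly_eval_eq_zero_iff H.pos] at hB
  rcases hB with (hB | ⟨j, hj⟩) | ⟨j, hj⟩
  · exact hn.1 hB
  · exact hn.2 j hj
  · exact hd j hj

theorem deriv_ne_zero_of_norm_ne {z : ℂ} (hz : ‖z‖ ≠ 1) (hn : (numPoly μ κ).eval z ≠ 0)
    (hd : (denPoly μ κ).eval z ≠ 0) : deriv (blaschke μ κ) z ≠ 0 :=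
  H.deriv_ne_zero hn hd fun h => hz (H.norm_root z h)

theorem den_ne_zero {c : ℂ} (hc : 1 ≤ ‖c‖) : (denPoly μ κ).eval c ≠ 0 := by
  rw [Ne, denPoly_eval_eq_zero_iff H.pos]
  rintro ⟨j, hj⟩
  exact μ.one_sub_ne_zero hc j hj

theorem num_ne_zero {c : ℂ} (hc0 : c ≠ 0) (hc : ‖c‖ ≤ 1) : (numPoly μ κ).eval c ≠ 0 := by
  rwa [Ne, numPoly_eval_eq_zero_iff_of_norm_le H.pos hc]

theorem exists_chart_regular {c : ℂ} (hc : ‖c‖ = 1) (hP : (critPoly μ κ).eval c ≠ 0) :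
    ∃ α G N, IsCircleChart (blaschke μ κ) c 1 α G N := by
  have hc0 : c ≠ 0 := by rintro rfl; simp at hc
  have hd := H.den_ne_zero hc.ge
  have hBa := analyticAt_blaschke (μ := μ) (κ := κ) hd
  refine exists_circleChart hBa hc (fun z hz => norm_blaschke μ κ hz) one_pos ?_
  simpa using hBa.analyticOrderAt_sub_eq_one_of_deriv_ne_zero
    (H.deriv_ne_zero (H.num_ne_zero hc0 hc.le) hd hP)

theorem isCriticalPoint {c : ℂ} (hP : (critPoly μ κ).eval c = 0) :
    IsCriticalPoint (blaschke μ κ) c := by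
  have hc := H.norm_root c hP
  have hc0 : c ≠ 0 := by rintro rfl; simp at hc
  refine ⟨analyticAt_blaschke (H.den_ne_zero hc.ge), ?_⟩
  have h := deriv_blaschke_mul (μ := μ) (κ := κ) hc0 (μ.sub_ne_zero hc.le) (μ.one_sub_ne_zero hc.ge)
  rw [hP, mul_zero, mul_eq_zero] at h
  refine h.resolve_right (mul_ne_zero hc0 (Finset.prod_ne_zero_iff.2 fun j _ => ?_))
  rw [poleFactor_eval]
  exact mul_ne_zero (μ.sub_ne_zero hc.le j) (μ.one_sub_ne_zero hc.ge j)

/-- Near `c` the derivative of `B` is a nonvanishing factor times `critPoly`. A simple root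
therefore gives `B'' c ≠ 0`, so `B - B c` vanishes to order exactly two. -/
theorem exists_chart_critical {c : ℂ} (hP : (critPoly μ κ).eval c = 0) :
    ∃ α G N, IsCircleChart (blaschke μ κ) c 2 α G N := by
  have hc := H.norm_root c hP
  have hc0 : c ≠ 0 := by rintro rfl; simp at hc
  obtain ⟨hBa, hB1⟩ := H.isCriticalPoint hP
  refine exists_circleChart hBa hc (fun z hz => norm_blaschke μ κ hz) two_pos ?_
  have hBc : blaschke μ κ c ≠ 0 := by
    intro h0; have := norm_blaschke μ κ hc; rw [h0, norm_zero] at this; exact zero_ne_one this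
  set Q : ℂ → ℂ := fun z => z * ∏ j, (poleFactor μ j).eval z with hQ
  have hQc : Q c ≠ 0 := by
    refine mul_ne_zero hc0 (Finset.prod_ne_zero_iff.2 fun j _ => ?_)
    rw [poleFactor_eval]
    exact mul_ne_zero (μ.sub_ne_zero hc.le j) (μ.one_sub_ne_zero hc.ge j)
  have hQd : Differentiable ℂ Q :=
    differentiable_id.mul (Differentiable.fun_finsetProd fun j _ => (poleFactor μ j).differentiable)
  have hev : deriv (blaschke μ κ) =ᶠ[𝓝 c]
      fun z => blaschke μ κ z / Q z * (critPoly μ κ).eval z := by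
    filter_upwards [hQd.continuous.continuousAt.eventually_ne hQc] with z hz
    have hz0 : z ≠ 0 := left_ne_zero_of_mul hz
    have hz1 := fun j => (Finset.prod_ne_zero_iff.1 (right_ne_zero_of_mul hz)) j (Finset.mem_univ j)
    simp only [poleFactor_eval] at hz1
    have h := deriv_blaschke_mul (μ := μ) (κ := κ) hz0 (fun j => left_ne_zero_of_mul (hz1 j))
      (fun j => right_ne_zero_of_mul (hz1 j))
    rw [div_mul_eq_mul_div, eq_div_iff hz]
    exact h
  have hB2 : deriv (deriv (blaschke μ κ)) c ≠ 0 := by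
    rw [hev.deriv_eq]
    have h1 : HasDerivAt (fun z => blaschke μ κ z / Q z) _ c :=
      (hBa.differentiableAt.div hQd.differentiableAt hQc).hasDerivAt
    have h2 := h1.mul ((critPoly μ κ).hasDerivAt c)
    have h3 : deriv (fun z => blaschke μ κ z / Q z * (critPoly μ κ).eval z) c = _ := h2.deriv
    rw [h3, hP, mul_zero, zero_add]
    exact mul_ne_zero (div_ne_zero hBc hQc) (H.simple c hP)
  have ho := (hBa.deriv).analyticOrderAt_eq_one_of_zero_deriv_ne_zero hB1 hB2
  have hd' : deriv (fun z => blaschke μ κ z - blaschke μ κ c) = deriv (blaschke μ κ) := by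
    ext z; exact deriv_sub_const _
  have h4 := analyticOrderAt_deriv_eq_iff (f := fun z => blaschke μ κ z - blaschke μ κ c)
    (hBa.sub analyticAt_const) (sub_self _) (n := 1)
  rw [hd'] at h4
  rw [h4.2 (by simpa using ho)]
  norm_num

theorem exists_chart {c : ℂ} (hc : ‖c‖ = 1) :
    ∃ n α G N, (n = 1 ∨ n = 2) ∧ IsCircleChart (blaschke μ κ) c n α G N := by
  by_cases hP : (critPoly μ κ).eval c = 0
  · obtain ⟨α, G, N, h⟩ := H.exists_chart_critical hP
    exact ⟨2, α, G, N, Or.inr rfl, h⟩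
  · obtain ⟨α, G, N, h⟩ := H.exists_chart_regular hc hP
    exact ⟨1, α, G, N, Or.inl rfl, h⟩

theorem exists_nhds_injOn {c : ℂ} (hc : ‖c‖ = 1) :
    ∃ N ∈ 𝓝 c, InjOn (blaschke μ κ) (N ∩ ball 0 1) := by
  obtain ⟨n, α, G, N, hn, h⟩ := H.exists_chart hc
  refine ⟨N, h.isOpen.mem_nhds h.mem, h.injOn_ball hn fun h0 => ?_⟩
  have := norm_blaschke μ κ hc
  rw [h0, norm_zero] at this
  exact zero_ne_one this

/-- A repeated `a_j` would make every term of `critPoly` vanish at the pole `1 / conj a_j`, which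
lies inside the disc, while all roots lie on the circle. Hence the `m` poles are distinct. -/
theorem a_injective : Function.Injective μ.a := by
  intro i j hij
  by_contra hne
  set p := 1 / conj (μ.a j) with hp
  have hj : 1 - conj (μ.a j) * p = 0 := (μ.one_sub_eq_zero_iff p j).2 rfl
  have hi : 1 - conj (μ.a i) * p = 0 := by rw [hij]; exact hj
  have hP : (critPoly μ κ).eval p = 0 := by
    rw [critPoly_eval]
    have h1 : ∏ l, ((p - μ.a l) * (1 - conj (μ.a l) * p)) = 0 :=
      Finset.prod_eq_zero (Finset.mem_univ j) (by rw [hj, mul_zero])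
    rw [h1, mul_zero, zero_add]
    refine Finset.sum_eq_zero fun l _ => ?_
    have h2 : ∏ i ∈ Finset.univ.erase l, ((p - μ.a i) * (1 - conj (μ.a i) * p)) = 0 := by
      by_cases hl : l = j
      · exact Finset.prod_eq_zero (i := i) (by simp [hl, hne]) (by rw [hi, mul_zero])
      · exact Finset.prod_eq_zero (i := j) (by simp [Ne.symm hl]) (by rw [hj, mul_zero])
    rw [h2, mul_zero]
  have := H.norm_root p hP
  linarith [μ.norm_pole_lt j]

theorem not_common {z : ℂ} (hz : ‖z‖ ≤ 1) (hn : (numPoly μ κ).eval z = 0) :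
    (denPoly μ κ).eval z ≠ 0 := by
  rw [numPoly_eval_eq_zero_iff_of_norm_le H.pos hz] at hn
  rw [hn, denPoly_eval_zero]; exact one_ne_zero

/-- The closed region `|B| ≤ 1` in the closed disc. -/
theorem isBranchedDisc_zero :
    IsBranchedDisc (fun z => (numPoly μ κ).eval z / (denPoly μ κ).eval z)
      {z | ‖z‖ ≤ 1 ∧ ‖(numPoly μ κ).eval z‖ ≤ ‖(denPoly μ κ).eval z‖}
      {z | ‖z‖ < 1 ∧ ‖(numPoly μ κ).eval z‖ < ‖(denPoly μ κ).eval z‖} := by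
  have hB : (fun z => (numPoly μ κ).eval z / (denPoly μ κ).eval z) = blaschke μ κ :=
    (funext (blaschke_eq_div μ κ)).symm
  refine isBranchedDisc_of_pair (fun z hz h => H.not_common hz h) (fun z hz => norm_num_eq_norm_den H.pos hz)
    (fun z hz hn hd => ?_) (fun z hz => ?_) (fun w hw => ?_)
  · rw [hB]; exact H.deriv_ne_zero_of_norm_ne hz.ne hn hd
  · rw [hB]; exact H.exists_nhds_injOn hz
  -- Evaluation at `0` forces `w = 0`, and then the numerator would vanish at `1`.
  · have h0 := congrArg (Polynomial.eval 0) hw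
    simp only [Polynomial.eval_sub, Polynomial.eval_mul, Polynomial.eval_C, numPoly_eval_zero H.pos,
      denPoly_eval_zero, mul_one, zero_sub, Polynomial.eval_zero, neg_eq_zero] at h0
    rw [h0, Polynomial.C_0, zero_mul, sub_zero] at hw
    have h1 := congrArg (Polynomial.eval 1) hw
    rw [Polynomial.eval_zero] at h1
    exact H.num_ne_zero one_ne_zero (by simp) h1

/-- The closed region `|B| ≥ 1` in the closed disc. -/
theorem isBranchedDisc_infty :
    IsBranchedDisc (fun z => (denPoly μ κ).eval z / (numPoly μ κ).eval z)
      {z | ‖z‖ ≤ 1 ∧ ‖(denPoly μ κ).eval z‖ ≤ ‖(numPoly μ κ).eval z‖}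
      {z | ‖z‖ < 1 ∧ ‖(denPoly μ κ).eval z‖ < ‖(numPoly μ κ).eval z‖} := by
  have hB : (fun z => (denPoly μ κ).eval z / (numPoly μ κ).eval z) = fun z => (blaschke μ κ z)⁻¹ := by
    ext z; rw [blaschke_eq_div, inv_div]
  refine isBranchedDisc_of_pair (fun z hz h h' => H.not_common hz h' h)
    (fun z hz => (norm_num_eq_norm_den H.pos hz).symm)
    (fun z hz hd hn => ?_) (fun z hz => ?_) (fun w hw => ?_)
  · have hB0 : blaschke μ κ z ≠ 0 := by rw [blaschke_eq_div]; exact div_ne_zero hn hd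
    rw [hB, deriv_fun_inv'' (analyticAt_blaschke hd).differentiableAt hB0]
    exact div_ne_zero (neg_ne_zero.2 (H.deriv_ne_zero_of_norm_ne hz.ne hn hd)) (pow_ne_zero _ hB0)
  · rw [hB]
    obtain ⟨N, hN, hi⟩ := H.exists_nhds_injOn hz
    exact ⟨N, hN, fun x hx y hy hxy => hi hx hy (inv_injective hxy)⟩
  · have h0 := congrArg (Polynomial.eval 0) hw
    simp only [Polynomial.eval_sub, Polynomial.eval_mul, Polynomial.eval_C, numPoly_eval_zero H.pos,
      denPoly_eval_zero, mul_zero, sub_zero, Polynomial.eval_zero] at h0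
    exact one_ne_zero h0

end HasCircleCriticalPoints
end

section

/-! ### Arcs of the circle and half-discs -/

/-- A Möbius transformation of the closed disc moving `±1` to given boundary points. -/
theorem exists_moebius {w₁ w₂ : ℂ} (h₁ : ‖w₁‖ = 1) (h₂ : ‖w₂‖ = 1) (hne : w₁ ≠ w₂) :
    ∃ M : ℂ → ℂ, ContinuousOn M (closedBall 0 1) ∧ BijOn M (closedBall 0 1) (closedBall 0 1) ∧
      (∀ z ∈ closedBall (0 : ℂ) 1, ‖M z‖ = 1 ↔ ‖z‖ = 1) ∧ M 1 = w₁ ∧ M (-1) = w₂ := by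
  have hw₂ : w₂ ≠ 0 := by rintro rfl; simp at h₂
  -- `v` is the square root of `-(w₁ / w₂)` in the right half-plane, which exists since `w₁ ≠ w₂`.
  -- With `b` the tangent of half the argument of `v`, the map `(z + ib) / (1 - ibz)` sends `1` to
  -- `v` and `-1` to `-1 / v`; rotation by `w₁ / v` moves these to `w₁` and `w₂`.
  set v : ℂ := exp ((arg (-(w₁ / w₂)) / 2 : ℝ) * I) with hv
  have hvn : ‖v‖ = 1 := norm_exp_ofReal_mul_I _
  have hv2 : v ^ 2 = -(w₁ / w₂) := by
    have hn : ‖-(w₁ / w₂)‖ = 1 := by rw [norm_neg, norm_div, h₁, h₂, div_one]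
    have := norm_mul_exp_arg_mul_I (-(w₁ / w₂))
    rw [hn] at this
    rw [ofReal_one, one_mul] at this
    rw [hv, ← exp_nat_mul]
    refine Eq.trans ?_ this
    congr 1
    push_cast
    ring
  have hvre : 0 < v.re := by
    rw [hv, exp_ofReal_mul_I_re]
    have harg : arg (-(w₁ / w₂)) ≠ Real.pi := by
      intro h
      rw [arg_eq_pi_iff] at h
      have h3 : -(w₁ / w₂) = -1 := by
        have hn : ‖-(w₁ / w₂)‖ = 1 := by rw [norm_neg, norm_div, h₁, h₂, div_one]
        have := norm_mul_exp_arg_mul_I (-(w₁ / w₂))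
        rw [hn, arg_eq_pi_iff.2 h, exp_pi_mul_I] at this
        simpa using this.symm
      rw [neg_inj, div_eq_one_iff_eq hw₂] at h3
      exact hne h3
    have := arg_le_pi (-(w₁ / w₂))
    have := neg_pi_lt_arg (-(w₁ / w₂))
    have hlt := lt_of_le_of_ne ‹arg (-(w₁ / w₂)) ≤ Real.pi› harg
    exact Real.cos_pos_of_mem_Ioo ⟨by linarith, by linarith⟩
  have hsq : v.re ^ 2 + v.im ^ 2 = 1 := by
    have := Complex.sq_norm v
    rw [hvn, normSq_apply] at this
    nlinarith
  set b : ℝ := v.im / (1 + v.re) with hb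
  have hb1 : b ^ 2 < 1 := by
    rw [hb, div_pow, div_lt_one (by positivity)]
    nlinarith
  -- `v = (1 + i b) / (1 - i b)`
  have hvb : v * (1 - I * b) = 1 + I * b := by
    have h0 : 1 + v.re ≠ 0 := by positivity
    have hbm : b * (1 + v.re) = v.im := by rw [hb]; field_simp
    apply Complex.ext
    · simp
      have : v.im * b * (1 + v.re) = (1 - v.re) * (1 + v.re) := by
        rw [mul_assoc, hbm]; nlinarith
      have := mul_right_cancel₀ h0 this
      linarith
    · simp
      linarith
  have hnorm : ∀ z : ℂ, normSq (1 - I * b * z) - normSq (z + I * b) = (1 - b ^ 2) * (1 - normSq z) := by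
    intro z
    simp only [normSq_apply, sub_re, one_re, mul_re, I_re, zero_mul, ofReal_re, I_im, ofReal_im, mul_zero,
      mul_im, add_re, add_im, sub_im, one_im, one_mul, zero_add, zero_sub, add_zero, sub_self]
    ring
  have hdne : ∀ z ∈ closedBall (0 : ℂ) 1, 1 - I * b * z ≠ 0 := by
    intro z hz h0
    have hz1 : normSq z ≤ 1 := by
      rw [normSq_eq_norm_sq]; exact pow_le_one₀ (norm_nonneg _) (mem_closedBall_zero_iff.1 hz)
    have hn : ‖I * b * z‖ = 1 := by rw [← sub_eq_zero.1 h0, norm_one]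
    have : ‖I * b * z‖ ^ 2 = b ^ 2 * normSq z := by
      rw [norm_mul, norm_mul, norm_I, one_mul, norm_real, mul_pow, Real.norm_eq_abs, sq_abs, normSq_eq_norm_sq]
    rw [hn] at this
    nlinarith [normSq_nonneg z, sq_nonneg b]
  set l : ℂ := w₁ / v with hl
  have hv0 : v ≠ 0 := by intro h; rw [h] at hvn; simp at hvn
  have hln : ‖l‖ = 1 := by rw [hl, norm_div, h₁, hvn, div_one]
  have hl0 : l ≠ 0 := by intro h; rw [h] at hln; simp at hln
  set M : ℂ → ℂ := fun z => l * ((z + I * b) / (1 - I * b * z)) with hM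
  have hMn : ∀ z ∈ closedBall (0 : ℂ) 1, 1 - ‖M z‖ ^ 2 = (1 - b ^ 2) * (1 - ‖z‖ ^ 2) / normSq (1 - I * b * z) := by
    intro z hz
    have hp : normSq (1 - I * b * z) ≠ 0 := (normSq_pos.2 (hdne z hz)).ne'
    rw [hM]
    simp only [norm_mul, hln, one_mul, norm_div, div_pow, ← normSq_eq_norm_sq]
    rw [← hnorm z, sub_div, div_self hp]
  refine ⟨M, ?_, ⟨?_, ?_, ?_⟩, ?_, ?_, ?_⟩
  · exact continuousOn_const.mul (ContinuousOn.div (by fun_prop) (by fun_prop) hdne)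
  · intro z hz
    have h1 := hMn z hz
    have hz1 : ‖z‖ ^ 2 ≤ 1 := pow_le_one₀ (norm_nonneg _) (mem_closedBall_zero_iff.1 hz)
    have h2 : 0 ≤ (1 - b ^ 2) * (1 - ‖z‖ ^ 2) / normSq (1 - I * b * z) :=
      div_nonneg (mul_nonneg (by linarith) (by linarith)) (normSq_nonneg _)
    rw [mem_closedBall_zero_iff]
    rw [← h1] at h2
    exact (sq_le_one_iff₀ (norm_nonneg _)).1 (by linarith)
  · intro z hz z' hz' hzz
    have h1 := mul_left_cancel₀ hl0 hzz
    rw [div_eq_div_iff (hdne z hz) (hdne z' hz')] at h1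
    have h2 : (z - z') * (1 - b ^ 2) = 0 := by
      linear_combination h1 - (z - z') * b ^ 2 * I_sq
    have h3 : (1 - (b : ℂ) ^ 2) ≠ 0 := by
      intro h; have : (1 - b ^ 2 : ℝ) = 0 := by exact_mod_cast h
      linarith
    exact sub_eq_zero.1 ((mul_eq_zero.1 h2).resolve_right h3)
  · intro w hw
    set u : ℂ := w / l with hu
    have hun : ‖u‖ ≤ 1 := by rw [hu, norm_div, hln, div_one]; exact mem_closedBall_zero_iff.1 hw
    clear_value u
    have hd : 1 + I * b * u ≠ 0 := by
      have := hdne (-u) (by simpa using hun)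
      intro h; apply this; rw [← h]; ring
    have h3 : (1 - (b : ℂ) ^ 2) ≠ 0 := by
      intro h; have : (1 - b ^ 2 : ℝ) = 0 := by exact_mod_cast h
      linarith
    have hden : 1 - I * b * ((u - I * b) / (1 + I * b * u)) = (1 - b ^ 2) / (1 + I * b * u) := by
      field_simp
      linear_combination (b : ℂ) ^ 2 * I_sq
    refine ⟨(u - I * b) / (1 + I * b * u), ?_, ?_⟩
    · rw [mem_closedBall_zero_iff, norm_div, div_le_one (norm_pos_iff.2 hd)]
      refine le_of_sq_le_sq ?_ (norm_nonneg _)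
      rw [← normSq_eq_norm_sq, ← normSq_eq_norm_sq]
      have h4 := hnorm (-u)
      have e1 : 1 - I * b * -u = 1 + I * b * u := by ring
      have e2 : normSq (-u + I * b) = normSq (u - I * b) := by rw [← normSq_neg]; congr 1; ring
      rw [e1, e2, normSq_neg, normSq_eq_norm_sq u] at h4
      have : ‖u‖ ^ 2 ≤ 1 := pow_le_one₀ (norm_nonneg _) hun
      nlinarith
    · simp only [hM, hden]
      have : (u - I * b) / (1 + I * b * u) + I * b = u * (1 - b ^ 2) / (1 + I * b * u) := by
        rw [eq_div_iff hd, add_mul, div_mul_cancel₀ _ hd]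
        linear_combination (b : ℂ) ^ 2 * u * I_sq
      rw [this, div_div_div_cancel_right₀ hd, mul_div_cancel_right₀ _ h3, hu]
      field_simp
  · intro z hz
    have h1 := hMn z hz
    have hp : normSq (1 - I * b * z) ≠ 0 := (normSq_pos.2 (hdne z hz)).ne'
    have hb' : 1 - b ^ 2 ≠ 0 := by linarith
    constructor
    · intro h
      rw [h, one_pow, sub_self, eq_comm, div_eq_zero_iff] at h1
      have h2 := (mul_eq_zero.1 (h1.resolve_right hp)).resolve_left hb'
      exact (pow_eq_one_iff_of_nonneg (norm_nonneg _) two_ne_zero).1 (by linarith)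
    · intro h
      rw [h, one_pow, sub_self, mul_zero, zero_div] at h1
      exact (pow_eq_one_iff_of_nonneg (norm_nonneg _) two_ne_zero).1 (by linarith)
  · have hd1 := hdne 1 (by simp)
    rw [mul_one] at hd1
    simp only [hM, mul_one]
    rw [← hvb, mul_div_cancel_right₀ _ hd1, hl, div_mul_cancel₀ _ hv0]
  · have hd1 := hdne (-1) (by simp)
    have e : 1 - I * b * -1 = 1 + I * b := by ring
    rw [e] at hd1
    simp only [hM, e]
    have e2 : (-1 + I * b : ℂ) / (1 + I * b) = -(1 / v) := by
      rw [← hvb]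
      have hd2 : (1 - I * b : ℂ) ≠ 0 := by
        intro h; rw [h, mul_zero] at hvb; exact hd1 hvb.symm
      field_simp
      ring
    rw [e2, hl]
    have : w₁ = -(v ^ 2 * w₂) := by rw [hv2]; field_simp
    rw [this]
    field_simp

/-- The closed upper half of the unit disc. -/
def halfDisc : Set ℂ := {z | ‖z‖ ≤ 1 ∧ 0 ≤ z.im}

theorem norm_le_one_iff_sq (z : ℂ) : ‖z‖ ≤ 1 ↔ z.re ^ 2 + z.im ^ 2 ≤ 1 := by
  rw [← sq_le_one_iff₀ (norm_nonneg z), Complex.sq_norm, normSq_apply, ← sq, ← sq]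

theorem norm_eq_one_iff_sq (z : ℂ) : ‖z‖ = 1 ↔ z.re ^ 2 + z.im ^ 2 = 1 := by
  rw [← pow_eq_one_iff_of_nonneg (norm_nonneg z) two_ne_zero, Complex.sq_norm, normSq_apply, ← sq, ← sq]

/-- The vertical stretch of the half-disc onto the disc. -/
def stretch (z : ℂ) : ℂ := ⟨z.re, 2 * z.im - Real.sqrt (1 - z.re ^ 2)⟩

theorem continuous_stretch : Continuous stretch := by
  have : stretch = fun z : ℂ => (z.re : ℂ) + ((2 * z.im - Real.sqrt (1 - z.re ^ 2) : ℝ) : ℂ) * I := by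
    ext z; apply Complex.ext <;> simp [stretch]
  rw [this]
  fun_prop

theorem stretch_props {z : ℂ} (hz : z ∈ halfDisc) :
    z.im ≤ Real.sqrt (1 - z.re ^ 2) ∧ Real.sqrt (1 - z.re ^ 2) ^ 2 = 1 - z.re ^ 2 := by
  have h := (norm_le_one_iff_sq z).1 hz.1
  have h0 : 0 ≤ 1 - z.re ^ 2 := by nlinarith [sq_nonneg z.im]
  exact ⟨Real.le_sqrt_of_sq_le (by linarith), Real.sq_sqrt h0⟩

/-- On each vertical line the upper half of the chord is mapped affinely onto the whole chord. -/
theorem bijOn_stretch : BijOn stretch halfDisc (closedBall 0 1) := by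
  refine ⟨fun z hz => ?_, fun z hz z' hz' h => ?_, fun w hw => ?_⟩
  · obtain ⟨h1, h2⟩ := stretch_props hz
    rw [mem_closedBall_zero_iff, norm_le_one_iff_sq]
    simp only [stretch]
    have := hz.2
    nlinarith
  · have hre : (stretch z).re = (stretch z').re := by rw [h]
    have him : (stretch z).im = (stretch z').im := by rw [h]
    simp only [stretch] at hre him
    rw [hre] at him
    exact Complex.ext hre (by linarith)
  · have h := (norm_le_one_iff_sq w).1 (mem_closedBall_zero_iff.1 hw)
    have h0 : 0 ≤ 1 - w.re ^ 2 := by nlinarith [sq_nonneg w.im]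
    have hs := Real.sq_sqrt h0
    have h1 : |w.im| ≤ Real.sqrt (1 - w.re ^ 2) := Real.abs_le_sqrt (by linarith)
    obtain ⟨h2, h3⟩ := abs_le.1 h1
    refine ⟨⟨w.re, (w.im + Real.sqrt (1 - w.re ^ 2)) / 2⟩, ⟨?_, ?_⟩, ?_⟩
    · rw [norm_le_one_iff_sq]
      simp only
      nlinarith
    · simp only; linarith
    · apply Complex.ext
      · rfl
      · simp only [stretch]; ring

theorem norm_stretch_eq_one_iff {z : ℂ} (hz : z ∈ halfDisc) :
    ‖stretch z‖ = 1 ↔ z.im = 0 ∨ ‖z‖ = 1 := by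
  obtain ⟨h1, h2⟩ := stretch_props hz
  rw [norm_eq_one_iff_sq, norm_eq_one_iff_sq]
  simp only [stretch]
  constructor
  · intro h
    have : z.im * (z.im - Real.sqrt (1 - z.re ^ 2)) = 0 := by nlinarith
    rcases mul_eq_zero.1 this with h3 | h3
    · exact Or.inl h3
    · right; rw [sub_eq_zero.1 h3, h2]; ring
  · rintro (h | h)
    · rw [h]; nlinarith
    · have : z.im = Real.sqrt (1 - z.re ^ 2) := by
        rw [show 1 - z.re ^ 2 = z.im ^ 2 by linarith, Real.sqrt_sq hz.2]
      rw [← this]; linarith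

/-- The diameter goes to the closed lower semicircle, while the upper semicircle is fixed pointwise.
-/
theorem stretch_im_le_zero_iff {z : ℂ} (hz : z ∈ halfDisc) (h1 : ‖stretch z‖ = 1) :
    (stretch z).im ≤ 0 ↔ z.im = 0 := by
  have hs0 := Real.sqrt_nonneg (1 - z.re ^ 2)
  constructor
  · intro h
    rcases (norm_stretch_eq_one_iff hz).1 h1 with h2 | h2
    · exact h2
    · rw [norm_eq_one_iff_sq] at h2
      have : z.im = Real.sqrt (1 - z.re ^ 2) := by
        rw [show 1 - z.re ^ 2 = z.im ^ 2 by linarith, Real.sqrt_sq hz.2]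
      simp only [stretch] at h
      rw [← this] at h
      linarith [hz.2]
  · intro h
    simp only [stretch]; rw [h]; linarith

theorem stretch_one : stretch 1 = 1 := by
  apply Complex.ext <;> simp [stretch]

theorem stretch_neg_one : stretch (-1) = -1 := by
  apply Complex.ext <;> simp [stretch]

theorem isPreconnected_semicircle (s : ℝ) :
    IsPreconnected ((fun x : ℝ => (x : ℂ) + (s * Real.sqrt (1 - x ^ 2) : ℝ) * I) '' Ioo (-1) 1) :=
  isPreconnected_Ioo.image _ (by fun_prop)

theorem isPreconnected_lower : IsPreconnected {z : ℂ | ‖z‖ = 1 ∧ z.im < 0} := by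
  convert isPreconnected_semicircle (-1) using 1
  ext z
  simp only [mem_ofPred_eq, mem_image, mem_Ioo]
  constructor
  · rintro ⟨h1, h2⟩
    rw [norm_eq_one_iff_sq] at h1
    refine ⟨z.re, ⟨by nlinarith, by nlinarith⟩, ?_⟩
    rw [show 1 - z.re ^ 2 = (-z.im) ^ 2 by linarith, Real.sqrt_sq (by linarith)]
    apply Complex.ext <;> simp
  · rintro ⟨x, hx, rfl⟩
    have h0 : 0 < 1 - x ^ 2 := by nlinarith
    rw [norm_eq_one_iff_sq]
    simp [Real.sq_sqrt h0.le, Real.sqrt_pos.2 h0]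

theorem isPreconnected_upper : IsPreconnected {z : ℂ | ‖z‖ = 1 ∧ 0 < z.im} := by
  convert isPreconnected_lower.image conj continuous_conj.continuousOn using 1
  ext z
  constructor
  · rintro ⟨h1, h2⟩
    exact ⟨conj z, ⟨by rwa [RCLike.norm_conj], by simpa using h2⟩, conj_conj z⟩
  · rintro ⟨y, ⟨h1, h2⟩, rfl⟩
    exact ⟨by rwa [RCLike.norm_conj], by simpa using h2⟩

theorem isPreconnected_sphere_diff {w₀ : ℂ} (h : ‖w₀‖ = 1) : IsPreconnected {w : ℂ | ‖w‖ = 1 ∧ w ≠ w₀} := by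
  have h0 : w₀ ≠ 0 := by rintro rfl; simp at h
  have : {w : ℂ | ‖w‖ = 1 ∧ w ≠ w₀} =
      (fun t : ℝ => -w₀ * exp (t * I)) '' Ioo (-Real.pi) Real.pi := by
    ext w
    constructor
    · rintro ⟨hw, hne⟩
      have hn : ‖w / -w₀‖ = 1 := by rw [norm_div, norm_neg, h, hw, div_one]
      have he := norm_mul_exp_arg_mul_I (w / -w₀)
      rw [hn, ofReal_one, one_mul] at he
      refine ⟨arg (w / -w₀), ⟨neg_pi_lt_arg _, lt_of_le_of_ne (arg_le_pi _) fun hpi => hne ?_⟩, ?_⟩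
      · rw [hpi, exp_pi_mul_I, eq_div_iff (neg_ne_zero.2 h0)] at he
        rw [← he]; ring
      · simp only [he]
        field_simp
    · rintro ⟨t, ht, rfl⟩
      refine ⟨by rw [norm_mul, norm_neg, h, norm_exp_ofReal_mul_I, one_mul], fun he => ?_⟩
      have h1 : exp (t * I) = -1 := by
        have : w₀ * (exp (t * I) + 1) = 0 := by linear_combination -he
        exact eq_neg_of_add_eq_zero_left ((mul_eq_zero.1 this).resolve_left h0)
      have h2 := congrArg arg h1
      rw [arg_exp_mul_I, arg_neg_one, toIocMod_eq_self (Real.two_pi_pos) |>.2] at h2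
      · linarith [ht.2]
      · exact ⟨ht.1, by linarith [ht.2]⟩
  rw [this]
  exact isPreconnected_Ioo.image _ (by fun_prop)

/-- A relatively clopen subset of a preconnected set is everything or nothing. -/
theorem subset_or_disjoint_of_relClopen {X : Type*} [TopologicalSpace X] {S A : Set X}
    (hS : IsPreconnected S) (hA : IsClosed A) (hopen : ∀ x ∈ S, x ∈ A → ∀ᶠ y in 𝓝[S] x, y ∈ A) :
    S ⊆ A ∨ ∀ x ∈ S, x ∉ A := by
  have := isPreconnected_iff_preconnectedSpace.1 hS
  have hcl : IsClopen {s : S | (s : X) ∈ A} := by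
    refine ⟨hA.preimage continuous_subtype_val, isOpen_iff_mem_nhds.2 fun s hs => ?_⟩
    exact (eventually_nhds_subtype_iff S s (· ∈ A)).2 (hopen s s.2 hs)
  rcases isClopen_iff.1 hcl with h | h
  · right; intro x hx hxA
    have : (⟨x, hx⟩ : S) ∈ {s : S | (s : X) ∈ A} := hxA
    rw [h] at this; exact this
  · left; intro x hx
    have : (⟨x, hx⟩ : S) ∈ {s : S | (s : X) ∈ A} := by rw [h]; trivial
    exact this

/-- A closed subset of the circle whose only relative boundary points are `w₁` and `w₂` is an arc:
the half-disc is mapped onto the disc with the diameter going to `A`. -/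
theorem exists_halfDisc_homeo {A : Set ℂ} (hA : IsClosed A) (hAs : ∀ w ∈ A, ‖w‖ = 1) {w₁ w₂ : ℂ}
    (h₁ : w₁ ∈ A) (h₂ : w₂ ∈ A) (hne : w₁ ≠ w₂)
    (hopen : ∀ w ∈ A, w ≠ w₁ → w ≠ w₂ → ∀ᶠ y in 𝓝[sphere 0 1] w, y ∈ A)
    (hmore : ∃ w ∈ A, w ≠ w₁ ∧ w ≠ w₂) (hnot : ∃ w, ‖w‖ = 1 ∧ w ∉ A) :
    ∃ η : ℂ → ℂ, ContinuousOn η halfDisc ∧ BijOn η halfDisc (closedBall 0 1) ∧ η 1 = w₁ ∧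
      η (-1) = w₂ ∧ (∀ ζ ∈ halfDisc, η ζ ∈ A ↔ ζ.im = 0) ∧
      ∀ ζ ∈ halfDisc, ‖η ζ‖ = 1 ↔ ζ.im = 0 ∨ ‖ζ‖ = 1 := by
  obtain ⟨M, hMc, hMb, hMn, hM1, hM2⟩ := exists_moebius (hAs _ h₁) (hAs _ h₂) hne
  have hcb : ∀ z : ℂ, ‖z‖ = 1 → z ∈ closedBall (0 : ℂ) 1 := fun z hz => by simp [hz]
  have hinj : ∀ z : ℂ, ‖z‖ = 1 → z.im ≠ 0 → M z ≠ w₁ ∧ M z ≠ w₂ := by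
    intro z hz hz0
    constructor
    · rw [← hM1]; intro h; apply hz0; rw [hMb.injOn (hcb z hz) (by simp) h]; simp
    · rw [← hM2]; intro h; apply hz0; rw [hMb.injOn (hcb z hz) (by simp) h]; simp
  -- The image of an open semicircle avoids `w₁` and `w₂`, so `A` is relatively clopen in it and
  -- contains all of it or none.
  have dich : ∀ S : Set ℂ, IsPreconnected S → (∀ z ∈ S, ‖z‖ = 1 ∧ z.im ≠ 0) →
      (∀ z ∈ S, M z ∈ A) ∨ ∀ z ∈ S, M z ∉ A := by
    intro S hS hSs
    have hSc : ContinuousOn M S := hMc.mono fun z hz => hcb z (hSs z hz).1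
    have := subset_or_disjoint_of_relClopen (hS.image M hSc) hA (by
      rintro _ ⟨z, hz, rfl⟩ hzA
      refine (hopen _ hzA (hinj z (hSs z hz).1 (hSs z hz).2).1 (hinj z (hSs z hz).1 (hSs z hz).2).2).filter_mono ?_
      refine nhdsWithin_mono _ ?_
      rintro _ ⟨y, hy, rfl⟩
      rw [mem_sphere_zero_iff_norm]
      exact (hMn y (hcb y (hSs y hy).1)).2 (hSs y hy).1)
    rcases this with h | h
    · exact Or.inl fun z hz => h ⟨z, hz, rfl⟩
    · exact Or.inr fun z hz => h _ ⟨z, hz, rfl⟩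
  have him0 : ∀ z : ℂ, ‖z‖ = 1 → z.im = 0 → z = 1 ∨ z = -1 := by
    intro z hz hz0
    rw [norm_eq_one_iff_sq, hz0] at hz
    have : (z.re - 1) * (z.re + 1) = 0 := by linarith
    rcases mul_eq_zero.1 this with h | h
    · left; apply Complex.ext
      · rw [one_re]; linarith
      · rw [hz0, one_im]
    · right; apply Complex.ext
      · rw [neg_re, one_re]; linarith
      · rw [hz0, neg_im, one_im, neg_zero]
  have hlow := dich _ isPreconnected_lower fun z hz => ⟨hz.1, hz.2.ne⟩
  have hup := dich _ isPreconnected_upper fun z hz => ⟨hz.1, hz.2.ne'⟩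
  have hsurj : ∀ w : ℂ, ‖w‖ = 1 → ∃ z : ℂ, ‖z‖ = 1 ∧ M z = w := by
    intro w hw
    obtain ⟨z, hz, rfl⟩ := hMb.surjOn (hcb w hw)
    exact ⟨z, (hMn z hz).1 hw, rfl⟩
  -- one closed arc for `A`, in one of the two positions
  have key : ∀ M' : ℂ → ℂ, ContinuousOn M' (closedBall 0 1) → BijOn M' (closedBall 0 1) (closedBall 0 1) →
      (∀ z ∈ closedBall (0 : ℂ) 1, ‖M' z‖ = 1 ↔ ‖z‖ = 1) → M' 1 = w₁ → M' (-1) = w₂ →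
      (∀ z, ‖z‖ = 1 → z.im < 0 → M' z ∈ A) → (∀ z, ‖z‖ = 1 → 0 < z.im → M' z ∉ A) →
      ∃ η : ℂ → ℂ, ContinuousOn η halfDisc ∧ BijOn η halfDisc (closedBall 0 1) ∧ η 1 = w₁ ∧
      η (-1) = w₂ ∧ (∀ ζ ∈ halfDisc, η ζ ∈ A ↔ ζ.im = 0) ∧
      ∀ ζ ∈ halfDisc, ‖η ζ‖ = 1 ↔ ζ.im = 0 ∨ ‖ζ‖ = 1 := by
    intro M' hc hb hn hm1 hm2 hl hu
    have hn' : ∀ ζ ∈ halfDisc, ‖M' (stretch ζ)‖ = 1 ↔ ζ.im = 0 ∨ ‖ζ‖ = 1 := fun ζ hζ => by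
      rw [hn _ (bijOn_stretch.mapsTo hζ), norm_stretch_eq_one_iff hζ]
    refine ⟨fun ζ => M' (stretch ζ), hc.comp continuous_stretch.continuousOn bijOn_stretch.mapsTo,
      hb.comp bijOn_stretch, ?_, ?_, ?_, hn'⟩
    · simp only [stretch_one, hm1]
    · simp only [stretch_neg_one, hm2]
    · intro ζ hζ
      simp only
      constructor
      · intro hAζ
        have h1 := (hn _ (bijOn_stretch.mapsTo hζ)).1 (hAs _ hAζ)
        rw [← stretch_im_le_zero_iff hζ h1]
        by_contra hpos
        exact hu _ h1 (not_le.1 hpos) hAζ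
      · intro h0
        have h1 := (norm_stretch_eq_one_iff hζ).2 (Or.inl h0)
        rcases ((stretch_im_le_zero_iff hζ h1).2 h0).lt_or_eq with h2 | h2
        · exact hl _ h1 h2
        · rcases him0 _ h1 h2 with h3 | h3
          · rw [h3, hm1]; exact h₁
          · rw [h3, hm2]; exact h₂
  -- If `A` took both semicircles it would be the whole circle; if it took neither, it would be only
  -- `{w₁, w₂}`. In the two remaining cases `A` is one closed semicircle, made the lower one by
  -- conjugation when needed.
  rcases hlow with hlow | hlow <;> rcases hup with hup | hup
  · exfalso
    obtain ⟨w, hw, hwA⟩ := hnot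
    obtain ⟨z, hz, rfl⟩ := hsurj w hw
    rcases lt_trichotomy z.im 0 with h | h | h
    · exact hwA (hlow z ⟨hz, h⟩)
    · rcases him0 z hz h with rfl | rfl
      · exact hwA (hM1 ▸ h₁)
      · exact hwA (hM2 ▸ h₂)
    · exact hwA (hup z ⟨hz, h⟩)
  · exact key M hMc hMb hMn hM1 hM2 (fun z h1 h2 => hlow z ⟨h1, h2⟩) (fun z h1 h2 => hup z ⟨h1, h2⟩)
  · have hcm : MapsTo conj (closedBall (0 : ℂ) 1) (closedBall 0 1) := fun z hz => by simpa using hz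
    refine key (fun z => M (conj z)) (hMc.comp continuous_conj.continuousOn hcm)
      (hMb.comp ⟨hcm, fun z _ z' _ h => (starRingEnd ℂ).injective h, fun z hz => ⟨conj z, hcm hz, conj_conj z⟩⟩)
      (fun z hz => by rw [hMn _ (hcm hz), RCLike.norm_conj]) (by simpa using hM1) (by simpa using hM2)
      (fun z h1 h2 => hup _ ⟨by rwa [RCLike.norm_conj], by simpa using h2⟩)
      (fun z h1 h2 => hlow _ ⟨by rwa [RCLike.norm_conj], by simpa using h2⟩)
  · exfalso
    obtain ⟨w, hwA, hw1, hw2⟩ := hmore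
    obtain ⟨z, hz, rfl⟩ := hsurj w (hAs w hwA)
    rcases lt_trichotomy z.im 0 with h | h | h
    · exact hlow z ⟨hz, h⟩ hwA
    · rcases him0 z hz h with rfl | rfl
      · exact hw1 hM1
      · exact hw2 hM2
    · exact hup z ⟨hz, h⟩ hwA

/-! ### Doubling -/

/-- Reflecting a map of the upper half-disc in the unit circle. -/
theorem exists_double {θ : ℂ → ℂ} (hc : ContinuousOn θ halfDisc) (hi : InjOn θ halfDisc)
    (hle : ∀ ζ ∈ halfDisc, ‖θ ζ‖ ≤ 1) (h0 : ∀ ζ ∈ halfDisc, θ ζ ≠ 0)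
    (h1 : ∀ ζ ∈ halfDisc, ‖θ ζ‖ = 1 ↔ ζ.im = 0) :
    ∃ Ψ : ℂ → ℂ, ContinuousOn Ψ (closedBall 0 1) ∧ InjOn Ψ (closedBall 0 1) ∧ EqOn Ψ θ halfDisc ∧
      ∀ ζ ∈ closedBall (0 : ℂ) 1, Ψ (conj ζ) = 1 / conj (Ψ ζ) := by
  classical
  have hrefl : ∀ z : ℂ, ‖z‖ = 1 → 1 / conj z = z := by
    intro z hz
    have hz0 : conj z ≠ 0 := by
      rw [Ne, map_eq_zero]; rintro rfl; simp at hz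
    rw [div_eq_iff hz0, mul_conj, normSq_eq_norm_sq, hz]; norm_num
  have hcm : ∀ ζ ∈ closedBall (0 : ℂ) 1, ζ.im ≤ 0 → conj ζ ∈ halfDisc := fun ζ hζ h =>
    ⟨by simpa using hζ, by simpa using h⟩
  set Ψ : ℂ → ℂ := fun ζ => if 0 ≤ ζ.im then θ ζ else 1 / conj (θ (conj ζ)) with hΨ
  have hup : ∀ ζ : ℂ, 0 ≤ ζ.im → Ψ ζ = θ ζ := fun ζ h => if_pos h
  have hdown : ∀ ζ ∈ closedBall (0 : ℂ) 1, ζ.im ≤ 0 → Ψ ζ = 1 / conj (θ (conj ζ)) := by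
    intro ζ hζ h
    rcases h.lt_or_eq with h' | h'
    · exact if_neg (not_le.2 h')
    · have e : conj ζ = ζ := conj_eq_iff_im.2 h'
      have hm : ζ ∈ halfDisc := ⟨by simpa using hζ, h'.ge⟩
      rw [hup ζ h'.ge, e, hrefl _ ((h1 ζ hm).2 h')]
  have hsym : ∀ ζ ∈ closedBall (0 : ℂ) 1, Ψ (conj ζ) = 1 / conj (Ψ ζ) := by
    intro ζ hζ
    have hζ' : conj ζ ∈ closedBall (0 : ℂ) 1 := by simpa using hζ
    rcases le_total 0 ζ.im with h | h
    · rw [hdown _ hζ' (by simpa using h), conj_conj, hup ζ h]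
    · rw [hdown ζ hζ h, hup _ (by simpa using h)]
      simp
  refine ⟨Ψ, ?_, ?_, fun ζ hζ => hup ζ hζ.2, hsym⟩
  · have hu : closedBall (0 : ℂ) 1 = halfDisc ∪ (closedBall 0 1 ∩ {ζ | ζ.im ≤ 0}) := by
      ext ζ
      simp only [halfDisc, mem_union, mem_inter_iff, mem_closedBall_zero_iff, mem_ofPred_eq]
      constructor
      · intro h
        rcases le_total 0 ζ.im with h' | h'
        · exact Or.inl ⟨h, h'⟩
        · exact Or.inr ⟨h, h'⟩
      · rintro (h | h) <;> exact h.1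
    have hcl1 : IsClosed halfDisc :=
      (isClosed_le continuous_norm continuous_const).inter (isClosed_le continuous_const continuous_im)
    have hcl2 : IsClosed (closedBall (0 : ℂ) 1 ∩ {ζ | ζ.im ≤ 0}) :=
      isClosed_closedBall.inter (isClosed_le continuous_im continuous_const)
    rw [hu]
    refine ContinuousOn.union_of_isClosed (hc.congr fun ζ hζ => hup ζ hζ.2) ?_ hcl1 hcl2
    have : ContinuousOn (fun ζ => 1 / conj (θ (conj ζ))) (closedBall (0 : ℂ) 1 ∩ {ζ | ζ.im ≤ 0}) := by
      refine ContinuousOn.div continuousOn_const ?_ fun ζ hζ => (map_ne_zero _).2 (h0 _ (hcm ζ hζ.1 hζ.2))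
      exact continuous_conj.comp_continuousOn (hc.comp continuous_conj.continuousOn fun ζ hζ => hcm ζ hζ.1 hζ.2)
    exact this.congr fun ζ hζ => hdown ζ hζ.1 hζ.2
  -- The open lower half goes strictly outside the unit disc, so its image cannot meet that of the
  -- upper half.
  · have hmix : ∀ ζ ∈ closedBall (0 : ℂ) 1, ∀ ζ' ∈ closedBall (0 : ℂ) 1, 0 ≤ ζ.im → ζ'.im < 0 → Ψ ζ ≠ Ψ ζ' := by
      intro ζ hζ ζ' hζ' h h' he
      have hm : ζ ∈ halfDisc := ⟨by simpa using hζ, h⟩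
      have hm' := hcm ζ' hζ' h'.le
      rw [hup ζ h, hdown ζ' hζ' h'.le] at he
      have hlt : ‖θ (conj ζ')‖ < 1 := by
        refine lt_of_le_of_ne (hle _ hm') fun h2 => ?_
        rw [h1 _ hm', conj_im, neg_eq_zero] at h2
        exact h'.ne h2
      have h3 := hle ζ hm
      rw [he, norm_div, norm_one, RCLike.norm_conj, div_le_one (norm_pos_iff.2 (h0 _ hm'))] at h3
      linarith
    intro ζ hζ ζ' hζ' he
    rcases le_or_gt 0 ζ.im with h | h <;> rcases le_or_gt 0 ζ'.im with h' | h'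
    · rw [hup ζ h, hup ζ' h'] at he
      exact hi ⟨by simpa using hζ, h⟩ ⟨by simpa using hζ', h'⟩ he
    · exact (hmix ζ hζ ζ' hζ' h h' he).elim
    · exact (hmix ζ' hζ' ζ hζ h' h he.symm).elim
    · rw [hdown ζ hζ h.le, hdown ζ' hζ' h'.le] at he
      simp only [one_div, inv_inj] at he
      have := hi (hcm ζ hζ h.le) (hcm ζ' hζ' h'.le) ((starRingEnd ℂ).injective he)
      exact (starRingEnd ℂ).injective this

/-- The image of the open disc under an embedding of the closed disc, when open, is a disc bounded
by the image of the circle. -/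
theorem isOpenDiskBoundedBy_image {Ψ : ℂ → ℂ} (hc : ContinuousOn Ψ (closedBall 0 1))
    (hi : InjOn Ψ (closedBall 0 1)) (ho : IsOpen (Ψ '' ball 0 1)) :
    IsOpenDiskBoundedBy (Ψ '' ball 0 1) (Ψ '' sphere 0 1) := by
  have hcl : closure (ball (0 : ℂ) 1) = closedBall 0 1 := closure_ball _ one_ne_zero
  have hcomp : IsCompact (Ψ '' closedBall 0 1) := (isCompact_closedBall 0 1).image_of_continuousOn hc
  refine ⟨ho, hcomp.isBounded.subset (image_mono ball_subset_closedBall), ?_, ?_⟩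
  · have he : IsClosedEmbedding (fun x : closedBall (0 : ℂ) 1 => Ψ x) := by
      have : CompactSpace (closedBall (0 : ℂ) 1) := isCompact_iff_compactSpace.1 (isCompact_closedBall 0 1)
      exact (continuousOn_iff_continuous_domRestrict.1 hc).isClosedEmbedding
        (fun x y h => Subtype.ext (hi x.2 y.2 h))
    have hinc : IsEmbedding (inclusion (ball_subset_closedBall : ball (0 : ℂ) 1 ⊆ closedBall 0 1)) :=
      IsEmbedding.inclusion _
    have hcomp' := he.isEmbedding.comp hinc
    have hr : range ((fun x : closedBall (0 : ℂ) 1 => Ψ x) ∘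
        inclusion (ball_subset_closedBall : ball (0 : ℂ) 1 ⊆ closedBall 0 1)) = Ψ '' ball 0 1 := by
      ext z
      constructor
      · rintro ⟨x, rfl⟩; exact ⟨x, x.2, rfl⟩
      · rintro ⟨x, hx, rfl⟩; exact ⟨⟨x, hx⟩, rfl⟩
    exact ⟨(hcomp'.toHomeomorph.trans (Homeomorph.setCongr hr)).symm⟩
  · have h1 : closure (Ψ '' ball 0 1) = Ψ '' closedBall 0 1 := by
      rw [← hcl]
      refine (image_closure_of_isCompact ?_ ?_).symm
      · rw [hcl]; exact isCompact_closedBall 0 1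
      · rw [hcl]; exact hc
    rw [frontier, h1, ho.interior_eq, ← closedBall_sdiff_ball]
    rw [hi.image_sdiff_subset ball_subset_closedBall]

end

section

variable {m : ℕ} {μ : Param m} {κ : Fin (m + 1) → ℕ}

/-! ### The components of the complement of the preimage of the circle -/

/-- The part of the open disc where `|B| < 1`. -/
def lowRegion (μ : Param m) (κ : Fin (m + 1) → ℕ) : Set ℂ :=
  {z | ‖z‖ < 1 ∧ ‖(numPoly μ κ).eval z‖ < ‖(denPoly μ κ).eval z‖}

/-- The part of the open disc where `|B| > 1`. -/
def highRegion (μ : Param m) (κ : Fin (m + 1) → ℕ) : Set ℂ :=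
  {z | ‖z‖ < 1 ∧ ‖(denPoly μ κ).eval z‖ < ‖(numPoly μ κ).eval z‖}

/-- Nonvanishing excludes the poles, where `blaschke` takes the value `0` through division by zero.
-/
theorem mem_lowRegion {z : ℂ} (hz : ‖z‖ < 1) (h0 : blaschke μ κ z ≠ 0) (h : ‖blaschke μ κ z‖ < 1) :
    z ∈ lowRegion μ κ := by
  rw [blaschke_eq_div] at h0 h
  have hd : (denPoly μ κ).eval z ≠ 0 := fun h' => h0 (by rw [h', div_zero])
  rw [norm_div, div_lt_one (norm_pos_iff.2 hd)] at h
  exact ⟨hz, h⟩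

theorem mem_highRegion {z : ℂ} (hz : ‖z‖ < 1) (h : 1 < ‖blaschke μ κ z‖) :
    z ∈ highRegion μ κ := by
  rw [blaschke_eq_div] at h
  have hd : (denPoly μ κ).eval z ≠ 0 := fun h' => by
    rw [h', div_zero, norm_zero] at h; linarith
  rw [norm_div, one_lt_div (norm_pos_iff.2 hd)] at h
  exact ⟨hz, h⟩

theorem mem_closure_inter_ball {V : Set ℂ} (hV : IsOpen V) {z : ℂ} (hz : z ∈ V) (h1 : ‖z‖ ≤ 1) :
    z ∈ closure (V ∩ ball 0 1) := by
  refine hV.inter_closure ⟨hz, ?_⟩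
  rw [closure_ball _ one_ne_zero]
  exact mem_closedBall_zero_iff.2 h1

/-! ### The quadrants of `|B| < 1` and `|B| > 1` at a fold -/

namespace IsCircleChart

variable {c : ℂ} {n : ℕ} {α : ℝ} {G : ℂ → ℂ} {N : Set ℂ}

theorem norm_eq (h : IsCircleChart (blaschke μ κ) c n α G N) (hc : ‖c‖ = 1) {z : ℂ} (hz : z ∈ N) :
    ‖blaschke μ κ z‖ = Real.exp (-(α * (G z ^ n).im)) := by
  rw [h.eq z hz, norm_mul, norm_blaschke μ κ hc, one_mul, norm_exp, I_mul_re, im_ofReal_mul]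

theorem ne_zero (h : IsCircleChart (blaschke μ κ) c n α G N) (hc : ‖c‖ = 1) {z : ℂ} (hz : z ∈ N) :
    blaschke μ κ z ≠ 0 := by
  rw [← norm_pos_iff, h.norm_eq hc hz]; exact Real.exp_pos _

theorem norm_eq_one_iff (h : IsCircleChart (blaschke μ κ) c n α G N) (hc : ‖c‖ = 1) {z : ℂ}
    (hz : z ∈ N) : ‖blaschke μ κ z‖ = 1 ↔ (G z ^ n).im = 0 := by
  rw [h.norm_eq hc hz, Real.exp_eq_one_iff, neg_eq_zero, mul_eq_zero]
  refine or_iff_right ?_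
  rcases h.sign with h1 | h1 <;> rw [h1] <;> norm_num

theorem exists_mem_of_small (h : IsCircleChart (blaschke μ κ) c n α G N) {V : Set ℂ} (hV : V ∈ 𝓝 c) :
    ∃ ε > 0, ∀ y : ℂ, ‖y‖ < ε → ∃ z ∈ N ∩ V, G z = y := by
  have : G '' (N ∩ V) ∈ 𝓝 (0 : ℂ) := by
    rw [← h.map_nhds]; exact image_mem_map (inter_mem (h.isOpen.mem_nhds h.mem) hV)
  obtain ⟨ε, hε, hb⟩ := Metric.mem_nhds_iff.1 this
  exact ⟨ε, hε, fun y hy => hb (mem_ball_zero_iff.2 hy)⟩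

theorem sq_im (z : ℂ) : (z ^ 2).im = 2 * (z.re * z.im) := by
  rw [sq, mul_im]; ring

/-- In the upper half-plane of `G` the quadrant `α * Re G > 0` is low, because `|B| = exp (-α * Im
(G ^ 2))`. The witness has `Re G = α * ε / 4`, of the sign of `α`. -/
theorem mem_closure_low (h : IsCircleChart (blaschke μ κ) c 2 α G N) (hc : ‖c‖ = 1) :
    c ∈ closure (lowRegion μ κ) := by
  rw [mem_closure_iff_nhds]
  intro V hV
  obtain ⟨ε, hε, hy⟩ := h.exists_mem_of_small hV
  have hαα : α * α = 1 := by rcases h.sign with h1 | h1 <;> rw [h1] <;> norm_num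
  have hαa : |α| = 1 := by rcases h.sign with h1 | h1 <;> rw [h1] <;> norm_num
  obtain ⟨z, ⟨hzN, hzV⟩, hz⟩ := hy ⟨α * (ε / 4), ε / 4⟩ (by
    refine lt_of_le_of_lt (norm_le_abs_re_add_abs_im _) ?_
    simp only [abs_mul, hαa, one_mul]
    rw [abs_of_pos (by positivity)]; linarith)
  refine ⟨z, hzV, mem_lowRegion ((h.lt_iff z hzN).2 ?_) (h.ne_zero hc hzN) ?_⟩
  · rw [hz]; positivity
  · rw [h.norm_eq hc hzN, Real.exp_lt_one_iff, hz, sq_im]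
    have : α * (2 * (α * (ε / 4) * (ε / 4))) = (α * α) * (2 * (ε / 4) ^ 2) := by ring
    simp only [this, hαα, one_mul]
    have : 0 < (ε / 4) ^ 2 := by positivity
    linarith

/-- The other quadrant, `α * Re G < 0`, is high and borders the circle along the real half-axis `α *
G < 0`. This supplies points of the circle next to a critical point which lie in the same closed
component. -/
theorem frequently_mem_closure_high (h : IsCircleChart (blaschke μ κ) c 2 α G N) (hc : ‖c‖ = 1) :
    ∃ᶠ z in 𝓝[≠] c, ‖z‖ = 1 ∧ z ∈ closure (highRegion μ κ) := by
  rw [frequently_nhdsWithin_iff, frequently_iff]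
  intro V hV
  obtain ⟨ε, hε, hy⟩ := h.exists_mem_of_small hV
  have hαα : α * α = 1 := by rcases h.sign with h1 | h1 <;> rw [h1] <;> norm_num
  have hαa : |α| = 1 := by rcases h.sign with h1 | h1 <;> rw [h1] <;> norm_num
  obtain ⟨z, ⟨hzN, hzV⟩, hz⟩ := hy ((-(α * (ε / 2)) : ℝ) : ℂ) (by
    rw [norm_real, Real.norm_eq_abs, abs_neg, abs_mul, hαa, one_mul, abs_of_pos (by positivity)]
    linarith)
  have hz1 : ‖z‖ = 1 := (h.eq_iff z hzN).2 (by rw [hz, ofReal_im])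
  refine ⟨z, hzV, ⟨hz1, ?_⟩, ?_⟩
  · have hW : IsOpen (N ∩ {y | α * (G y).re < 0}) := by
      have : ContinuousOn (fun y => α * (G y).re) N :=
        continuousOn_const.mul (continuous_re.comp_continuousOn h.differentiableOn.continuousOn)
      exact this.isOpen_inter_preimage h.isOpen isOpen_Iio
    have hzW : z ∈ N ∩ {y | α * (G y).re < 0} := by
      refine ⟨hzN, ?_⟩
      simp only [mem_ofPred_eq, hz, ofReal_re]
      nlinarith
    refine closure_mono ?_ (mem_closure_inter_ball hW hzW hz1.le)
    rintro y ⟨⟨hyN, hy⟩, hyb⟩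
    have hy1 := mem_ball_zero_iff.1 hyb
    refine mem_highRegion hy1 ?_
    rw [h.norm_eq hc hyN, Real.one_lt_exp_iff, sq_im]
    have := (h.lt_iff y hyN).1 hy1
    simp only [mem_ofPred_eq] at hy
    nlinarith
  · rintro rfl
    rw [h.zero] at hz
    have := congrArg re hz
    rw [zero_re, ofReal_re] at this
    have h2 : α * (α * (ε / 2)) = 0 := by
      rw [show α * (ε / 2) = 0 by linarith, mul_zero]
    rw [← mul_assoc, hαα] at h2
    linarith

end IsCircleChart

/-- Parametrizations of the components of the complement of the preimage of the circle in the
unit disc. -/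
structure IsDecomposition (μ : Param m) (κ : Fin (m + 1) → ℕ) (k₀ : ℕ) (ψ₀ : ℂ → ℂ) (k : Fin m → ℕ)
    (ψ : Fin m → ℂ → ℂ) : Prop where
  crit : HasCircleCriticalPoints μ κ
  low : IsDiscParam (fun z => (numPoly μ κ).eval z / (denPoly μ κ).eval z)
    {z | ‖z‖ ≤ 1 ∧ ‖(numPoly μ κ).eval z‖ ≤ ‖(denPoly μ κ).eval z‖} 0 k₀ ψ₀
  high : ∀ j, IsDiscParam (fun z => (denPoly μ κ).eval z / (numPoly μ κ).eval z)
    {z | ‖z‖ ≤ 1 ∧ ‖(denPoly μ κ).eval z‖ ≤ ‖(numPoly μ κ).eval z‖} (1 / conj (μ.a j)) (k j) (ψ j)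

theorem HasCircleCriticalPoints.exists_decomposition (H : HasCircleCriticalPoints μ κ) :
    ∃ k₀ ψ₀ k ψ, IsDecomposition μ κ k₀ ψ₀ k ψ := by
  obtain ⟨k₀, ψ₀, h₀⟩ := H.isBranchedDisc_zero.exists_param (p := 0)
    ⟨by simp, by rw [numPoly_eval_zero H.pos, norm_zero]; exact norm_nonneg _⟩
    (by simp only [numPoly_eval_zero H.pos, zero_div])
  have hj : ∀ j, ∃ k ψ, IsDiscParam (fun z => (denPoly μ κ).eval z / (numPoly μ κ).eval z)
      {z | ‖z‖ ≤ 1 ∧ ‖(denPoly μ κ).eval z‖ ≤ ‖(numPoly μ κ).eval z‖} (1 / conj (μ.a j)) k ψ := by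
    intro j
    have hd : (denPoly μ κ).eval (1 / conj (μ.a j)) = 0 :=
      (denPoly_eval_eq_zero_iff H.pos _).2 ⟨j, (μ.one_sub_eq_zero_iff _ j).2 rfl⟩
    exact H.isBranchedDisc_infty.exists_param
      ⟨(μ.norm_pole_lt j).le, by rw [hd, norm_zero]; exact norm_nonneg _⟩ (by simp only [hd, zero_div])
  choose k ψ h using hj
  exact ⟨k₀, ψ₀, k, ψ, H, h₀, h⟩

/-! ### The components in the unit disc and their arcs on the circle -/

namespace IsDecomposition

variable {k₀ : ℕ} {ψ₀ : ℂ → ℂ} {k : Fin m → ℕ} {ψ : Fin m → ℂ → ℂ}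
variable (D : IsDecomposition μ κ k₀ ψ₀ k ψ)
include D

theorem low_eq : lowRegion μ κ = ψ₀ '' ball 0 1 := by
  have hB := D.crit.isBranchedDisc_zero
  refine Subset.antisymm ?_ ?_
  · have := hB.subset_iUnion (ι := Unit) (p := fun _ => 0) (k := fun _ => k₀) (ψ := fun _ => ψ₀)
      (fun _ => D.low) (fun z hz h0 => ⟨(), by
        have hz1 : ‖z‖ ≤ 1 := hz.1.le
        rw [div_eq_zero_iff, numPoly_eval_eq_zero_iff_of_norm_le D.crit.pos hz1] at h0
        refine h0.resolve_right fun hd => ?_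
        have := hz.2
        rw [hd, norm_zero] at this
        exact absurd this (not_lt.2 (norm_nonneg _))⟩)
    intro z hz
    obtain ⟨-, h⟩ := mem_iUnion.1 (this hz)
    exact h
  · rintro _ ⟨w, hw, rfl⟩
    exact (hB.mem_iff_of_param D.low (ball_subset_closedBall hw)).2 hw

theorem high_eq : highRegion μ κ = ⋃ j, ψ j '' ball 0 1 := by
  have hB := D.crit.isBranchedDisc_infty
  refine Subset.antisymm ?_ ?_
  · refine hB.subset_iUnion D.high fun z hz h0 => ?_
    have hn : (numPoly μ κ).eval z ≠ 0 := fun hn => by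
      have := hz.2
      rw [hn, norm_zero] at this
      exact absurd this (not_lt.2 (norm_nonneg _))
    rw [div_eq_zero_iff, denPoly_eval_eq_zero_iff D.crit.pos] at h0
    obtain ⟨j, hj⟩ := h0.resolve_right hn
    exact ⟨j, (μ.one_sub_eq_zero_iff z j).1 hj⟩
  · refine iUnion_subset fun j => ?_
    rintro _ ⟨w, hw, rfl⟩
    exact (hB.mem_iff_of_param (D.high j) (ball_subset_closedBall hw)).2 hw

theorem mem_high_iff (j : Fin m) {w : ℂ} (hw : ‖w‖ ≤ 1) : ψ j w ∈ highRegion μ κ ↔ ‖w‖ < 1 := by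
  rw [← mem_ball_zero_iff]
  exact D.crit.isBranchedDisc_infty.mem_iff_of_param (D.high j) (mem_closedBall_zero_iff.2 hw)

theorem norm_le (j : Fin m) {w : ℂ} (hw : ‖w‖ ≤ 1) : ‖ψ j w‖ ≤ 1 :=
  ((D.high j).mapsTo (mem_closedBall_zero_iff.2 hw)).1

theorem norm_blaschke_eq_one_iff {z : ℂ} (hz : ‖z‖ ≤ 1) :
    ‖blaschke μ κ z‖ = 1 ↔ ‖(numPoly μ κ).eval z‖ = ‖(denPoly μ κ).eval z‖ := by
  rw [blaschke_eq_div, norm_div]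
  by_cases hd : (denPoly μ κ).eval z = 0
  · have hn : (numPoly μ κ).eval z ≠ 0 := fun hn => D.crit.not_common hz hn hd
    simp [hd, hn]
  · rw [div_eq_one_iff_eq (norm_ne_zero_iff.2 hd)]

theorem norm_blaschke_ne_one_of_high {z : ℂ} (hz : z ∈ highRegion μ κ) : ‖blaschke μ κ z‖ ≠ 1 := by
  rw [Ne, D.norm_blaschke_eq_one_iff hz.1.le]; exact hz.2.ne'

theorem norm_blaschke_ne_one_of_low {z : ℂ} (hz : z ∈ lowRegion μ κ) : ‖blaschke μ κ z‖ ≠ 1 := by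
  rw [Ne, D.norm_blaschke_eq_one_iff hz.1.le]; exact hz.2.ne

theorem norm_blaschke_param (j : Fin m) {w : ℂ} (hw : ‖w‖ = 1) : ‖blaschke μ κ (ψ j w)‖ = 1 := by
  have h := (D.high j).map_eq w (by simp [hw])
  rw [D.norm_blaschke_eq_one_iff (D.norm_le j hw.le)]
  have h1 := congrArg norm h
  rw [norm_div, norm_pow, hw, one_pow] at h1
  by_cases hn : ‖(numPoly μ κ).eval (ψ j w)‖ = 0
  · rw [hn, div_zero] at h1; exact absurd h1 zero_ne_one
  · exact ((div_eq_one_iff_eq hn).1 h1).symm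

theorem norm_eq_one_of_level (j : Fin m) {w : ℂ} (hw : ‖w‖ ≤ 1) (h : ‖blaschke μ κ (ψ j w)‖ = 1) :
    ‖w‖ = 1 := by
  refine le_antisymm hw (not_lt.1 fun hlt => ?_)
  exact D.norm_blaschke_ne_one_of_high ((D.mem_high_iff j hw).2 hlt) h

theorem norm_eq_one_of_norm (j : Fin m) {w : ℂ} (hw : ‖w‖ ≤ 1) (h : ‖ψ j w‖ = 1) : ‖w‖ = 1 :=
  D.norm_eq_one_of_level j hw (norm_blaschke μ κ h)

theorem param_ne_zero (j : Fin m) {w : ℂ} (hw : ‖w‖ ≤ 1) : ψ j w ≠ 0 := by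
  intro h0
  have h := ((D.high j).mapsTo (mem_closedBall_zero_iff.2 hw)).2
  rw [h0, denPoly_eval_zero, numPoly_eval_zero D.crit.pos] at h
  simp at h
  linarith

theorem isClosed_image (j : Fin m) : IsClosed (ψ j '' closedBall 0 1) :=
  ((isCompact_closedBall 0 1).image_of_continuousOn (D.high j).cont).isClosed

theorem disjoint_image {i j : Fin m} (hij : i ≠ j) :
    Disjoint (ψ i '' closedBall 0 1) (ψ j '' closedBall 0 1) := by
  refine D.crit.isBranchedDisc_infty.disjoint_param (D.high i) (D.high j) fun h => hij ?_
  have h1 : conj (μ.a i) = conj (μ.a j) := by simpa using h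
  exact D.crit.a_injective ((starRingEnd ℂ).injective h1)

theorem exists_mem_image {z : ℂ} (hz : z ∈ closure (highRegion μ κ)) :
    ∃ j, z ∈ ψ j '' closedBall 0 1 := by
  have hcl : IsClosed (⋃ j, ψ j '' closedBall 0 1) := isClosed_iUnion_of_finite D.isClosed_image
  have hsub : highRegion μ κ ⊆ ⋃ j, ψ j '' closedBall 0 1 := by
    rw [D.high_eq]
    exact iUnion_mono fun j => image_mono ball_subset_closedBall
  exact mem_iUnion.1 (closure_minimal hsub hcl hz)

theorem mem_closure_high (j : Fin m) {w : ℂ} (hw : ‖w‖ ≤ 1) : ψ j w ∈ closure (highRegion μ κ) := by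
  have hcl : closure (ball (0 : ℂ) 1) = closedBall 0 1 := closure_ball _ one_ne_zero
  have : MapsTo (ψ j) (ball 0 1) (highRegion μ κ) := fun w hw =>
    (D.mem_high_iff j (mem_ball_zero_iff.1 hw).le).2 (mem_ball_zero_iff.1 hw)
  have := this.closure_of_continuousOn (hcl ▸ (D.high j).cont)
  rw [hcl] at this
  exact this (mem_closedBall_zero_iff.2 hw)

/-- The other closed components are finitely many closed sets not containing `z`, so they stay away
from it. -/
theorem eventually_mem_image {j : Fin m} {z : ℂ} (hz : z ∈ ψ j '' closedBall 0 1) :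
    ∀ᶠ y in 𝓝 z, y ∈ closure (highRegion μ κ) → y ∈ ψ j '' closedBall 0 1 := by
  have hcl : IsClosed (⋃ i : {i // i ≠ j}, ψ i '' closedBall 0 1) :=
    isClosed_iUnion_of_finite fun i => D.isClosed_image i
  have hnot : z ∉ ⋃ i : {i // i ≠ j}, ψ i '' closedBall 0 1 := by
    intro h
    obtain ⟨⟨i, hi⟩, hzi⟩ := mem_iUnion.1 h
    exact (Set.disjoint_left.1 (D.disjoint_image hi)) hzi hz
  filter_upwards [hcl.isOpen_compl.mem_nhds hnot] with y hy hyc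
  obtain ⟨i, hi⟩ := D.exists_mem_image hyc
  by_cases hij : i = j
  · exact hij ▸ hi
  · exact (hy (mem_iUnion.2 ⟨⟨i, hij⟩, hi⟩)).elim

/-- Inside the disc `B' ≠ 0` at such a point, so `B` is open there and takes the values `t * B z`
nearby for real `t` slightly below and slightly above `1`. -/
theorem mem_closure_of_level {z : ℂ} (hz : ‖z‖ < 1) (h : ‖blaschke μ κ z‖ = 1) :
    z ∈ closure (lowRegion μ κ) ∧ z ∈ closure (highRegion μ κ) := by
  have hB0 : blaschke μ κ z ≠ 0 := fun h0 => by rw [h0, norm_zero] at h; exact zero_ne_one h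
  have hnd := hB0
  rw [blaschke_eq_div] at hnd
  have hn : (numPoly μ κ).eval z ≠ 0 := fun h' => hnd (by rw [h', zero_div])
  have hd : (denPoly μ κ).eval z ≠ 0 := fun h' => hnd (by rw [h', div_zero])
  have hmap := (analyticAt_blaschke (μ := μ) (κ := κ) hd).hasStrictDerivAt.map_nhds_eq
    (D.crit.deriv_ne_zero_of_norm_ne hz.ne hn hd)
  have key : ∀ V ∈ 𝓝 z, ∃ ε > 0, ∀ t : ℝ, |t - 1| < ε → ∃ y ∈ V, ‖y‖ < 1 ∧
      blaschke μ κ y = t * blaschke μ κ z := by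
    intro V hV
    have hV' : V ∩ ball 0 1 ∈ 𝓝 z := inter_mem hV (isOpen_ball.mem_nhds (mem_ball_zero_iff.2 hz))
    have h1 : blaschke μ κ '' (V ∩ ball 0 1) ∈ 𝓝 (blaschke μ κ z) := by
      rw [← hmap]; exact image_mem_map hV'
    obtain ⟨ε, hε, hb⟩ := Metric.mem_nhds_iff.1 h1
    refine ⟨ε, hε, fun t ht => ?_⟩
    obtain ⟨y, ⟨hyV, hyb⟩, hy⟩ := hb (show (t : ℂ) * blaschke μ κ z ∈ ball _ ε by
      rw [mem_ball, dist_eq, ← sub_one_mul, norm_mul, h, mul_one, ← ofReal_one, ← ofReal_sub, norm_real]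
      exact ht)
    exact ⟨y, hyV, mem_ball_zero_iff.1 hyb, hy⟩
  constructor
  · rw [mem_closure_iff_nhds]
    intro V hV
    obtain ⟨ε, hε, hy⟩ := key V hV
    have hmin : 0 < min ε 1 := lt_min hε one_pos
    have h1 := min_le_left ε 1
    have h2 := min_le_right ε 1
    obtain ⟨y, hyV, hy1, hyB⟩ := hy (1 - min ε 1 / 2) (by
      rw [show 1 - min ε 1 / 2 - 1 = -(min ε 1 / 2) by ring, abs_neg, abs_of_pos (by linarith)]
      linarith)
    have ht : 0 < 1 - min ε 1 / 2 := by linarith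
    refine ⟨y, hyV, mem_lowRegion hy1 ?_ ?_⟩
    · rw [hyB]; exact mul_ne_zero (by exact_mod_cast ht.ne') hB0
    · rw [hyB, norm_mul, h, mul_one, norm_real, Real.norm_of_nonneg ht.le]; linarith
  · rw [mem_closure_iff_nhds]
    intro V hV
    obtain ⟨ε, hε, hy⟩ := key V hV
    obtain ⟨y, hyV, hy1, hyB⟩ := hy (1 + ε / 2) (by
      rw [show 1 + ε / 2 - 1 = ε / 2 by ring, abs_of_pos (by linarith)]
      linarith)
    refine ⟨y, hyV, mem_highRegion hy1 ?_⟩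
    rw [hyB, norm_mul, h, mul_one, norm_real, Real.norm_of_nonneg (by linarith)]; linarith

theorem closure_low_subset : closure (lowRegion μ κ) ⊆ ψ₀ '' closedBall 0 1 := by
  rw [D.low_eq]
  exact closure_minimal (image_mono ball_subset_closedBall)
    ((isCompact_closedBall 0 1).image_of_continuousOn D.low.cont).isClosed

theorem mem_low_circle {z : ℂ} (hz : z ∈ closure (lowRegion μ κ)) (h : ‖blaschke μ κ z‖ = 1) :
    z ∈ ψ₀ '' sphere 0 1 := by
  obtain ⟨w, hw, rfl⟩ := D.closure_low_subset hz
  refine ⟨w, ?_, rfl⟩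
  rw [mem_sphere_zero_iff_norm]
  refine le_antisymm (mem_closedBall_zero_iff.1 hw) (not_lt.1 fun hlt => ?_)
  refine D.norm_blaschke_ne_one_of_low ?_ h
  rw [D.low_eq]
  exact ⟨w, mem_ball_zero_iff.2 hlt, rfl⟩

theorem norm_blaschke_low {z : ℂ} (hz : z ∈ ψ₀ '' sphere 0 1) : ‖blaschke μ κ z‖ = 1 := by
  obtain ⟨w, hw, rfl⟩ := hz
  have h := D.low.map_eq w (sphere_subset_closedBall hw)
  rw [mem_sphere_zero_iff_norm] at hw
  rw [blaschke_eq_div, h, norm_pow, hw, one_pow]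

theorem eventually_level_iff {c : ℂ} (hc : ‖c‖ = 1) (hP : (critPoly μ κ).eval c ≠ 0) :
    ∀ᶠ z in 𝓝 c, ‖blaschke μ κ z‖ = 1 ↔ ‖z‖ = 1 := by
  obtain ⟨α, G, N, h⟩ := D.crit.exists_chart_regular hc hP
  filter_upwards [h.isOpen.mem_nhds h.mem] with z hz
  rw [h.norm_eq_one_iff hc hz, pow_one, h.eq_iff z hz]

/-- Near a regular point of the circle in the closure of the high region, the disc belongs to the
high region. -/
theorem eventually_mem_high {c : ℂ} (hc : ‖c‖ = 1) (hP : (critPoly μ κ).eval c ≠ 0)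
    (hh : c ∈ closure (highRegion μ κ)) :
    ∀ᶠ z in 𝓝 c, (‖z‖ < 1 → z ∈ highRegion μ κ) ∧ (‖z‖ = 1 → z ∈ closure (highRegion μ κ)) := by
  obtain ⟨α, G, N, h⟩ := D.crit.exists_chart_regular hc hP
  -- The sign `α = 1` would make the whole inner side of the chart low, leaving no high points near
  -- `c`.
  have hα : α = -1 := by
    refine h.sign.resolve_left fun hα => ?_
    obtain ⟨z, hzN, hzh⟩ := mem_closure_iff_nhds.1 hh N (h.isOpen.mem_nhds h.mem)
    have hlow : z ∈ lowRegion μ κ := by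
      refine mem_lowRegion hzh.1 (h.ne_zero hc hzN) ?_
      rw [h.norm_eq hc hzN, Real.exp_lt_one_iff, hα, pow_one]
      linarith [(h.lt_iff z hzN).1 hzh.1]
    exact lt_asymm hlow.2 hzh.2
  have hin : ∀ z ∈ N, ‖z‖ < 1 → z ∈ highRegion μ κ := by
    intro z hz hz1
    refine mem_highRegion hz1 ?_
    rw [h.norm_eq hc hz, Real.one_lt_exp_iff, hα, pow_one]
    linarith [(h.lt_iff z hz).1 hz1]
  filter_upwards [h.isOpen.mem_nhds h.mem] with z hz
  refine ⟨hin z hz, fun hz1 => ?_⟩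
  exact closure_mono (fun y hy => hin y hy.1 (mem_ball_zero_iff.1 hy.2))
    (mem_closure_inter_ball h.isOpen hz hz1.le)

theorem isClosed_arc (j : Fin m) : IsClosed {w : ℂ | ‖w‖ = 1 ∧ ‖ψ j w‖ = 1} := by
  have : {w : ℂ | ‖w‖ = 1 ∧ ‖ψ j w‖ = 1} = sphere 0 1 ∩ ψ j ⁻¹' sphere 0 1 := by ext; simp
  rw [this]
  exact ((D.high j).cont.mono sphere_subset_closedBall).preimage_isClosed_of_isClosed isClosed_sphere
    isClosed_sphere

/-- The boundary parametrization stays on `|B| = 1`, and near a regular point of the circle this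
level set is the circle alone. So the arc can end only at critical points. -/
theorem eventually_mem_arc (j : Fin m) {w : ℂ} (hw : ‖w‖ = 1) (hw1 : ‖ψ j w‖ = 1)
    (hP : (critPoly μ κ).eval (ψ j w) ≠ 0) :
    ∀ᶠ y in 𝓝[sphere 0 1] w, y ∈ {w : ℂ | ‖w‖ = 1 ∧ ‖ψ j w‖ = 1} := by
  have ht : Tendsto (ψ j) (𝓝[sphere 0 1] w) (𝓝 (ψ j w)) :=
    ((D.high j).cont.mono sphere_subset_closedBall) w (by simp [hw])
  filter_upwards [ht.eventually (D.eventually_level_iff hw1 hP), self_mem_nhdsWithin] with y hy hys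
  rw [mem_sphere_zero_iff_norm] at hys
  exact ⟨hys, hy.1 (D.norm_blaschke_param j hys)⟩

/-- Next to a critical point of the arc there are points of the circle in the closed high region.
Those close enough belong to the same component, and critical points are isolated. -/
theorem exists_regular_mem_arc (j : Fin m) {w : ℂ} (hw : ‖w‖ = 1) (hw1 : ‖ψ j w‖ = 1) :
    ∃ w, (‖w‖ = 1 ∧ ‖ψ j w‖ = 1) ∧ (critPoly μ κ).eval (ψ j w) ≠ 0 := by
  by_cases hP : (critPoly μ κ).eval (ψ j w) = 0
  · obtain ⟨α, G, N, h⟩ := D.crit.exists_chart_critical hP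
    have hfr := h.frequently_mem_closure_high hw1
    have h1 : ∀ᶠ z in 𝓝[≠] ψ j w, z ∈ closure (highRegion μ κ) → z ∈ ψ j '' closedBall 0 1 :=
      (D.eventually_mem_image ⟨w, by simp [hw], rfl⟩).filter_mono nhdsWithin_le_nhds
    have h2 : ∀ᶠ z in 𝓝[≠] ψ j w, (critPoly μ κ).eval z ≠ 0 := by
      have hfin : ({z | (critPoly μ κ).IsRoot z} \ {ψ j w}).Finite :=
        (Polynomial.finite_setOfPred_isRoot (critPoly_ne_zero D.crit.pos)).subset sdiff_subset
      have := hfin.isClosed.isOpen_compl.mem_nhds (show ψ j w ∈ _ by simp)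
      rw [eventually_nhdsWithin_iff]
      filter_upwards [this] with z hz hne h0
      exact hz ⟨h0, hne⟩
    obtain ⟨z, ⟨hz1, hz2⟩, hz3, hz4⟩ := (hfr.and_eventually (h1.and h2)).exists
    obtain ⟨w', hw', rfl⟩ := hz3 hz2
    exact ⟨w', ⟨D.norm_eq_one_of_norm j (mem_closedBall_zero_iff.1 hw') hz1, hz1⟩, hz4⟩
  · exact ⟨w, ⟨hw, hw1⟩, hP⟩

/-- Otherwise the component would be open and relatively closed in the unit disc, so it would fill
the disc and contain `0`, where `B` vanishes. -/
theorem exists_not_mem_arc (j : Fin m) : ∃ w, ‖w‖ = 1 ∧ ‖ψ j w‖ ≠ 1 := by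
  by_contra! hall
  have hsub : ball (0 : ℂ) 1 ⊆ ψ j '' ball 0 1 := by
    have h0 : ψ j 0 ∈ highRegion μ κ := (D.mem_high_iff j (by simp)).2 (by simp)
    refine (convex_ball (0 : ℂ) 1).isPreconnected.subset_of_closure_inter_subset (D.high j).isOpen_image
      ⟨ψ j 0, mem_ball_zero_iff.2 h0.1, ⟨0, by simp, rfl⟩⟩ ?_
    rintro z ⟨hz, hzb⟩
    obtain ⟨w, hw, rfl⟩ := closure_minimal (image_mono ball_subset_closedBall) (D.isClosed_image j) hz
    refine ⟨w, mem_ball_zero_iff.2 (lt_of_le_of_ne (mem_closedBall_zero_iff.1 hw) fun h => ?_), rfl⟩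
    rw [mem_ball_zero_iff, hall w h] at hzb
    exact lt_irrefl _ hzb
  obtain ⟨w, hw, h0⟩ := hsub (show (0 : ℂ) ∈ ball 0 1 by simp)
  exact D.param_ne_zero j (mem_ball_zero_iff.1 hw).le h0

/-- A component away from the circle would meet the connected boundary curve of the low region in a
relatively clopen set. This set is not empty, because boundary points of the component are limits of
low points; so it is the whole curve. But the curve passes through the critical points, which lie on
the circle. -/
theorem exists_mem_arc (j : Fin m) : ∃ w, ‖w‖ = 1 ∧ ‖ψ j w‖ = 1 := by
  by_contra! hall
  have hlt : ∀ w, ‖w‖ = 1 → ‖ψ j w‖ < 1 := fun w hw => lt_of_le_of_ne (D.norm_le j hw.le) (hall w hw)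
  have hQ : IsPreconnected (ψ₀ '' sphere 0 1) := by
    refine (isPreconnected_sphere ?_ 0 1).image _ (D.low.cont.mono sphere_subset_closedBall)
    rw [rank_real_complex]; norm_num
  rcases subset_or_disjoint_of_relClopen hQ (D.isClosed_image j) (by
    rintro x hxQ ⟨w, hw, rfl⟩
    have hw1 := D.norm_eq_one_of_level j (mem_closedBall_zero_iff.1 hw) (D.norm_blaschke_low hxQ)
    have h1 : ∀ᶠ y in 𝓝 (ψ j w), ‖y‖ < 1 := continuous_norm.continuousAt.eventually_lt_const (hlt w hw1)
    have h2 := D.eventually_mem_image (j := j) ⟨w, hw, rfl⟩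
    filter_upwards [mem_nhdsWithin_of_mem_nhds h1, mem_nhdsWithin_of_mem_nhds h2, self_mem_nhdsWithin]
      with y hy1 hy2 hy3
    exact hy2 (D.mem_closure_of_level hy1 (D.norm_blaschke_low hy3)).2) with h | h
  · have hm := j.pos
    have hne : (critPoly μ κ).roots.toFinset.Nonempty := by
      rw [← Finset.card_pos, D.crit.card]; omega
    obtain ⟨c, hc⟩ := hne
    rw [Multiset.mem_toFinset, Polynomial.mem_roots (critPoly_ne_zero D.crit.pos)] at hc
    have hc1 := D.crit.norm_root c hc
    obtain ⟨α, G, N, hch⟩ := D.crit.exists_chart_critical hc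
    obtain ⟨w, hw, hwc⟩ := h (D.mem_low_circle (hch.mem_closure_low hc1) (norm_blaschke μ κ hc1))
    have hw1 := D.norm_eq_one_of_norm j (mem_closedBall_zero_iff.1 hw) (by rw [hwc, hc1])
    have := hlt w hw1
    rw [hwc, hc1] at this
    exact lt_irrefl _ this
  · have h1 := hlt 1 (by simp)
    have h2 := D.norm_blaschke_param j (w := 1) (by simp)
    exact h _ (D.mem_low_circle (D.mem_closure_of_level h1 h2).1 h2) ⟨1, by simp, rfl⟩

/-- The arc is closed, neither empty nor the whole circle, and relatively open at noncritical
points. Without critical points it would be clopen in the circle; with only one, it would be clopen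
in the circle minus that point, which is still connected. -/
theorem exists_two_critical (j : Fin m) : ∃ w₁ w₂, w₁ ≠ w₂ ∧ (‖w₁‖ = 1 ∧ ‖ψ j w₁‖ = 1) ∧
    (‖w₂‖ = 1 ∧ ‖ψ j w₂‖ = 1) ∧ (critPoly μ κ).eval (ψ j w₁) = 0 ∧ (critPoly μ κ).eval (ψ j w₂) = 0 := by
  obtain ⟨w₀, hw₀, hw₀'⟩ := D.exists_mem_arc j
  obtain ⟨w, hw, hwP⟩ := D.exists_regular_mem_arc j hw₀ hw₀'
  obtain ⟨u, hu, hu'⟩ := D.exists_not_mem_arc j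
  have hfirst : ∃ w₁, (‖w₁‖ = 1 ∧ ‖ψ j w₁‖ = 1) ∧ (critPoly μ κ).eval (ψ j w₁) = 0 := by
    by_contra! hno
    have hS : IsPreconnected (sphere (0 : ℂ) 1) :=
      isPreconnected_sphere (by rw [rank_real_complex]; norm_num) 0 1
    rcases subset_or_disjoint_of_relClopen hS (D.isClosed_arc j)
      (fun x _ hxA => D.eventually_mem_arc j hxA.1 hxA.2 (hno x hxA)) with h | h
    · exact hu' (h (mem_sphere_zero_iff_norm.2 hu)).2
    · exact h w (mem_sphere_zero_iff_norm.2 hw.1) hw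
  obtain ⟨w₁, hw₁, hP₁⟩ := hfirst
  by_contra! hno
  have huniq : ∀ x, (‖x‖ = 1 ∧ ‖ψ j x‖ = 1) → x ≠ w₁ → (critPoly μ κ).eval (ψ j x) ≠ 0 :=
    fun x hx hne h0 => hno w₁ x hne.symm hw₁ hx hP₁ h0
  rcases subset_or_disjoint_of_relClopen (isPreconnected_sphere_diff hw₁.1) (D.isClosed_arc j) (by
    rintro x ⟨hx, hxne⟩ hxA
    refine (D.eventually_mem_arc j hxA.1 hxA.2 (huniq x hxA hxne)).filter_mono (nhdsWithin_mono _ ?_)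
    exact fun y hy => mem_sphere_zero_iff_norm.2 hy.1) with h | h
  · have hne : u ≠ w₁ := by rintro rfl; exact hu' hw₁.2
    exact hu' (h ⟨hu, hne⟩).2
  · have hne : w ≠ w₁ := by rintro rfl; exact hwP hP₁
    exact h w ⟨hw.1, hne⟩ hw

-- The `m` components are disjoint and contain at least two critical points each; as there are only
-- `2m` in all, equality holds for every one.
open Classical in
theorem card_critical (j : Fin m) :
    ((critPoly μ κ).roots.toFinset.filter (· ∈ ψ j '' closedBall 0 1)).card = 2 := by
  set C := (critPoly μ κ).roots.toFinset with hC
  set f : Fin m → Finset ℂ := fun i => C.filter (· ∈ ψ i '' closedBall 0 1) with hf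
  have hmem : ∀ z, z ∈ C ↔ (critPoly μ κ).eval z = 0 := fun z => by
    rw [hC, Multiset.mem_toFinset, Polynomial.mem_roots (critPoly_ne_zero D.crit.pos)]; rfl
  have hge : ∀ i, 2 ≤ (f i).card := by
    intro i
    obtain ⟨w₁, w₂, hne, h₁, h₂, hP₁, hP₂⟩ := D.exists_two_critical i
    have b1 : w₁ ∈ closedBall (0 : ℂ) 1 := by simp [h₁.1]
    have b2 : w₂ ∈ closedBall (0 : ℂ) 1 := by simp [h₂.1]
    have hne' : ψ i w₁ ≠ ψ i w₂ := fun h => hne ((D.high i).inj b1 b2 h)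
    rw [← Finset.card_pair hne']
    refine Finset.card_le_card fun z hz => ?_
    rw [Finset.mem_insert, Finset.mem_singleton] at hz
    rw [hf, Finset.mem_filter, hmem]
    rcases hz with rfl | rfl
    · exact ⟨hP₁, w₁, b1, rfl⟩
    · exact ⟨hP₂, w₂, b2, rfl⟩
  have hsum : ∑ i, (f i).card ≤ 2 * m := by
    rw [← Finset.card_biUnion, ← D.crit.card]
    · exact Finset.card_le_card (Finset.biUnion_subset.2 fun i _ => Finset.filter_subset _ _)
    · intro i _ i' _ hii
      change Disjoint (f i) (f i')
      rw [Finset.disjoint_left]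
      intro z hz hz'
      exact Set.disjoint_left.1 (D.disjoint_image hii) (Finset.mem_filter.1 hz).2 (Finset.mem_filter.1 hz').2
  have hsum2 : ∑ _i : Fin m, 2 = 2 * m := by simp [mul_comm]
  have := (Finset.sum_eq_sum_iff_of_le (s := Finset.univ) (f := fun _ : Fin m => 2) (g := fun i => (f i).card)
    fun i _ => hge i).1 (le_antisymm (Finset.sum_le_sum fun i _ => hge i) (hsum2 ▸ hsum)) j (Finset.mem_univ j)
  exact this.symm

/-- The two critical points on the boundary of the `j`-th component. -/
theorem exists_critical_pair (j : Fin m) : ∃ w₁ w₂, w₁ ≠ w₂ ∧ (‖w₁‖ = 1 ∧ ‖ψ j w₁‖ = 1) ∧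
    (‖w₂‖ = 1 ∧ ‖ψ j w₂‖ = 1) ∧ (critPoly μ κ).eval (ψ j w₁) = 0 ∧
    (critPoly μ κ).eval (ψ j w₂) = 0 ∧
    ∀ w, ‖w‖ = 1 → (critPoly μ κ).eval (ψ j w) = 0 → w = w₁ ∨ w = w₂ := by
  classical
  obtain ⟨w₁, w₂, hne, h₁, h₂, hP₁, hP₂⟩ := D.exists_two_critical j
  refine ⟨w₁, w₂, hne, h₁, h₂, hP₁, hP₂, fun w hw hP => ?_⟩
  by_contra! hno
  have hcard := D.card_critical j
  have b : w ∈ closedBall (0 : ℂ) 1 := by simp [hw]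
  have b1 : w₁ ∈ closedBall (0 : ℂ) 1 := by simp [h₁.1]
  have b2 : w₂ ∈ closedBall (0 : ℂ) 1 := by simp [h₂.1]
  have hsub : ({w, w₁, w₂} : Finset ℂ).image (ψ j) ⊆
      (critPoly μ κ).roots.toFinset.filter (· ∈ ψ j '' closedBall 0 1) := by
    intro z hz
    rw [Finset.mem_image] at hz
    obtain ⟨x, hx, rfl⟩ := hz
    rw [Finset.mem_filter, Multiset.mem_toFinset, Polynomial.mem_roots (critPoly_ne_zero D.crit.pos)]
    simp only [Finset.mem_insert, Finset.mem_singleton] at hx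
    rcases hx with rfl | rfl | rfl
    · exact ⟨hP, x, b, rfl⟩
    · exact ⟨hP₁, x, b1, rfl⟩
    · exact ⟨hP₂, x, b2, rfl⟩
  have h3 : (({w, w₁, w₂} : Finset ℂ).image (ψ j)).card = 3 := by
    rw [Finset.card_image_of_injOn, Finset.card_eq_three.2 ⟨w, w₁, w₂, hno.1, hno.2, hne, rfl⟩]
    intro x hx y hy hxy
    have hb : ∀ x ∈ ({w, w₁, w₂} : Finset ℂ), x ∈ closedBall (0 : ℂ) 1 := by
      intro x hx
      simp only [Finset.mem_insert, Finset.mem_singleton] at hx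
      rcases hx with rfl | rfl | rfl <;> assumption
    exact (D.high j).inj (hb x hx) (hb y hy) hxy
  have := Finset.card_le_card hsub
  omega

end IsDecomposition
end

section

variable {m : ℕ} {μ : Param m} {κ : Fin (m + 1) → ℕ}

/-! ### The curves and the discs -/

theorem inv_conj_inv_conj (z : ℂ) : 1 / conj (1 / conj z) = z := by simp

theorem norm_inv_conj (z : ℂ) : ‖1 / conj z‖ = ‖z‖⁻¹ := by simp

theorem tendsto_inv_conj {z : ℂ} (hz : z ≠ 0) :
    Tendsto (fun y : ℂ => 1 / conj y) (𝓝 z) (𝓝 (1 / conj z)) :=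
  ContinuousAt.div continuousAt_const continuous_conj.continuousAt ((map_ne_zero _).2 hz)

/-- The parametrization of the closed disc bounded by one of the curves, symmetric about the
circle, extending the part `T` in the closed unit disc. -/
structure IsSymmetricParam (μ : Param m) (κ : Fin (m + 1) → ℕ) (T : Set ℂ) (Ψ : ℂ → ℂ) : Prop where
  cont : ContinuousOn Ψ (closedBall 0 1)
  inj : InjOn Ψ (closedBall 0 1)
  symm : ∀ ζ ∈ closedBall (0 : ℂ) 1, Ψ (conj ζ) = 1 / conj (Ψ ζ)
  ne_zero : ∀ ζ ∈ closedBall (0 : ℂ) 1, Ψ ζ ≠ 0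
  mem : ∀ ζ ∈ closedBall (0 : ℂ) 1, ‖Ψ ζ‖ ≤ 1 → Ψ ζ ∈ T
  surj : ∀ z ∈ T, ∃ ζ ∈ closedBall (0 : ℂ) 1, Ψ ζ = z
  level : ∀ ζ ∈ closedBall (0 : ℂ) 1, ‖Ψ ζ‖ < 1 → (‖ζ‖ = 1 ↔ ‖blaschke μ κ (Ψ ζ)‖ = 1)
  norm_eq_one_iff : ∀ ζ ∈ closedBall (0 : ℂ) 1, ‖Ψ ζ‖ = 1 ↔ ζ.im = 0
  crit_one : (critPoly μ κ).eval (Ψ 1) = 0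
  crit_neg_one : (critPoly μ κ).eval (Ψ (-1)) = 0
  eq_of_crit : ∀ z ∈ T, (critPoly μ κ).eval z = 0 → z = Ψ 1 ∨ z = Ψ (-1)

/-- The closed component is a disc with one arc on the circle. Reparametrizing it by a half-disc
whose diameter goes to that arc allows doubling by reflection; the ends `±1` of the diameter go to
the two critical points. -/
theorem IsDecomposition.exists_symmetricParam {k₀ : ℕ} {ψ₀ : ℂ → ℂ} {k : Fin m → ℕ}
    {ψ : Fin m → ℂ → ℂ} (D : IsDecomposition μ κ k₀ ψ₀ k ψ) (j : Fin m) :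
    ∃ Ψ, IsSymmetricParam μ κ (ψ j '' closedBall 0 1) Ψ := by
  obtain ⟨w₁, w₂, hne, h₁, h₂, hP₁, hP₂, huniq⟩ := D.exists_critical_pair j
  obtain ⟨η, hηc, hηb, hη1, hη2, hηA, hηn⟩ := exists_halfDisc_homeo (D.isClosed_arc j)
    (fun w hw => hw.1) h₁ h₂ hne
    (fun w hw hw1 hw2 => D.eventually_mem_arc j hw.1 hw.2 fun h =>
      (huniq w hw.1 h).elim hw1 hw2)
    (by
      obtain ⟨w, hw, hP⟩ := D.exists_regular_mem_arc j h₁.1 h₁.2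
      exact ⟨w, hw, fun h => hP (h ▸ hP₁), fun h => hP (h ▸ hP₂)⟩)
    (by
      obtain ⟨w, hw, hw'⟩ := D.exists_not_mem_arc j
      exact ⟨w, hw, fun h => hw' h.2⟩)
  have hηle : ∀ ζ ∈ halfDisc, ‖η ζ‖ ≤ 1 := fun ζ hζ => mem_closedBall_zero_iff.1 (hηb.mapsTo hζ)
  have hn1 : ∀ ζ ∈ halfDisc, ‖ψ j (η ζ)‖ = 1 ↔ ζ.im = 0 := fun ζ hζ => by
    rw [← hηA ζ hζ]
    exact ⟨fun h => ⟨D.norm_eq_one_of_norm j (hηle ζ hζ) h, h⟩, fun h => h.2⟩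
  obtain ⟨Ψ, hc, hi, he, hs⟩ := exists_double (θ := fun ζ => ψ j (η ζ))
    ((D.high j).cont.comp hηc hηb.mapsTo)
    ((D.high j).inj.comp hηb.injOn hηb.mapsTo)
    (fun ζ hζ => D.norm_le j (hηle ζ hζ)) (fun ζ hζ => D.param_ne_zero j (hηle ζ hζ)) hn1
  replace he : ∀ {ζ}, ζ ∈ halfDisc → Ψ ζ = ψ j (η ζ) := fun hζ => he hζ
  have hsub : ∀ ζ ∈ halfDisc, ζ ∈ closedBall (0 : ℂ) 1 := fun ζ hζ => mem_closedBall_zero_iff.2 hζ.1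
  have hlow : ∀ ζ ∈ closedBall (0 : ℂ) 1, ζ ∉ halfDisc →
      conj ζ ∈ halfDisc ∧ ζ.im < 0 ∧ 1 < ‖Ψ ζ‖ := by
    intro ζ hζ hζh
    have hζ1 := mem_closedBall_zero_iff.1 hζ
    have him : ζ.im < 0 := not_le.1 fun h => hζh ⟨hζ1, h⟩
    have hcj : conj ζ ∈ halfDisc := ⟨by simpa using hζ1, by simpa using him.le⟩
    refine ⟨hcj, him, ?_⟩
    have h := hs (conj ζ) (hsub _ hcj)
    rw [conj_conj] at h
    rw [h, norm_inv_conj, he hcj]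
    have hlt : ‖ψ j (η (conj ζ))‖ < 1 :=
      lt_of_le_of_ne (D.norm_le j (hηle _ hcj)) fun h => by
        have := (hn1 _ hcj).1 h
        rw [conj_im, neg_eq_zero] at this
        exact him.ne this
    exact (one_lt_inv₀ (norm_pos_iff.2 (D.param_ne_zero j (hηle _ hcj)))).2 hlt
  have hhalf : ∀ ζ ∈ closedBall (0 : ℂ) 1, ‖Ψ ζ‖ ≤ 1 → ζ ∈ halfDisc := fun ζ hζ h => by
    by_contra hζh
    exact absurd h (not_le.2 (hlow ζ hζ hζh).2.2)
  have h1m : (1 : ℂ) ∈ halfDisc := by simp [halfDisc]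
  have h2m : (-1 : ℂ) ∈ halfDisc := by simp [halfDisc]
  have hΨ1 : Ψ 1 = ψ j w₁ := by rw [he h1m, hη1]
  have hΨ2 : Ψ (-1) = ψ j w₂ := by rw [he h2m, hη2]
  refine ⟨Ψ, hc, hi, hs, ?_, ?_, ?_, ?_, ?_, by rwa [hΨ1], by rwa [hΨ2], ?_⟩
  · intro ζ hζ h0
    have hh := hhalf ζ hζ (by rw [h0, norm_zero]; exact zero_le_one)
    rw [he hh] at h0
    exact D.param_ne_zero j (hηle ζ hh) h0
  · intro ζ hζ h
    have hh := hhalf ζ hζ h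
    rw [he hh]
    exact ⟨η ζ, hηb.mapsTo hh, rfl⟩
  · rintro _ ⟨w, hw, rfl⟩
    obtain ⟨ζ, hζ, rfl⟩ := hηb.surjOn hw
    exact ⟨ζ, hsub ζ hζ, he hζ⟩
  · intro ζ hζ h
    have hh := hhalf ζ hζ h.le
    rw [he hh] at h ⊢
    have him : ζ.im ≠ 0 := fun h0 => h.ne ((hn1 ζ hh).2 h0)
    have h3 := hηn ζ hh
    rw [or_iff_right him] at h3
    rw [← h3]
    exact ⟨fun h => D.norm_blaschke_param j h, D.norm_eq_one_of_level j (hηle ζ hh)⟩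
  · intro ζ hζ
    by_cases hh : ζ ∈ halfDisc
    · rw [he hh]; exact hn1 ζ hh
    · obtain ⟨-, h1, h2⟩ := hlow ζ hζ hh
      exact ⟨fun h => absurd h h2.ne', fun h => absurd h h1.ne⟩
  · rintro _ ⟨w, hw, rfl⟩ hP
    have hw1 := D.norm_eq_one_of_norm j (mem_closedBall_zero_iff.1 hw) (D.crit.norm_root _ hP)
    rw [hΨ1, hΨ2]
    rcases huniq w hw1 hP with rfl | rfl
    · exact Or.inl rfl
    · exact Or.inr rfl

theorem isAnalytic_chart {Γ : Set ℂ} {φ : ℂ → ℂ} {p : ℂ} {N : Set ℂ} (hN : N ∈ 𝓝 p)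
    (hd : DifferentiableOn ℂ φ N) (hi : InjOn φ N) (h : ∀ᶠ z in 𝓝 p, z ∈ Γ ↔ (φ z).im = 0) :
    ∃ (U : Set ℂ) (φ : ℂ → ℂ), IsOpen U ∧ p ∈ U ∧ DifferentiableOn ℂ φ U ∧
      Set.InjOn φ U ∧ Γ ∩ U = {z ∈ U | (φ z).im = 0} := by
  have hM : N ∩ {z | z ∈ Γ ↔ (φ z).im = 0} ∈ 𝓝 p := inter_mem hN h
  refine ⟨interior (N ∩ {z | z ∈ Γ ↔ (φ z).im = 0}), φ, isOpen_interior, mem_interior_iff_mem_nhds.2 hM,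
    hd.mono (interior_subset.trans inter_subset_left),
    hi.mono (interior_subset.trans inter_subset_left), ?_⟩
  ext z
  constructor
  · rintro ⟨hz, hU⟩
    exact ⟨hU, (interior_subset hU).2.1 hz⟩
  · rintro ⟨hU, hz⟩
    exact ⟨(interior_subset hU).2.2 hz, hU⟩

/-- A level curve of the modulus is analytic near a regular point. -/
theorem isAnalytic_chart_of_level {Γ : Set ℂ} {B : ℂ → ℂ} {p : ℂ} (hB : AnalyticAt ℂ B p)
    (hB1 : ‖B p‖ = 1) (hd : deriv B p ≠ 0) (h : ∀ᶠ z in 𝓝 p, z ∈ Γ ↔ ‖B z‖ = 1) :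
    ∃ (U : Set ℂ) (φ : ℂ → ℂ), IsOpen U ∧ p ∈ U ∧ DifferentiableOn ℂ φ U ∧
      Set.InjOn φ U ∧ Γ ∩ U = {z ∈ U | (φ z).im = 0} := by
  have hBp : B p ≠ 0 := fun h0 => by rw [h0, norm_zero] at hB1; exact zero_ne_one hB1
  obtain ⟨N, hN, hi⟩ := exists_nhds_injOn_of_deriv_ne_zero hB hd
  have hslit : ∀ᶠ z in 𝓝 p, B z / B p ∈ slitPlane :=
    (hB.continuousAt.div_const _).eventually_mem
      (isOpen_slitPlane.mem_nhds (by rw [div_self hBp]; exact one_mem_slitPlane))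
  have hM : {z | z ∈ N ∧ AnalyticAt ℂ B z ∧ B z / B p ∈ slitPlane} ∈ 𝓝 p :=
    (show ∀ᶠ z in 𝓝 p, z ∈ N from hN).and (hB.eventually_analyticAt.and hslit)
  -- The imaginary part of this coordinate is `log |B|`.
  refine isAnalytic_chart (φ := fun z => I * log (B z / B p)) hM ?_ ?_ ?_
  · rintro z ⟨-, hz, hs⟩
    exact (((hz.differentiableAt.div_const _).clog hs).const_mul I).differentiableWithinAt
  · rintro z ⟨hz, -, hs⟩ w ⟨hw, -, hs'⟩ he
    refine hi hz hw ?_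
    have h1 := mul_left_cancel₀ I_ne_zero he
    have h2 := congrArg exp h1
    rw [exp_log (slitPlane_ne_zero hs), exp_log (slitPlane_ne_zero hs')] at h2
    exact (div_left_inj' hBp).1 h2
  · filter_upwards [h, hslit] with z hz hs
    have hB0 : 0 < ‖B z‖ := norm_pos_iff.2 fun h0 => slitPlane_ne_zero hs (by rw [h0, zero_div])
    rw [hz, I_mul_im, log_re, norm_div, hB1, div_one]
    constructor
    · intro h; rw [h, Real.log_one]
    · exact Real.eq_one_of_pos_of_log_eq_zero hB0

/-! ### Properties of the doubled discs and their boundary curves -/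

namespace IsSymmetricParam

variable {k₀ : ℕ} {ψ₀ : ℂ → ℂ} {k : Fin m → ℕ} {ψ : Fin m → ℂ → ℂ} {j : Fin m} {Ψ : ℂ → ℂ}
variable (h : IsSymmetricParam μ κ (ψ j '' closedBall 0 1) Ψ)
include h

theorem inv_conj_mem {S : Set ℂ} (hS : S ⊆ closedBall 0 1) (hSc : ∀ ζ ∈ S, conj ζ ∈ S) {z : ℂ}
    (hz : z ∈ Ψ '' S) : 1 / conj z ∈ Ψ '' S := by
  obtain ⟨ζ, hζ, rfl⟩ := hz
  exact ⟨conj ζ, hSc ζ hζ, h.symm ζ (hS hζ)⟩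

theorem inv_conj_mem_ball {z : ℂ} : 1 / conj z ∈ Ψ '' ball 0 1 ↔ z ∈ Ψ '' ball 0 1 := by
  have hi : ∀ {z}, z ∈ Ψ '' ball 0 1 → 1 / conj z ∈ Ψ '' ball 0 1 :=
    h.inv_conj_mem ball_subset_closedBall fun ζ hζ => by simpa using hζ
  exact ⟨fun hz => by simpa only [inv_conj_inv_conj] using hi hz, hi⟩

theorem inv_conj_mem_sphere {z : ℂ} : 1 / conj z ∈ Ψ '' sphere 0 1 ↔ z ∈ Ψ '' sphere 0 1 := by
  have hi : ∀ {z}, z ∈ Ψ '' sphere 0 1 → 1 / conj z ∈ Ψ '' sphere 0 1 :=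
    h.inv_conj_mem sphere_subset_closedBall fun ζ hζ => by simpa using hζ
  exact ⟨fun hz => by simpa only [inv_conj_inv_conj] using hi hz, hi⟩

theorem mem_or_inv_conj_mem {z : ℂ} (hz : z ∈ Ψ '' closedBall 0 1) :
    (‖z‖ ≤ 1 ∧ z ∈ ψ j '' closedBall 0 1) ∨ (1 < ‖z‖ ∧ 1 / conj z ∈ ψ j '' closedBall 0 1) := by
  rcases le_or_gt ‖z‖ 1 with h1 | h1
  · obtain ⟨ζ, hζ, rfl⟩ := hz
    exact Or.inl ⟨h1, h.mem ζ hζ h1⟩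
  · obtain ⟨ζ, hζ, hζz⟩ := h.inv_conj_mem Subset.rfl (fun ζ hζ => by simpa using hζ) hz
    refine Or.inr ⟨h1, hζz ▸ h.mem ζ hζ ?_⟩
    rw [hζz, norm_inv_conj]
    exact inv_le_one_of_one_le₀ h1.le

theorem mem_sphere_iff {z : ℂ} (hz : ‖z‖ < 1) :
    z ∈ Ψ '' sphere 0 1 ↔ z ∈ ψ j '' closedBall 0 1 ∧ ‖blaschke μ κ z‖ = 1 := by
  constructor
  · rintro ⟨ζ, hζ, rfl⟩
    have hζ' := sphere_subset_closedBall hζ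
    exact ⟨h.mem ζ hζ' hz.le, (h.level ζ hζ' hz).1 (mem_sphere_zero_iff_norm.1 hζ)⟩
  · rintro ⟨hT, hB⟩
    obtain ⟨ζ, hζ, rfl⟩ := h.surj z hT
    exact ⟨ζ, mem_sphere_zero_iff_norm.2 ((h.level ζ hζ hz).2 hB), rfl⟩

theorem mem_sphere_iff_of_norm_eq_one {z : ℂ} (hz : ‖z‖ = 1) :
    z ∈ Ψ '' sphere 0 1 ↔ z = Ψ 1 ∨ z = Ψ (-1) := by
  constructor
  · rintro ⟨ζ, hζ, rfl⟩
    have him := (h.norm_eq_one_iff ζ (sphere_subset_closedBall hζ)).1 hz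
    have hn := (norm_eq_one_iff_sq ζ).1 (mem_sphere_zero_iff_norm.1 hζ)
    rw [him] at hn
    have hre : ζ.re ^ 2 = 1 := by linarith
    rcases (sq_eq_sq_iff_eq_or_eq_neg (a := ζ.re) (b := 1)).1 (by rw [hre, one_pow]) with h1 | h1
    · left; congr 1; exact Complex.ext h1 him
    · right; congr 1; exact Complex.ext (by simpa using h1) (by simpa using him)
  · rintro (rfl | rfl)
    · exact ⟨1, by simp, rfl⟩
    · exact ⟨-1, by simp, rfl⟩

theorem mem_ball_iff {z : ℂ} (hz : ‖z‖ < 1) :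
    z ∈ Ψ '' ball 0 1 ↔ z ∈ ψ j '' closedBall 0 1 ∧ ‖blaschke μ κ z‖ ≠ 1 := by
  constructor
  · rintro ⟨ζ, hζ, rfl⟩
    have hζ' := ball_subset_closedBall hζ
    exact ⟨h.mem ζ hζ' hz.le, fun hB =>
      (mem_ball_zero_iff.1 hζ).ne ((h.level ζ hζ' hz).2 hB)⟩
  · rintro ⟨hT, hB⟩
    obtain ⟨ζ, hζ, rfl⟩ := h.surj z hT
    exact ⟨ζ, mem_ball_zero_iff.2 (lt_of_le_of_ne (mem_closedBall_zero_iff.1 hζ) fun h1 =>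
      hB ((h.level ζ hζ hz).1 h1)), rfl⟩

theorem mem_ball_iff_of_norm_eq_one {z : ℂ} (hz : ‖z‖ = 1) :
    z ∈ Ψ '' ball 0 1 ↔ z ∈ ψ j '' closedBall 0 1 ∧ z ≠ Ψ 1 ∧ z ≠ Ψ (-1) := by
  constructor
  · rintro ⟨ζ, hζ, rfl⟩
    have hζ' := ball_subset_closedBall hζ
    have hlt := mem_ball_zero_iff.1 hζ
    refine ⟨h.mem ζ hζ' hz.le, fun he => ?_, fun he => ?_⟩
    · rw [h.inj hζ' (by simp) he] at hlt; simp at hlt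
    · rw [h.inj hζ' (by simp) he] at hlt; simp at hlt
  · rintro ⟨hT, h1, h2⟩
    obtain ⟨ζ, hζ, rfl⟩ := h.surj z hT
    refine ⟨ζ, mem_ball_zero_iff.2 (lt_of_le_of_ne (mem_closedBall_zero_iff.1 hζ) fun hn => ?_), rfl⟩
    exact ((h.mem_sphere_iff_of_norm_eq_one hz).1 ⟨ζ, mem_sphere_zero_iff_norm.2 hn, rfl⟩).elim h1 h2

theorem image_ne_zero {z : ℂ} (hz : z ∈ Ψ '' closedBall 0 1) : z ≠ 0 := by
  obtain ⟨ζ, hζ, rfl⟩ := hz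
  exact h.ne_zero ζ hζ

theorem one_ne_neg_one : Ψ 1 ≠ Ψ (-1) := fun he => by
  have h1 := h.inj (by simp) (by simp) he
  have h2 := congrArg re h1
  norm_num at h2

theorem isJordanCurve : IsJordanCurve (Ψ '' sphere 0 1) := by
  have hs : ∀ z : Circle, (z : ℂ) ∈ sphere (0 : ℂ) 1 := fun z => mem_sphere_zero_iff_norm.2 z.norm_coe
  refine ⟨fun z : Circle => Ψ z, ?_, ?_, ?_⟩
  · exact h.cont.comp_continuous continuous_subtype_val fun z => sphere_subset_closedBall (hs z)
  · intro x y hxy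
    exact Circle.ext (h.inj (sphere_subset_closedBall (hs x)) (sphere_subset_closedBall (hs y)) hxy)
  · ext z
    constructor
    · rintro ⟨x, rfl⟩; exact ⟨x, hs x, rfl⟩
    · rintro ⟨x, hx, rfl⟩; exact ⟨⟨x, hx⟩, rfl⟩

theorem isInversionSymmetric : IsInversionSymmetric (Ψ '' sphere 0 1) := by
  refine ⟨fun h0 => h.image_ne_zero (image_mono sphere_subset_closedBall h0) rfl, ?_⟩
  ext z
  constructor
  · rintro ⟨y, hy, rfl⟩; exact h.inv_conj_mem_sphere.2 hy
  · intro hz; exact ⟨1 / conj z, h.inv_conj_mem_sphere.2 hz, inv_conj_inv_conj z⟩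

theorem inter_sphere : Ψ '' sphere 0 1 ∩ sphere 0 1 = {Ψ 1, Ψ (-1)} := by
  ext z
  constructor
  · rintro ⟨hz, h1⟩
    exact (h.mem_sphere_iff_of_norm_eq_one (mem_sphere_zero_iff_norm.1 h1)).1 hz
  · intro hz
    have h1 : ‖z‖ = 1 := by
      rcases hz with rfl | rfl
      · exact (h.norm_eq_one_iff 1 (by simp)).2 (by simp)
      · exact (h.norm_eq_one_iff (-1) (by simp)).2 (by simp)
    exact ⟨(h.mem_sphere_iff_of_norm_eq_one h1).2 hz, mem_sphere_zero_iff_norm.2 h1⟩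

theorem norm_blaschke_eq_one {z : ℂ} (hz : z ∈ Ψ '' sphere 0 1) : ‖blaschke μ κ z‖ = 1 := by
  have hz0 := h.image_ne_zero (image_mono sphere_subset_closedBall hz)
  rcases lt_trichotomy ‖z‖ 1 with h1 | h1 | h1
  · exact ((h.mem_sphere_iff h1).1 hz).2
  · exact norm_blaschke μ κ h1
  · rw [← norm_blaschke_inv_conj hz0]
    refine ((h.mem_sphere_iff ?_).1 (h.inv_conj_mem_sphere.2 hz)).2
    rw [norm_inv_conj]; exact inv_lt_one_of_one_lt₀ h1

variable (D : IsDecomposition μ κ k₀ ψ₀ k ψ)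
include D

/-- Inside the unit disc the set is the open component. At an interior point of the arc, which is
regular, the inner side is high and lies near no other component. The reflection takes care of the
outer side. -/
theorem isOpen_image_ball : IsOpen (Ψ '' ball 0 1) := by
  have hin : ∀ z ∈ Ψ '' ball 0 1, ‖z‖ ≤ 1 →
      ∀ᶠ y in 𝓝 z, ‖y‖ ≤ 1 → y ∈ Ψ '' ball 0 1 := by
    intro z hz h1
    rcases h1.lt_or_eq with h1 | h1
    · obtain ⟨w, hw, rfl⟩ := ((h.mem_ball_iff h1).1 hz).1
      have hw1 : w ∈ ball (0 : ℂ) 1 := mem_ball_zero_iff.2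
        (lt_of_le_of_ne (mem_closedBall_zero_iff.1 hw) fun hn =>
          ((h.mem_ball_iff h1).1 hz).2 (D.norm_blaschke_param j hn))
      filter_upwards [(D.high j).isOpen_image.mem_nhds ⟨w, hw1, rfl⟩] with y hy _
      obtain ⟨v, hv, rfl⟩ := hy
      have hv1 := mem_ball_zero_iff.1 hv
      have hhigh := (D.mem_high_iff j hv1.le).2 hv1
      exact (h.mem_ball_iff hhigh.1).2 ⟨⟨v, ball_subset_closedBall hv, rfl⟩,
        D.norm_blaschke_ne_one_of_high hhigh⟩
    · obtain ⟨hT, hne1, hne2⟩ := (h.mem_ball_iff_of_norm_eq_one h1).1 hz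
      have hP : (critPoly μ κ).eval z ≠ 0 := fun hP => (h.eq_of_crit z hT hP).elim hne1 hne2
      have hcl : z ∈ closure (highRegion μ κ) := by
        obtain ⟨w, hw, rfl⟩ := hT
        exact D.mem_closure_high j (mem_closedBall_zero_iff.1 hw)
      filter_upwards [D.eventually_mem_high h1 hP hcl, D.eventually_mem_image hT,
        isOpen_ne.mem_nhds hne1, isOpen_ne.mem_nhds hne2] with y hy1 hy2 hy3 hy4 hy
      rcases hy.lt_or_eq with hy | hy
      · have hh := hy1.1 hy
        exact (h.mem_ball_iff hy).2 ⟨hy2 (subset_closure hh), D.norm_blaschke_ne_one_of_high hh⟩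
      · exact (h.mem_ball_iff_of_norm_eq_one hy).2 ⟨hy2 (hy1.2 hy), hy3, hy4⟩
  have hin' : ∀ z ∈ Ψ '' ball 0 1, ∀ᶠ y in 𝓝 z, ‖y‖ ≤ 1 → y ∈ Ψ '' ball 0 1 := by
    intro z hz
    rcases le_or_gt ‖z‖ 1 with h1 | h1
    · exact hin z hz h1
    · filter_upwards [(continuous_norm.isOpen_preimage _ isOpen_Ioi).mem_nhds h1] with y hy hy'
      exact absurd hy' (not_le.2 hy)
  rw [isOpen_iff_mem_nhds]
  intro z hz
  have hz0 := h.image_ne_zero (image_mono ball_subset_closedBall hz)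
  filter_upwards [hin' z hz,
    (tendsto_inv_conj hz0).eventually (hin' _ (h.inv_conj_mem_ball.2 hz))] with y hy1 hy2
  rcases le_or_gt ‖y‖ 1 with hy | hy
  · exact hy1 hy
  · refine h.inv_conj_mem_ball.1 (hy2 ?_)
    rw [norm_inv_conj]; exact inv_le_one_of_one_le₀ hy.le

/-- Level points inside the disc are limits of high points, and near `p` these come from the `j`-th
component only; reflection gives the outside. Points of the circle are excluded because `|B| = 1` on
all of it. -/
theorem eventually_mem_sphere_iff {p : ℂ} (hp : p ∈ Ψ '' sphere 0 1) :
    ∀ᶠ z in 𝓝 p, ‖z‖ ≠ 1 → (z ∈ Ψ '' sphere 0 1 ↔ ‖blaschke μ κ z‖ = 1) := by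
  have hin : ∀ p ∈ Ψ '' sphere 0 1, ∀ᶠ z in 𝓝 p, ‖z‖ < 1 →
      (z ∈ Ψ '' sphere 0 1 ↔ ‖blaschke μ κ z‖ = 1) := by
    intro p hp
    rcases h.mem_or_inv_conj_mem (image_mono sphere_subset_closedBall hp) with ⟨-, hT⟩ | ⟨h1, -⟩
    · filter_upwards [D.eventually_mem_image hT] with z hz hz1
      rw [h.mem_sphere_iff hz1, and_iff_right_iff_imp]
      exact fun hB => hz (D.mem_closure_of_level hz1 hB).2
    · filter_upwards [(continuous_norm.isOpen_preimage _ isOpen_Ioi).mem_nhds h1] with y hy hy'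
      exact absurd hy' (not_lt.2 (le_of_lt hy))
  have hp0 := h.image_ne_zero (image_mono sphere_subset_closedBall hp)
  filter_upwards [hin p hp, (tendsto_inv_conj hp0).eventually (hin _ (h.inv_conj_mem_sphere.2 hp)),
    isOpen_ne.mem_nhds hp0] with z hz1 hz2 hz0 hne
  rcases hne.lt_or_gt with hz | hz
  · exact hz1 hz
  · rw [← h.inv_conj_mem_sphere, ← norm_blaschke_inv_conj hz0]
    refine hz2 ?_
    rw [norm_inv_conj]; exact inv_lt_one_of_one_lt₀ hz

/-- At a fold the level set is `Re G * Im G = 0` and the circle is `Im G = 0`, so the curve is `Re G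
= 0`, straightened by `i G`. Elsewhere on the curve `B' ≠ 0` and the logarithm of `B` is a
coordinate. -/
theorem isAnalyticJordanCurve : IsAnalyticJordanCurve (Ψ '' sphere 0 1) := by
  refine ⟨h.isJordanCurve, fun p hp => ?_⟩
  have hev := h.eventually_mem_sphere_iff D hp
  by_cases hp1 : ‖p‖ = 1
  · have hor := (h.mem_sphere_iff_of_norm_eq_one hp1).1 hp
    have hP : (critPoly μ κ).eval p = 0 := by
      rcases hor with rfl | rfl
      · exact h.crit_one
      · exact h.crit_neg_one
    have hcirc : ∀ᶠ z in 𝓝 p, ‖z‖ = 1 → (z ∈ Ψ '' sphere 0 1 ↔ z = p) := by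
      rcases hor with rfl | rfl
      · filter_upwards [isOpen_ne.mem_nhds h.one_ne_neg_one] with z hz hz1
        rw [h.mem_sphere_iff_of_norm_eq_one hz1, or_iff_left hz]
      · filter_upwards [isOpen_ne.mem_nhds h.one_ne_neg_one.symm] with z hz hz1
        rw [h.mem_sphere_iff_of_norm_eq_one hz1, or_iff_right hz]
    obtain ⟨α, G, N, hG⟩ := D.crit.exists_chart_critical hP
    have hN := hG.isOpen.mem_nhds hG.mem
    refine isAnalytic_chart (φ := fun z => I * G z) hN (hG.differentiableOn.const_mul I)
      (fun z hz w hw he => hG.inj hz hw (mul_left_cancel₀ I_ne_zero he)) ?_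
    filter_upwards [hev, hcirc, hN] with z hz1 hz2 hzN
    rw [I_mul_im]
    by_cases hzn : ‖z‖ = 1
    · rw [hz2 hzn]
      constructor
      · rintro rfl; rw [hG.zero, zero_re]
      · intro hre
        refine hG.inj hzN hG.mem ?_
        rw [hG.zero]
        exact Complex.ext hre ((hG.eq_iff z hzN).1 hzn)
    · rw [hz1 hzn, hG.norm_eq_one_iff hp1 hzN, IsCircleChart.sq_im]
      have him : (G z).im ≠ 0 := fun h0 => hzn ((hG.eq_iff z hzN).2 h0)
      simp [him]
  · have hB1 := h.norm_blaschke_eq_one hp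
    have hB0 : blaschke μ κ p ≠ 0 := fun h0 => by rw [h0, norm_zero] at hB1; exact zero_ne_one hB1
    rw [blaschke_eq_div] at hB0
    obtain ⟨hn, hd⟩ := div_ne_zero_iff.1 hB0
    refine isAnalytic_chart_of_level (analyticAt_blaschke hd) hB1
      (D.crit.deriv_ne_zero_of_norm_ne hp1 hn hd) ?_
    filter_upwards [hev, (continuous_norm.isOpen_preimage _ isOpen_ne).mem_nhds hp1] with z hz hz1
    exact hz hz1

/-- The pole is the centre of the `j`-th component, and `a_j` is its reflection. -/
theorem a_mem : μ.a j ∈ Ψ '' ball 0 1 ∧ 1 / conj (μ.a j) ∈ Ψ '' ball 0 1 := by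
  have h1 : 1 / conj (μ.a j) ∈ Ψ '' ball 0 1 := by
    refine (h.mem_ball_iff (μ.norm_pole_lt j)).2 ?_
    rw [← (D.high j).map_zero]
    exact ⟨⟨0, by simp, rfl⟩, D.norm_blaschke_ne_one_of_high ((D.mem_high_iff j (by simp)).2 (by simp))⟩
  exact ⟨h.inv_conj_mem_ball.1 h1, h1⟩

/-- A common point, or its reflection if it lies outside the disc, would belong to two of the
disjoint components. -/
theorem disjoint_closure {i : Fin m} (hij : i ≠ j) {Φ : ℂ → ℂ}
    (h' : IsSymmetricParam μ κ (ψ i '' closedBall 0 1) Φ) :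
    Disjoint (closure (Φ '' ball 0 1)) (closure (Ψ '' ball 0 1)) := by
  have hcl : ∀ {f : ℂ → ℂ}, ContinuousOn f (closedBall 0 1) →
      closure (f '' ball 0 1) ⊆ f '' closedBall 0 1 := fun hf =>
    closure_minimal (image_mono ball_subset_closedBall)
      ((isCompact_closedBall 0 1).image_of_continuousOn hf).isClosed
  refine Disjoint.mono (hcl h'.cont) (hcl h.cont) (Set.disjoint_left.2 fun z hz hz' => ?_)
  have hdis := Set.disjoint_left.1 (D.disjoint_image hij)
  rcases h.mem_or_inv_conj_mem hz' with ⟨h1, h2⟩ | ⟨h1, h2⟩ <;>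
    rcases h'.mem_or_inv_conj_mem hz with ⟨h3, h4⟩ | ⟨h3, h4⟩
  · exact hdis h4 h2
  · exact absurd h3 (not_lt.2 h1)
  · exact absurd h1 (not_lt.2 h3)
  · exact hdis h4 h2

end IsSymmetricParam

/-- A level point inside the disc is a limit of high points, so it lies in some closed component, on
its boundary curve. Level points outside are reflections of these. -/
theorem IsDecomposition.norm_blaschke_eq_one_iff_mem {k₀ : ℕ} {ψ₀ : ℂ → ℂ} {k : Fin m → ℕ}
    {ψ : Fin m → ℂ → ℂ} (D : IsDecomposition μ κ k₀ ψ₀ k ψ) {Ψ : Fin m → ℂ → ℂ}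
    (h : ∀ j, IsSymmetricParam μ κ (ψ j '' closedBall 0 1) (Ψ j)) (z : ℂ) :
    ‖blaschke μ κ z‖ = 1 ↔ ‖z‖ = 1 ∨ ∃ j, z ∈ Ψ j '' sphere 0 1 := by
  constructor
  · intro hB
    have hin : ∀ z : ℂ, ‖z‖ < 1 → ‖blaschke μ κ z‖ = 1 → ∃ j, z ∈ Ψ j '' sphere 0 1 := by
      intro z hz hB
      obtain ⟨j, hj⟩ := D.exists_mem_image (D.mem_closure_of_level hz hB).2
      exact ⟨j, ((h j).mem_sphere_iff hz).2 ⟨hj, hB⟩⟩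
    rcases lt_trichotomy ‖z‖ 1 with h1 | h1 | h1
    · exact Or.inr (hin z h1 hB)
    · exact Or.inl h1
    · have hz0 : z ≠ 0 := by rintro rfl; rw [norm_zero] at h1; linarith
      obtain ⟨j, hj⟩ := hin (1 / conj z) (by rw [norm_inv_conj]; exact inv_lt_one_of_one_lt₀ h1)
        ((norm_blaschke_inv_conj hz0).2 hB)
      exact Or.inr ⟨j, (h j).inv_conj_mem_sphere.1 hj⟩
  · rintro (hz | ⟨j, hj⟩)
    · exact norm_blaschke μ κ hz
    · exact (h j).norm_blaschke_eq_one hj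

/-- The two versions of `B` differ only at poles and at `∞`. At a finite pole one takes the value
`∞` and the other the default value `0`, neither of which is on the circle; `∞` itself is mapped to
`∞`. -/
theorem blaschkeSphere_preimage (hκ : ∀ j, 0 < κ j) :
    blaschkeSphere μ κ ⁻¹' ((fun z : ℂ => (z : OnePoint ℂ)) '' sphere 0 1) =
      (fun z : ℂ => (z : OnePoint ℂ)) '' {z | ‖blaschke μ κ z‖ = 1} := by
  ext x
  induction x using OnePoint.rec with
  | infty =>
    constructor
    · rintro ⟨z, -, hz⟩; exact absurd hz (OnePoint.coe_ne_infty z)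
    · rintro ⟨z, -, hz⟩; exact absurd hz (OnePoint.coe_ne_infty z)
  | coe z =>
    rw [OnePoint.coe_injective.mem_set_image, mem_preimage]
    change (if ∃ j, 1 - conj (μ.a j) * z = 0 then OnePoint.infty
      else ((blaschke μ κ z : ℂ) : OnePoint ℂ)) ∈ _ ↔ _
    split_ifs with hpole
    · constructor
      · rintro ⟨y, -, hy⟩; exact absurd hy (OnePoint.coe_ne_infty y)
      · intro hB
        rw [mem_ofPred_eq, blaschke_eq_div, (denPoly_eval_eq_zero_iff hκ z).2 hpole, div_zero,
          norm_zero] at hB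
        exact absurd hB zero_ne_one
    · rw [OnePoint.coe_injective.mem_set_image, mem_sphere_zero_iff_norm]
      rfl

end

end BlaschkeType

end

theorem mainTheorem5 (m : ℕ) (hm : 1 ≤ m) (κ : Fin (m + 1) → ℕ) (hκ : ∀ j, 0 < κ j)
    (μ : BlaschkeType.Param m)
    (hμ : BlaschkeType.IsMultimodal (2 * m) (BlaschkeType.circleRestriction μ κ)) :
    ∃ Γ D : Fin m → Set ℂ,
      (∀ j, BlaschkeType.IsAnalyticJordanCurve (Γ j)) ∧
      BlaschkeType.blaschkeSphere μ κ ⁻¹' ((fun z : ℂ => (z : OnePoint ℂ)) '' Metric.sphere 0 1) =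
        (fun z : ℂ => (z : OnePoint ℂ)) '' (Metric.sphere 0 1 ∪ ⋃ j, Γ j) ∧
      (∀ j, BlaschkeType.IsInversionSymmetric (Γ j)) ∧
      (∀ j, ∃ c' c'' : ℂ, c' ≠ c'' ∧ Γ j ∩ Metric.sphere 0 1 = {c', c''} ∧
        BlaschkeType.IsCriticalPoint (BlaschkeType.blaschke μ κ) c' ∧
        BlaschkeType.IsCriticalPoint (BlaschkeType.blaschke μ κ) c'') ∧
      (∀ j, BlaschkeType.IsOpenDiskBoundedBy (D j) (Γ j)) ∧
      (∀ i j, i ≠ j → Disjoint (closure (D i)) (closure (D j))) ∧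
      (∀ j, μ.a j ∈ D j ∧ 1 / (starRingEnd ℂ) (μ.a j) ∈ D j) := by
  obtain ⟨k₀, ψ₀, k, ψ, D⟩ := (BlaschkeType.hasCircleCriticalPoints hκ hμ).exists_decomposition
  choose Ψ h using D.exists_symmetricParam
  refine ⟨fun j => Ψ j '' Metric.sphere 0 1, fun j => Ψ j '' Metric.ball 0 1,
    fun j => (h j).isAnalyticJordanCurve D, ?_, fun j => (h j).isInversionSymmetric,
    fun j => ⟨Ψ j 1, Ψ j (-1), (h j).one_ne_neg_one, (h j).inter_sphere,
      D.crit.isCriticalPoint (h j).crit_one, D.crit.isCriticalPoint (h j).crit_neg_one⟩,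
    fun j => BlaschkeType.isOpenDiskBoundedBy_image (h j).cont (h j).inj ((h j).isOpen_image_ball D),
    fun i j hij => (h j).disjoint_closure D hij (h i), fun j => (h j).a_mem D⟩
  rw [BlaschkeType.blaschkeSphere_preimage hκ]
  congr 1
  ext z
  rw [Set.mem_ofPred_eq, D.norm_blaschke_eq_one_iff_mem h z, Set.mem_union, Set.mem_iUnion,
    mem_sphere_zero_iff_norm]
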